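/- **Setting.** There are $K$ arms, a horizon $T$, and changepoints $1=\nu_0<\nu_1<\dots<\nu_{M-1}<\nu_M=T+1$, which divide $\{1,\dots,T\}$ into $M$ stationary segments $S_m=\{\nu_{m-1},\dots,\nu_m-1\}$. Segment $S_m$ has a preference matrix $P^{(m)}=(p^{(m)}_{i,j})\in[0,1]^{K\times K}$ with $p^{(m)}_{i,j}+p^{(m)}_{j,i}=1$ and a Condorcet winner $m^*$, that is, $p^{(m)}_{m^*,i}>\frac12$ for all $i\neq m^*$. If the pair $(i,j)$ is played at time $t\in S_m$, the outcome $X^{(t)}_{i,j}\sim\mathrm{Ber}(p^{(m)}_{i,j})$ is observed; all $X^{(t)}_{i,j}$ are mutually independent. With $\Delta^{(m)}_i=p^{(m)}_{m^*,i}-\frac12$, playing $(I_t,J_t)$ at time $t\in S_m$ costs the binary strong regret $\lceil(\Delta^{(m)}_{I_t}+\Delta^{(m)}_{J_t})/2\rceil$, and $R^{\bar{\mathrm S}}(T)$ is its sum over $t=1,\dots,T$. **Algorithm.** Monitored Dueling Bandits (MDB) has as parameters an even integer $w\ge 2$, a threshold $b>0$, a rate $\gamma\in(0,1]$, an ordering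 $O$ (counting from $0$) of the pairs $(i,j)$ with $i<j$, and a (possibly randomized) black-box dueling bandits algorithm $Alg$. Let $d=\lfloor K(K-1)/(2\gamma)\rfloor$. Initially $\tau=0$. At time $t$ let $r=(t-\tau-1)\bmod d$. If $r<K(K-1)/2$, MDB plays the $r$-th pair $(i,j)$ of $O$ and records the outcome as the next detection sample of this pair; if this pair now has at least $w$ samples since the last reset and, among its $w$ most recent ones, the numbers of wins in the older $w/2$ and in the newer $w/2$ differ by more than $b$, then the changepoint detection is triggered: $\tau$ is set to $t$, all detection samples are discarded, and $Alg$ is reset to its initial state. If $r\ge K(K-1)/2$, MDB plays the pair selected by $Alg$ and forwards the outcome to $Alg$. MDB initialized at time $s$ is the same procedure with first time step $s$ and initially $\tau=s-1$. **Assumptions.** Put $L=w\,d$ and $\delta^{(m)}=\max_{i,j}|p^{(m+1)}_{i,j}-p^{(m)}_{i,j}|$ for $1\le m\le M-1$. Suppose 1. $|S_m|\ge 2L$ for all $m\in\{1,\dots,M\}$; 2. there is $c>0$ with $\delta^{(m)}\ge\frac{2b}{w}+c$ for all $m\in\{1,\dots,M-1\}$; 3. $\gamma\in\left[\frac{K(K-1)}{2T},\frac{K-1}{2}\right]$.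 **Theorem 3.** Let $\tau_m$ be the first time step in $\{\nu_{m-1},\dots,T\}$ at which the changepoint detection is triggered when MDB is initialized at $\nu_{m-1}$ ($\tau_m=\infty$ if there is none). Let $p,q\in[0,1]$ be such that $\mathbb P(\tau_m<\nu_m)\le p$ for all $m\le M$ and $\mathbb P(\tau_m\ge\nu_m+L/2\mid\tau_m\ge\nu_m)\le q$ for all $m\le M-1$. Then the expected cumulative binary strong regret of MDB, initialized at time $1$, satisfies $$\mathbb E\big[R^{\bar{\mathrm S}}(T)\big]\le\frac{ML}{2}+2T\left(\frac{\gamma K}{K-1}+p+q\right)+\sum_{m=1}^{M}\mathbb E\big[\tilde R^{\bar{\mathrm S}}(\nu_{m-1},\nu_m-1)\big],$$ where $\tilde R^{\bar{\mathrm S}}(\nu_{m-1},\nu_m-1)$ is the cumulative binary strong regret that $Alg$ incurs when it is started in its initial state at time $\nu_{m-1}$ and run on its own until time $\nu_m-1$. -/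

import Mathlib

open MeasureTheory ProbabilityTheory

noncomputable section

/-- A non-stationary dueling bandits problem with arms `Fin K`, time steps `1, …, T` and `M`
stationary segments. Segments are indexed from `0`: segment `m : Fin M` consists of the time steps
`cp m.castSucc, …, cp m.succ - 1`, where `cp 0 = 1` and `cp M = T + 1` are the dummy changepoints.
In segment `m`, arm `i` wins against arm `j` with probability `P m i j`, and `best m` is the
Condorcet winner. -/
structure DuelingProblem (K T M : ℕ) where
  cp : Fin (M + 1) → ℕ
  cp_strictMono : StrictMono cp
  cp_zero : cp 0 = 1
  cp_last : cp (Fin.last M) = T + 1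
  P : Fin M → Matrix (Fin K) (Fin K) ℝ
  P_mem : ∀ m i j, P m i j ∈ Set.Icc (0 : ℝ) 1
  P_add : ∀ m i j, P m i j + P m j i = 1
  best : Fin M → Fin K
  best_wins : ∀ m i, i ≠ best m → 1 / 2 < P m (best m) i

namespace DuelingProblem

variable {K T M : ℕ} (E : DuelingProblem K T M)

/-- The time steps of the `m`-th stationary segment. -/
def segment (m : Fin M) : Finset ℕ := Finset.Ico (E.cp m.castSucc) (E.cp m.succ)

/-- The suboptimality gap of arm `i` in segment `m`. -/
def gap (m : Fin M) (i : Fin K) : ℝ := E.P m (E.best m) i - 1 / 2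

/-- The instantaneous strong regret of a pair of arms in segment `m`. -/
def strongRegret (m : Fin M) (a : Fin K × Fin K) : ℝ := (E.gap m a.1 + E.gap m a.2) / 2

/-- The instantaneous binary strong regret of a pair of arms in segment `m`. -/
def binaryStrongRegret (m : Fin M) (a : Fin K × Fin K) : ℝ := (⌈E.strongRegret m a⌉ : ℝ)

/-- The segmental change at the changepoint between the segments `m` and `m + 1`: the largest
absolute change of an entry of the preference matrix. -/
def change (m : Fin M) (h : (m : ℕ) + 1 < M) : ℝ :=
  ⨆ ij : Fin K × Fin K, |E.P ⟨m + 1, h⟩ ij.1 ij.2 - E.P m ij.1 ij.2|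

end DuelingProblem

/-- A (possibly randomized) black-box dueling bandits algorithm. In each of its time steps it
receives a fresh random seed, selects a pair of arms from its internal state and the seed, and,
after the outcome of the duel is forwarded to it, updates its internal state. -/
structure DuelingAlg (K : ℕ) (St Sd : Type*) [MeasurableSpace St] [MeasurableSpace Sd] where
  init : St
  select : St → Sd → Fin K × Fin K
  update : St → Sd → Bool → St
  measurable_select : Measurable (fun z : St × Sd => select z.1 z.2)
  measurable_update : Measurable (fun z : St × Sd × Bool => update z.1 z.2.1 z.2.2)

/-- The random experiment: `X t i j` is the outcome of a duel between `i` and `j` at time `t`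
(`true` if `i` wins), Bernoulli distributed with the parameter of the segment that contains `t`;
`ξ t` is the seed available to the black-box algorithm at time `t`. All outcomes and all seeds are
mutually independent, and the seeds are identically distributed. -/
structure DuelingProblem.IsExperiment {K T M : ℕ} (E : DuelingProblem K T M) {Ω Sd : Type*}
    [MeasurableSpace Ω] [MeasurableSpace Sd] (μ : Measure Ω)
    (X : ℕ → Fin K → Fin K → Ω → Bool) (ξ : ℕ → Ω → Sd) : Prop where
  measurable_outcome : ∀ t i j, Measurable (X t i j)
  measurable_seed : ∀ t, Measurable (ξ t)
  bernoulli : ∀ m, ∀ t ∈ E.segment m, ∀ i j, μ.real {ω | X t i j ω = true} = E.P m i j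
  indep_outcomes :
    iIndepFun (fun (c : Finset.Icc 1 T × Fin K × Fin K) => X c.1 c.2.1 c.2.2) μ
  indep_seeds : iIndepFun (fun (t : Finset.Icc 1 T) => ξ t) μ
  indep : IndepFun
    (fun ω (c : Finset.Icc 1 T × Fin K × Fin K) => X c.1 c.2.1 c.2.2 ω)
    (fun ω (t : Finset.Icc 1 T) => ξ t ω) μ
  identDistrib : ∀ s ∈ Finset.Icc 1 T, ∀ t ∈ Finset.Icc 1 T, IdentDistrib (ξ s) (ξ t) μ μ

/-! ### The black-box algorithm on its own -/

namespace DuelingAlg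

variable {K : ℕ} {St Sd : Type*} [MeasurableSpace St] [MeasurableSpace Sd] (A : DuelingAlg K St Sd)

/-- The internal state after `k` time steps when the algorithm is started at time `t₀` on its own,
with outcomes `x` and seeds `u`. -/
def stateFrom (x : ℕ → Fin K → Fin K → Bool) (u : ℕ → Sd) (t₀ : ℕ) : ℕ → St
  | 0 => A.init
  | k + 1 =>
    let s := stateFrom x u t₀ k
    let a := A.select s (u (t₀ + k))
    A.update s (u (t₀ + k)) (x (t₀ + k) a.1 a.2)

/-- The pair played at time `t ≥ t₀` when the algorithm is started at time `t₀` on its own. -/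
def played (x : ℕ → Fin K → Fin K → Bool) (u : ℕ → Sd) (t₀ t : ℕ) : Fin K × Fin K :=
  A.select (A.stateFrom x u t₀ (t - t₀)) (u t)

/-- The binary strong regret of the algorithm when run on its own during segment `m`, started at
the first time step of the segment. -/
def regretAlone {T M : ℕ} (E : DuelingProblem K T M)
    (x : ℕ → Fin K → Fin K → Bool) (u : ℕ → Sd) (m : Fin M) : ℝ :=
  ∑ t ∈ E.segment m, E.binaryStrongRegret m (A.played x u (E.cp m.castSucc) t)

end DuelingAlg

/-! ### Monitored Dueling Bandits -/

/-- The pairs of distinct arms, each counted once. -/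
abbrev DistinctPair (K : ℕ) : Type := {a : Fin K × Fin K // a.1 < a.2}

/-- Monitored Dueling Bandits, given by a window length `w`, a threshold `b`, an exploration rate
`γ`, an ordering of the pairs of distinct arms (counting from `0`), and a black-box algorithm. -/
structure MDB (K : ℕ) (St Sd : Type*) [MeasurableSpace St] [MeasurableSpace Sd] where
  w : ℕ
  b : ℝ
  γ : ℝ
  order : Fin (K * (K - 1) / 2) ≃ DistinctPair K
  alg : DuelingAlg K St Sd

/-- The memory of Monitored Dueling Bandits: the time `tau` of the last reset, the number `n a` of
detection samples of the pair `a` since then, the samples `obs a 1, …, obs a (n a)`, and the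
internal state of the black-box algorithm. -/
structure MDBState (K : ℕ) (St : Type*) where
  tau : ℕ
  n : DistinctPair K → ℕ
  obs : DistinctPair K → ℕ → Bool
  inner : St

namespace MDBState

variable {K : ℕ} {St : Type*}

/-- Append an outcome to the detection samples of the pair `a`. -/
def record (s : MDBState K St) (a : DistinctPair K) (o : Bool) : MDBState K St :=
  { s with
    n := Function.update s.n a (s.n a + 1)
    obs := Function.update s.obs a (Function.update (s.obs a) (s.n a + 1) o) }

/-- The number of wins among the samples of the pair `a` with index in `{k, …, l}`. -/
def wins (s : MDBState K St) (a : DistinctPair K) (k l : ℕ) : ℝ :=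
  ∑ r ∈ Finset.Icc k l, if s.obs a r = true then (1 : ℝ) else 0

/-- The detection window (of even length `w`) of the pair `a` is filled, and the numbers of wins in
its two halves differ by more than `b`. -/
def windowExceeds (s : MDBState K St) (w : ℕ) (b : ℝ) (a : DistinctPair K) : Prop :=
  w ≤ s.n a ∧
    b < |s.wins a (s.n a - w + 1) (s.n a - w / 2) - s.wins a (s.n a - w / 2 + 1) (s.n a)|

end MDBState

namespace MDB

variable {K : ℕ} {St Sd : Type*} [MeasurableSpace St] [MeasurableSpace Sd] (D : MDB K St Sd)

/-- The distance between two consecutive detection phases, `⌊K (K - 1) / (2 γ)⌋`. -/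
def period : ℕ := ⌊(K : ℝ) * ((K : ℝ) - 1) / (2 * D.γ)⌋₊

/-- The number `L` of time steps needed to fill all detection windows. -/
def L : ℕ := D.w * D.period

/-- The memory of MDB right after initialization such that time step `tau + 1` is the next one. -/
def fresh (tau : ℕ) : MDBState K St where
  tau := tau
  n := fun _ => 0
  obs := fun _ _ => false
  inner := D.alg.init

/-- The pair to be explored in a detection step at time `t`; `none` if the black-box algorithm is to
be run at time `t`. -/
def detectionPair (t : ℕ) (s : MDBState K St) : Option (DistinctPair K) :=
  if h : (t - s.tau - 1) % D.period < K * (K - 1) / 2 then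
    some (D.order ⟨(t - s.tau - 1) % D.period, h⟩)
  else none

/-- The pair of arms played at time `t` with seed `u`. -/
def pair (t : ℕ) (u : Sd) (s : MDBState K St) : Fin K × Fin K :=
  match D.detectionPair t s with
  | some a => a.1
  | none => D.alg.select s.inner u

/-- The changepoint detection is triggered at time `t` when the outcomes at time `t` are `x`. -/
def triggers (t : ℕ) (x : Fin K → Fin K → Bool) (s : MDBState K St) : Prop :=
  ∃ a, D.detectionPair t s = some a ∧
    (s.record a (x a.1.1 a.1.2)).windowExceeds D.w D.b a

open Classical in
/-- The memory of MDB after time step `t` with outcomes `x` and seed `u`. -/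
def next (t : ℕ) (x : Fin K → Fin K → Bool) (u : Sd) (s : MDBState K St) : MDBState K St :=
  if D.triggers t x s then D.fresh t
  else
    match D.detectionPair t s with
    | some a => s.record a (x a.1.1 a.1.2)
    | none =>
      { s with
        inner := D.alg.update s.inner u
          (x (D.alg.select s.inner u).1 (D.alg.select s.inner u).2) }

/-- The memory after `k` time steps when MDB is initialized at time `t₀`, that is, with `t₀` as its
first time step, for outcomes `x` and seeds `u`. -/
def stateFrom (x : ℕ → Fin K → Fin K → Bool) (u : ℕ → Sd) (t₀ : ℕ) : ℕ → MDBState K St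
  | 0 => D.fresh (t₀ - 1)
  | k + 1 => D.next (t₀ + k) (x (t₀ + k)) (u (t₀ + k)) (stateFrom x u t₀ k)

/-- The pair played at time `t ≥ t₀` when MDB is initialized at time `t₀`. -/
def played (x : ℕ → Fin K → Fin K → Bool) (u : ℕ → Sd) (t₀ t : ℕ) : Fin K × Fin K :=
  D.pair t (u t) (D.stateFrom x u t₀ (t - t₀))

/-- The first time step in `{t₀, …, T}` at which the changepoint detection is triggered when MDB is
initialized at time `t₀`; `⊤` if there is none. -/
def firstDetection (T : ℕ) (x : ℕ → Fin K → Fin K → Bool) (u : ℕ → Sd) (t₀ : ℕ) : ℕ∞ :=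
  ⨅ t ∈ {t : ℕ | t₀ ≤ t ∧ t ≤ T ∧ D.triggers t (x t) (D.stateFrom x u t₀ (t - t₀))}, (t : ℕ∞)

/-- The cumulative binary strong regret of MDB over all time steps `1, …, T`. -/
def regret {T M : ℕ} (E : DuelingProblem K T M)
    (x : ℕ → Fin K → Fin K → Bool) (u : ℕ → Sd) : ℝ :=
  ∑ m, ∑ t ∈ E.segment m, E.binaryStrongRegret m (D.played x u 1 t)

end MDB

end

-- Call a segment with first time step α and next changepoint β good if some reset happens at a time
-- s with α - 1 ≤ s < α + L/2 and, after the first such s, the detector sees no alarm before β. A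
-- good segment costs at most L/2 for the delay, one per exploration step, and the regret of a fresh
-- copy of `Alg` fed with data of this segment only. Any other segment costs at most its length. So
-- the core of the theorem is that a segment fails to be good (`MDB.Fails`) with probability at most
-- 2(p + q). The difficulty is that p and q concern an MDB initialized exactly at α, while the
-- actual last reset is random and failures carry over to later segments.
--
-- Alarms as events of the outcomes. Between two resets the detector inspects fixed windows, so
-- alarms and resets are functions of finitely many outcomes and do not involve the seeds
-- (`firstDetection_lt_iff`, `tau_stateFrom`). Events about disjoint sets of outcomes are
-- independent, and one can condition on the time of a reset (`outcomeProb_cut_le`).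
--
-- Alignment. Cut time into blocks of length d counted from β. Wherever the last reset was, a pair
-- is sampled once per period, at a fixed position in these blocks. Moving the samples within their
-- blocks turns the sampling times for a reset at s into those for an initialization at α without
-- crossing β, hence without changing the law (`prob_align`). A reset inside the segment, or an
-- earlier one whose samples before α + d are ignored, therefore has false alarm probability at most
-- p, and a false alarm or late detection has probability at most e = p + q(1 - p) = 1 - (1 - p)(1 -
-- q). `prob_delay_le` refines this by allowing a further event that depends on samples from β on.
--
-- Recursion. For a segment let f be the probability of no reset in {α - 1, …, α + L/2 - 1}, let ρ
-- be that of no reset in {α - 1, …, β - L - 1}, and let y be that of the latter event together with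
-- a bad detection by the old detector. With primes for the next segment and κ = pe + q(1 - p), one
-- has f' ≤ e(1 - ρ) + y, y ≤ p + ef and y' ≤ κ(1 - ρ) + ey + κf. The failure probability is at most
-- p + (1 - p)f, so (1 - p)f ≤ p + 2q suffices, and it is proved by induction from f = 0 in the
-- first segment. The first two inequalities are enough when p ≤ q; when q ≤ p the third one is
-- needed, with a second invariant bounding y. If p + q > 1/2 there is nothing to prove.
--
-- Regret of `Alg`. The event that s is the first reset is decided by the outcomes up to s, whereas
-- `Alg` then uses later data. Its time steps are distinct steps of one segment, on which the data
-- are i.i.d., so its expected regret is at most that of `Alg` run alone. Summing over the disjoint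
-- values of s keeps this bound (`integral_exploitRegret_le`).

open MeasureTheory ProbabilityTheory

noncomputable section

set_option linter.unusedSectionVars false

/-! ### The detection mechanism as a function of the outcomes -/

namespace MDB

variable {K : ℕ} {St Sd : Type*} [MeasurableSpace St] [MeasurableSpace Sd] (D : MDB K St Sd)

/-- The position of the pair `a` in the ordering. -/
def idx (a : DistinctPair K) : ℕ := (D.order.symm a : ℕ)

/-- The numbers of wins of the pair `a` in the two halves of its detection window, when the window
consists of the outcomes at the times `t, t - d, …, t - (w - 1) d`, differ by more than `b`. -/
def Exceeds (x : ℕ → Fin K → Fin K → Bool) (a : DistinctPair K) (t : ℕ) : Prop :=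
  D.b < |(∑ k ∈ Finset.Ico (D.w / 2) D.w,
      if x (t - k * D.period) a.1.1 a.1.2 = true then (1 : ℝ) else 0) -
    ∑ k ∈ Finset.range (D.w / 2), if x (t - k * D.period) a.1.1 a.1.2 = true then (1 : ℝ) else 0|

/-- The detection triggers at time `t` if the last reset was at time `s`. -/
def AlarmAt (x : ℕ → Fin K → Fin K → Bool) (s t : ℕ) : Prop :=
  ∃ a, s + 1 + (D.w - 1) * D.period ≤ t ∧ (t - s - 1) % D.period = D.idx a ∧ D.Exceeds x a t

/-- With detection phases aligned to a reset at time `s`, some detection window contained in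
`{u, …, v - 1}` exceeds the threshold. -/
def Alarm (x : ℕ → Fin K → Fin K → Bool) (s u v : ℕ) : Prop :=
  ∃ a t, u + (D.w - 1) * D.period ≤ t ∧ t < v ∧ (t - s - 1) % D.period = D.idx a ∧ D.Exceeds x a t

open Classical in
/-- The time of the last reset before time `t`, when the algorithm is initialized at time `1`. -/
def lastReset (x : ℕ → Fin K → Fin K → Bool) : ℕ → ℕ
  | 0 => 0
  | t + 1 => if D.AlarmAt x (lastReset x t) t then t else lastReset x t

variable {D}

lemma idx_lt (a : DistinctPair K) : D.idx a < K * (K - 1) / 2 := (D.order.symm a).2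

/-- The memory before time `t` is determined by the outcomes since the last reset. -/
structure Tracks (D : MDB K St Sd) (x : ℕ → Fin K → Fin K → Bool) (t : ℕ)
    (s : MDBState K St) : Prop where
  lt : s.tau < t
  n_eq : ∀ a, s.n a = (t - s.tau - 1 + (D.period - 1 - D.idx a)) / D.period
  obs_eq : ∀ a k, k < s.n a →
    s.obs a (k + 1) = x (s.tau + 1 + D.idx a + k * D.period) a.1.1 a.1.2

lemma tracks_fresh (hd : K * (K - 1) / 2 ≤ D.period) (x : ℕ → Fin K → Fin K → Bool) (t : ℕ) :
    D.Tracks x (t + 1) (D.fresh t) := by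
  have hn : ∀ a, (t + 1 - t - 1 + (D.period - 1 - D.idx a)) / D.period = 0 := by
    intro a
    have := D.idx_lt a
    apply Nat.div_eq_of_lt
    omega
  refine ⟨by simp [fresh], fun a => ?_, fun a k hk => ?_⟩
  · simp only [fresh]
    exact (hn a).symm
  · simp [fresh] at hk

lemma detectionPair_eq_some {t : ℕ} {s : MDBState K St} {a : DistinctPair K} :
    D.detectionPair t s = some a ↔ (t - s.tau - 1) % D.period = D.idx a := by
  unfold detectionPair idx
  split_ifs with h
  · rw [Option.some.injEq, ← Equiv.eq_symm_apply, Fin.ext_iff]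
  · simp only [false_iff]
    intro h'
    exact h (h' ▸ (D.order.symm a).2)

lemma detectionPair_eq_none {t : ℕ} {s : MDBState K St} :
    D.detectionPair t s = none ↔ ¬ (t - s.tau - 1) % D.period < K * (K - 1) / 2 := by
  unfold detectionPair
  split_ifs with h <;> simp [h]

/-- The quotient `(l + (d - 1 - i)) / d` counts the k < l with k % d = i. It jumps exactly when d
divides l + (d - i), that is, when l itself has residue i. -/
lemma n_step {l d i : ℕ} (hi : i < d) :
    (l + 1 + (d - 1 - i)) / d = (l + (d - 1 - i)) / d + if l % d = i then 1 else 0 := by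
  have h1 : l + 1 + (d - 1 - i) = l + (d - 1 - i) + 1 := by omega
  rw [h1, Nat.succ_div]
  congr 1
  have h2 : l + (d - 1 - i) + 1 = l + (d - i) := by omega
  rw [h2]
  have : d ∣ l + (d - i) ↔ l % d = i := by
    have hl := Nat.div_add_mod l d
    have hlt := Nat.mod_lt l (by omega : 0 < d)
    constructor
    · intro h
      have h3 : d ∣ l % d + (d - i) := by
        rw [← hl, add_assoc] at h
        exact (Nat.dvd_add_right (dvd_mul_right _ _)).1 h
      obtain ⟨c, hc⟩ := h3
      have : c = 1 := by
        rcases c with _ | _ | c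
        · omega
        · rfl
        · have : d * (c + 1 + 1) = d * c + d + d := by ring
          have := Nat.zero_le (d * c)
          omega
      subst this
      omega
    · intro h
      have : l + (d - i) = d * (l / d) + d := by omega
      rw [this]
      exact ⟨l / d + 1, by ring⟩
  simp [this]

lemma n_at {l d i : ℕ} (hi : i < d) (h : l % d = i) : (l + (d - 1 - i)) / d = l / d := by
  have hl := Nat.div_add_mod l d
  have : l + (d - 1 - i) = (d - 1) + d * (l / d) := by omega
  rw [this, Nat.add_mul_div_left _ _ (by omega), Nat.div_eq_of_lt (by omega), zero_add]

lemma Tracks.record (hd : K * (K - 1) / 2 ≤ D.period) {x : ℕ → Fin K → Fin K → Bool} {t : ℕ}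
    {s : MDBState K St} (h : D.Tracks x t s) {a : DistinctPair K}
    (ha : (t - s.tau - 1) % D.period = D.idx a) :
    D.Tracks x (t + 1) (s.record a (x t a.1.1 a.1.2)) := by
  have hlt := h.lt
  have hia := D.idx_lt a
  have hn : ∀ c, (s.record a (x t a.1.1 a.1.2)).n c =
      (t + 1 - s.tau - 1 + (D.period - 1 - D.idx c)) / D.period := by
    intro c
    have hic := D.idx_lt c
    have e : t + 1 - s.tau - 1 = (t - s.tau - 1) + 1 := by omega
    rw [e, n_step (by omega), ← h.n_eq c]
    by_cases hc : c = a
    · subst hc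
      simp [MDBState.record, ha]
    · have : D.idx a ≠ D.idx c := by
        intro h'
        exact hc (D.order.symm.injective (Fin.ext h'.symm))
      simp [MDBState.record, ha, hc, this]
  refine ⟨Nat.lt_succ_of_lt hlt, hn, fun c k hk => ?_⟩
  by_cases hc : c = a
  · subst hc
    simp only [MDBState.record, Function.update_self] at hk ⊢
    by_cases hk' : k = s.n c
    · subst hk'
      rw [Function.update_self, h.n_eq c, n_at (by omega) ha]
      have := Nat.div_add_mod (t - s.tau - 1) D.period
      have e : s.tau + 1 + D.idx c + (t - s.tau - 1) / D.period * D.period = t := by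
        rw [mul_comm]; omega
      rw [e]
    · rw [Function.update_of_ne (by omega)]
      exact h.obs_eq c k (by omega)
  · simp only [MDBState.record, Function.update_of_ne hc] at hk ⊢
    exact h.obs_eq c k hk

/-- Right after a sample of `a` at time t, the sample with index `n a - k` was taken at time t - k
d. The older half of the window therefore corresponds to w/2 ≤ k < w and the newer half to k < w/2,
and the window is full exactly when t - (w - 1) d lies after the reset. -/
lemma windowExceeds_iff {x : ℕ → Fin K → Fin K → Bool} {t : ℕ} {s : MDBState K St}
    {a : DistinctPair K} (hd : D.idx a < D.period) (hw : 0 < D.w) (h : D.Tracks x (t + 1) s)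
    (hs : s.tau < t) (ha : (t - s.tau - 1) % D.period = D.idx a) :
    s.windowExceeds D.w D.b a ↔ s.tau + 1 + (D.w - 1) * D.period ≤ t ∧ D.Exceeds x a t := by
  have hn : s.n a = (t - s.tau - 1) / D.period + 1 := by
    have e : t + 1 - s.tau - 1 = (t - s.tau - 1) + 1 := by omega
    rw [h.n_eq a, e, n_step hd, if_pos ha, n_at hd ha]
  have ht : t = s.tau + 1 + D.idx a + (s.n a - 1) * D.period := by
    have := Nat.div_add_mod (t - s.tau - 1) D.period
    rw [hn, Nat.add_sub_cancel, mul_comm]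
    omega
  have hle : D.w ≤ s.n a ↔ s.tau + 1 + (D.w - 1) * D.period ≤ t := by
    have h1 : D.w ≤ s.n a ↔ D.w - 1 ≤ (t - s.tau - 1) / D.period := by omega
    rw [h1, Nat.le_div_iff_mul_le (by omega)]
    omega
  unfold MDBState.windowExceeds
  rw [hle]
  refine and_congr_right fun hwin => ?_
  have hwn := hle.2 hwin
  have hobs : ∀ k < s.n a, s.obs a (s.n a - k) = x (t - k * D.period) a.1.1 a.1.2 := by
    intro k hk
    have := h.obs_eq a (s.n a - 1 - k) (by omega)
    rw [show s.n a - 1 - k + 1 = s.n a - k by omega] at this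
    rw [this]
    congr 1
    have e : (s.n a - 1 - k) * D.period + k * D.period = (s.n a - 1) * D.period := by
      rw [← add_mul]
      congr 1
      omega
    omega
  have hsum : ∀ l m, l ≤ m → m ≤ D.w → s.wins a (s.n a - m + 1) (s.n a - l) =
      ∑ k ∈ Finset.Ico l m, if x (t - k * D.period) a.1.1 a.1.2 = true then (1 : ℝ) else 0 := by
    intro l m hlm hmw
    unfold MDBState.wins
    refine Finset.sum_nbij' (fun r => s.n a - r) (fun k => s.n a - k) ?_ ?_ ?_ ?_ ?_
    · intro r hr
      simp only [Finset.mem_Icc, Finset.mem_Ico] at hr ⊢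
      omega
    · intro r hr
      simp only [Finset.mem_Icc, Finset.mem_Ico] at hr ⊢
      omega
    · intro r hr
      simp only [Finset.mem_Icc] at hr ⊢
      omega
    · intro r hr
      simp only [Finset.mem_Ico] at hr ⊢
      omega
    · intro r hr
      simp only [Finset.mem_Icc] at hr
      rw [← hobs (s.n a - r) (by omega), show s.n a - (s.n a - r) = r by omega]
  have h1 := hsum (D.w / 2) D.w (by omega) le_rfl
  have h2 := hsum 0 (D.w / 2) (by omega) (by omega)
  rw [Nat.sub_zero, Nat.Ico_zero_eq_range] at h2
  rw [h1, h2]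
  rfl

lemma Tracks.triggers_iff (hd : K * (K - 1) / 2 ≤ D.period) (hw : 0 < D.w)
    {x : ℕ → Fin K → Fin K → Bool} {t : ℕ} {s : MDBState K St} (h : D.Tracks x t s) :
    D.triggers t (x t) s ↔ D.AlarmAt x s.tau t := by
  unfold triggers AlarmAt
  refine exists_congr fun a => ?_
  rw [detectionPair_eq_some]
  have hia := D.idx_lt a
  by_cases ha : (t - s.tau - 1) % D.period = D.idx a
  · have := windowExceeds_iff (by omega) hw (h.record hd ha) h.lt ha
    rw [this]
    simp only [ha, true_and]
    rfl
  · simp [ha]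

lemma Tracks.next (hd : K * (K - 1) / 2 ≤ D.period)
    {x : ℕ → Fin K → Fin K → Bool} {t : ℕ} (u : Sd)
    {s : MDBState K St} (h : D.Tracks x t s) :
    D.Tracks x (t + 1) (D.next t (x t) u s) := by
  unfold MDB.next
  split_ifs with htr
  · exact tracks_fresh hd x t
  · rcases hp : D.detectionPair t s with _ | a
    · rw [detectionPair_eq_none] at hp
      have hlt := h.lt
      refine ⟨Nat.lt_succ_of_lt hlt, fun c => ?_, h.obs_eq⟩
      have hic := D.idx_lt c
      have e : t + 1 - s.tau - 1 = (t - s.tau - 1) + 1 := by omega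
      simp only
      rw [e, n_step (by omega), if_neg (by omega), add_zero, h.n_eq]
    · exact h.record hd (detectionPair_eq_some.1 hp)

lemma tracks_stateFrom (hd : K * (K - 1) / 2 ≤ D.period) (x : ℕ → Fin K → Fin K → Bool)
    (u : ℕ → Sd) (t₀ : ℕ) (ht₀ : 0 < t₀) (k : ℕ) :
    D.Tracks x (t₀ + k) (D.stateFrom x u t₀ k) := by
  induction k with
  | zero =>
    have := tracks_fresh (D := D) hd x (t₀ - 1)
    rwa [Nat.sub_add_cancel ht₀] at this
  | succ k ih => exact ih.next hd (u (t₀ + k))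

lemma next_tau (t : ℕ) (x : Fin K → Fin K → Bool) (u : Sd) (s : MDBState K St)
    [Decidable (D.triggers t x s)] :
    (D.next t x u s).tau = if D.triggers t x s then t else s.tau := by
  unfold MDB.next
  split_ifs
  · rfl
  · rcases D.detectionPair t s with _ | a <;> rfl

/-- This removes the seeds and the black-box algorithm from the analysis of resets: the right-hand
side is a recursion on the outcomes alone. -/
lemma tau_stateFrom (hd : K * (K - 1) / 2 ≤ D.period) (hw : 0 < D.w)
    (x : ℕ → Fin K → Fin K → Bool) (u : ℕ → Sd) (k : ℕ) :
    (D.stateFrom x u 1 k).tau = D.lastReset x (1 + k) := by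
  classical
  induction k with
  | zero =>
    have : ¬ D.AlarmAt x 0 0 := by
      rintro ⟨a, h, -⟩
      omega
    simp [stateFrom, fresh, lastReset, this]
  | succ k ih =>
    change (D.next _ _ _ _).tau = _
    have h := (tracks_stateFrom (D := D) hd x u 1 one_pos k).triggers_iff hd hw
    rw [ih] at h
    rw [next_tau, ← Nat.add_assoc 1 k 1]
    simp only [h, ih, lastReset]

/-- The first detection happens before time `v` exactly if some window exceeds the threshold. -/
lemma firstDetection_lt_iff (hd : K * (K - 1) / 2 ≤ D.period) (hw : 0 < D.w)
    (x : ℕ → Fin K → Fin K → Bool) (u : ℕ → Sd) {T t₀ v : ℕ} (ht₀ : 0 < t₀) (hv : v ≤ T + 1) :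
    D.firstDetection T x u t₀ < (v : ℕ∞) ↔ D.Alarm x (t₀ - 1) t₀ v := by
  have htr : ∀ k, D.triggers (t₀ + k) (x (t₀ + k)) (D.stateFrom x u t₀ k) ↔
      D.AlarmAt x (D.stateFrom x u t₀ k).tau (t₀ + k) :=
    fun k => (tracks_stateFrom hd x u t₀ ht₀ k).triggers_iff hd hw
  have htau : ∀ k, (∀ j < k, ¬ D.triggers (t₀ + j) (x (t₀ + j)) (D.stateFrom x u t₀ j)) →
      (D.stateFrom x u t₀ k).tau = t₀ - 1 := by
    classical
    intro k
    induction k with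
    | zero => intro _; rfl
    | succ k ih =>
      intro h
      change (D.next _ _ _ _).tau = _
      rw [next_tau, if_neg (h k (Nat.lt_succ_self k)), ih fun j hj => h j (by omega)]
  have hlt : D.firstDetection T x u t₀ < (v : ℕ∞) ↔
      ∃ k, t₀ + k < v ∧ D.triggers (t₀ + k) (x (t₀ + k)) (D.stateFrom x u t₀ k) := by
    unfold firstDetection
    simp only [iInf_lt_iff, Set.mem_ofPred_eq, Nat.cast_lt]
    constructor
    · rintro ⟨t, ⟨h1, -, h3⟩, h4⟩
      refine ⟨t - t₀, by omega, ?_⟩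
      rwa [show t₀ + (t - t₀) = t by omega]
    · rintro ⟨k, h1, h2⟩
      refine ⟨t₀ + k, ⟨by omega, by omega, ?_⟩, h1⟩
      rwa [show t₀ + k - t₀ = k by omega]
  rw [hlt]
  constructor
  · intro h
    classical
    obtain ⟨h1, h2⟩ := Nat.find_spec h
    -- Up to the first trigger the phases are still those of the initialization, so this trigger is
    -- an alarm for a reset at `t₀ - 1`.
    have h3 := htau (Nat.find h) fun j hj hj' => Nat.find_min h hj ⟨by omega, hj'⟩
    rw [htr, h3] at h2
    obtain ⟨a, ha1, ha2, ha3⟩ := h2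
    exact ⟨a, _, by omega, h1, ha2, ha3⟩
  · rintro ⟨a, t, h1, h2, h3, h4⟩
    by_contra hno
    push Not at hno
    have h5 := htau (t - t₀) fun j hj => hno j (by omega)
    refine hno (t - t₀) (by omega) ?_
    rw [htr, h5]
    refine ⟨a, ?_, ?_, ?_⟩ <;> rw [show t₀ + (t - t₀) = t by omega]
    · omega
    · exact h3
    · exact h4

end MDB

-- Properties determined by a set of outcomes.

/-- A property of the outcomes depends only on the outcomes with indices in `C`. -/
def OutcomesDependOn {K : ℕ} (A : (ℕ → Fin K → Fin K → Bool) → Prop)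
    (C : Set (ℕ × Fin K × Fin K)) : Prop :=
  ∀ x y, (∀ c ∈ C, x c.1 c.2.1 c.2.2 = y c.1 c.2.1 c.2.2) → (A x ↔ A y)

/-- The indices of the outcomes at the time steps `u, …, v - 1`. -/
def timeBlock (K u v : ℕ) : Set (ℕ × Fin K × Fin K) := {c | u ≤ c.1 ∧ c.1 < v}

namespace OutcomesDependOn

variable {K : ℕ} {A B : (ℕ → Fin K → Fin K → Bool) → Prop} {C C' : Set (ℕ × Fin K × Fin K)}

lemma mono (h : OutcomesDependOn A C) (hC : C ⊆ C') : OutcomesDependOn A C' :=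
  fun x y hxy => h x y fun c hc => hxy c (hC hc)

lemma and (hA : OutcomesDependOn A C) (hB : OutcomesDependOn B C) :
    OutcomesDependOn (fun x => A x ∧ B x) C :=
  fun x y hxy => and_congr (hA x y hxy) (hB x y hxy)

lemma or (hA : OutcomesDependOn A C) (hB : OutcomesDependOn B C) :
    OutcomesDependOn (fun x => A x ∨ B x) C :=
  fun x y hxy => or_congr (hA x y hxy) (hB x y hxy)

lemma not (hA : OutcomesDependOn A C) : OutcomesDependOn (fun x => ¬ A x) C :=
  fun x y hxy => not_congr (hA x y hxy)

lemma const (p : Prop) : OutcomesDependOn (fun _ : ℕ → Fin K → Fin K → Bool => p) C :=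
  fun _ _ _ => Iff.rfl

lemma exists' {ι : Type*} {A : ι → (ℕ → Fin K → Fin K → Bool) → Prop}
    (h : ∀ i, OutcomesDependOn (A i) C) : OutcomesDependOn (fun x => ∃ i, A i x) C :=
  fun x y hxy => exists_congr fun i => h i x y hxy

lemma forall' {ι : Type*} {A : ι → (ℕ → Fin K → Fin K → Bool) → Prop}
    (h : ∀ i, OutcomesDependOn (A i) C) : OutcomesDependOn (fun x => ∀ i, A i x) C :=
  fun x y hxy => forall_congr' fun i => h i x y hxy

lemma and_of_imp {p : Prop} (h : p → OutcomesDependOn A C) :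
    OutcomesDependOn (fun x => p ∧ A x) C :=
  fun x y hxy => and_congr_right fun hp => h hp x y hxy

lemma imp_of_imp {p : Prop} (h : p → OutcomesDependOn A C) :
    OutcomesDependOn (fun x => p → A x) C :=
  fun x y hxy => imp_congr_right fun hp => h hp x y hxy

end OutcomesDependOn

lemma timeBlock_mono {K u v u' v' : ℕ} (hu : u' ≤ u) (hv : v ≤ v') :
    timeBlock K u v ⊆ timeBlock K u' v' := by
  rintro c ⟨h1, h2⟩
  exact ⟨by omega, by omega⟩

-- Which outcomes determine alarms and resets.

namespace MDB

variable {K : ℕ} {St Sd : Type*} [MeasurableSpace St] [MeasurableSpace Sd] {D : MDB K St Sd}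

/-- The indices of the detection samples taken at the times `u, …, v - 1` when the detection phases
are aligned to a reset at time `s`. -/
def sampleBlock (D : MDB K St Sd) (s u v : ℕ) : Set (ℕ × Fin K × Fin K) :=
  {c | u ≤ c.1 ∧ c.1 < v ∧
    ∃ a : DistinctPair K, a.1 = c.2 ∧ (c.1 - s - 1) % D.period = D.idx a}

lemma sampleBlock_subset (s u v : ℕ) : D.sampleBlock s u v ⊆ timeBlock K u v :=
  fun _ hc => ⟨hc.1, hc.2.1⟩

lemma sampleBlock_mono {s u v u' v' : ℕ} (hu : u' ≤ u) (hv : v ≤ v') :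
    D.sampleBlock s u v ⊆ D.sampleBlock s u' v' := by
  rintro c ⟨h1, h2, h3⟩
  exact ⟨by omega, by omega, h3⟩

lemma alarm_succ_iff {x : ℕ → Fin K → Fin K → Bool} {s v : ℕ} :
    D.Alarm x s (s + 1) v ↔ ∃ t < v, D.AlarmAt x s t := by
  constructor
  · rintro ⟨a, t, h1, h2, h3⟩
    exact ⟨t, h2, a, h1, h3⟩
  · rintro ⟨t, h2, a, h1, h3⟩
    exact ⟨a, t, h1, h2, h3⟩

lemma Alarm.mono {x : ℕ → Fin K → Fin K → Bool} {s u v u' v' : ℕ} (h : D.Alarm x s u v)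
    (hu : u' ≤ u) (hv : v ≤ v') : D.Alarm x s u' v' := by
  obtain ⟨a, t, h1, h2, h3⟩ := h
  exact ⟨a, t, by omega, by omega, h3⟩

lemma AlarmAt.alarm {x : ℕ → Fin K → Fin K → Bool} {s t u v : ℕ} (h : D.AlarmAt x s t)
    (hu : u + (D.w - 1) * D.period ≤ t) (hv : t < v) : D.Alarm x s u v := by
  obtain ⟨a, -, h3⟩ := h
  exact ⟨a, t, hu, hv, h3⟩

lemma window_le {k w d : ℕ} (hk : k < w) : k * d ≤ (w - 1) * d :=
  Nat.mul_le_mul_right d (by omega)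

lemma sub_window_mod {t s k d : ℕ} (h : s + 1 + k * d ≤ t) :
    (t - k * d - s - 1) % d = (t - s - 1) % d := by
  have e : t - s - 1 = t - k * d - s - 1 + k * d := by omega
  rw [e, Nat.add_mul_mod_self_right]

lemma exceeds_congr {x y : ℕ → Fin K → Fin K → Bool} {a : DistinctPair K} {t t' : ℕ}
    (h : ∀ k < D.w, x (t - k * D.period) a.1.1 a.1.2 = y (t' - k * D.period) a.1.1 a.1.2) :
    D.Exceeds x a t ↔ D.Exceeds y a t' := by
  unfold Exceeds
  have h1 : (∑ k ∈ Finset.Ico (D.w / 2) D.w,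
      if x (t - k * D.period) a.1.1 a.1.2 = true then (1 : ℝ) else 0) =
      ∑ k ∈ Finset.Ico (D.w / 2) D.w,
        if y (t' - k * D.period) a.1.1 a.1.2 = true then (1 : ℝ) else 0 := by
    refine Finset.sum_congr rfl fun k hk => ?_
    rw [h k (Finset.mem_Ico.1 hk).2]
  have h2 : (∑ k ∈ Finset.range (D.w / 2),
      if x (t - k * D.period) a.1.1 a.1.2 = true then (1 : ℝ) else 0) =
      ∑ k ∈ Finset.range (D.w / 2),
        if y (t' - k * D.period) a.1.1 a.1.2 = true then (1 : ℝ) else 0 := by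
    refine Finset.sum_congr rfl fun k hk => ?_
    have := Finset.mem_range.1 hk
    rw [h k (by omega)]
  rw [h1, h2]

lemma exceeds_dependsOn {a : DistinctPair K} {s u v t : ℕ} (hs : s < u)
    (hu : u + (D.w - 1) * D.period ≤ t) (hv : t < v)
    (ha : (t - s - 1) % D.period = D.idx a) :
    OutcomesDependOn (fun x => D.Exceeds x a t) (D.sampleBlock s u v) := by
  intro x y hxy
  refine exceeds_congr fun k hk => hxy (t - k * D.period, a.1) ⟨?_, ?_, a, rfl, ?_⟩
  · have := window_le (d := D.period) hk
    dsimp only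
    omega
  · dsimp only
    omega
  · have := window_le (d := D.period) hk
    rw [sub_window_mod (by omega), ha]

/-- The exact sampling positions are recorded, not just the time range, because the change of time
used for alignment is controlled only on them. -/
lemma alarm_dependsOn {s u v : ℕ} (hs : s < u) :
    OutcomesDependOn (fun x => D.Alarm x s u v) (D.sampleBlock s u v) :=
  .exists' fun _ => .exists' fun _ => .and_of_imp fun h1 => .and_of_imp fun h2 =>
    .and_of_imp fun h3 => exceeds_dependsOn hs h1 h2 h3

lemma alarm_dependsOn' {s u v : ℕ} (hs : s < u) :
    OutcomesDependOn (fun x => D.Alarm x s u v) (timeBlock K u v) :=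
  (alarm_dependsOn hs).mono (sampleBlock_subset s u v)

lemma alarmAt_dependsOn (s t : ℕ) :
    OutcomesDependOn (fun x => D.AlarmAt x s t) (timeBlock K (s + 1) (t + 1)) :=
  OutcomesDependOn.mono (.exists' fun _ => .and_of_imp fun h1 => .and_of_imp fun h2 =>
    exceeds_dependsOn (Nat.lt_succ_self s) h1 (Nat.lt_succ_self t) h2) (sampleBlock_subset s _ _)

lemma lastReset_congr {x y : ℕ → Fin K → Fin K → Bool} {t : ℕ}
    (h : ∀ c ∈ timeBlock K 1 t, x c.1 c.2.1 c.2.2 = y c.1 c.2.1 c.2.2) :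
    D.lastReset x t = D.lastReset y t := by
  induction t with
  | zero => rfl
  | succ t ih =>
    have ih := ih fun c hc => h c (timeBlock_mono le_rfl (Nat.le_succ t) hc)
    have : D.AlarmAt x (D.lastReset y t) t ↔ D.AlarmAt y (D.lastReset y t) t :=
      alarmAt_dependsOn (D.lastReset y t) t x y fun c hc =>
        h c (timeBlock_mono (by omega) le_rfl hc)
    rw [lastReset, lastReset, ih]
    by_cases hA : D.AlarmAt y (D.lastReset y t) t
    · rw [if_pos hA, if_pos (this.2 hA)]
    · rw [if_neg hA, if_neg (mt this.1 hA)]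

lemma lastReset_dependsOn (p : ℕ → Prop) (t : ℕ) :
    OutcomesDependOn (fun x => p (D.lastReset x t)) (timeBlock K 1 t) := by
  intro x y hxy
  simp only [lastReset_congr hxy]

lemma lastReset_succ_le (x : ℕ → Fin K → Fin K → Bool) (t : ℕ) : D.lastReset x (t + 1) ≤ t := by
  induction t with
  | zero =>
    rw [lastReset]
    split_ifs <;> rfl
  | succ t ih =>
    rw [lastReset]
    split_ifs <;> omega

lemma lastReset_lt (x : ℕ → Fin K → Fin K → Bool) {t : ℕ} (ht : 0 < t) : D.lastReset x t < t := by
  obtain ⟨t, rfl⟩ := Nat.exists_eq_succ_of_ne_zero ht.ne'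
  have := D.lastReset_succ_le x t
  simp only [Nat.succ_eq_add_one]
  omega

lemma lastReset_eq_of_forall_ne {x : ℕ → Fin K → Fin K → Bool} {a b : ℕ} (hab : a ≤ b)
    (h : ∀ s, a ≤ s → s < b → D.lastReset x (s + 1) ≠ s) : D.lastReset x b = D.lastReset x a := by
  induction b, hab using Nat.le_induction with
  | base => rfl
  | succ b hab ih =>
    have h1 := h b hab (Nat.lt_succ_self b)
    rw [lastReset] at h1 ⊢
    split_ifs with h2
    · simp [h2] at h1
    · exact ih fun s hs hs' => h s hs (by omega)

lemma exists_reset_of_alarmAt {x : ℕ → Fin K → Fin K → Bool} {a b s t : ℕ}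
    (ha : D.lastReset x a = s) (hat : a ≤ t) (htb : t < b) (ht : D.AlarmAt x s t) :
    ∃ r, a ≤ r ∧ r < b ∧ D.lastReset x (r + 1) = r := by
  by_contra! hno
  have h1 := lastReset_eq_of_forall_ne hat fun r h1 h2 => hno r h1 (by omega)
  refine hno t hat htb ?_
  rw [lastReset, h1, ha, if_pos ht]

lemma lastReset_eq_of_forall_not_alarmAt {x : ℕ → Fin K → Fin K → Bool} {a b s : ℕ}
    (ha : D.lastReset x a = s) (hab : a ≤ b) (h : ∀ t, a ≤ t → t < b → ¬ D.AlarmAt x s t) :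
    D.lastReset x b = s := by
  induction b, hab using Nat.le_induction with
  | base => exact ha
  | succ b hab ih =>
    rw [lastReset, ih fun t h1 h2 => h t h1 (by omega), if_neg (h b hab (Nat.lt_succ_self b))]

end MDB

/-! ### Aligning the detection samples of two resets at a changepoint -/

namespace MDB

variable {K : ℕ} {St Sd : Type*} [MeasurableSpace St] [MeasurableSpace Sd] {D : MDB K St Sd}

/-- The shift that takes the sampling times of the pair `a` for detection phases starting at `a₁`
to those for detection phases starting at `a₂`, and preserves the numbers of samples before and
after `β`. -/
def phaseShift (D : MDB K St Sd) (a₁ a₂ β : ℕ) (a : DistinctPair K) : ℤ :=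
  ((a₂ : ℤ) + D.idx a - β) % (D.period : ℤ) - ((a₁ : ℤ) + D.idx a - β) % (D.period : ℤ)

lemma phaseShift_swap (a₁ a₂ β : ℕ) (a : DistinctPair K) :
    D.phaseShift a₂ a₁ β a = - D.phaseShift a₁ a₂ β a := by
  unfold phaseShift
  ring

lemma exists_eq_of_mod {t a₁ r d : ℕ} (h : a₁ ≤ t) (hr : (t - a₁) % d = r) :
    ∃ k : ℕ, t = a₁ + r + k * d := by
  refine ⟨(t - a₁) / d, ?_⟩
  have := Nat.div_add_mod (t - a₁) d
  rw [mul_comm]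
  omega

lemma abs_phaseShift_lt (hd : 0 < D.period) (a₁ a₂ β : ℕ) (a : DistinctPair K) :
    |D.phaseShift a₁ a₂ β a| < D.period := by
  unfold phaseShift
  have hd' : (0 : ℤ) < D.period := by exact_mod_cast hd
  have h1 := Int.emod_nonneg ((a₂ : ℤ) + D.idx a - β) hd'.ne'
  have h2 := Int.emod_nonneg ((a₁ : ℤ) + D.idx a - β) hd'.ne'
  have h3 := Int.emod_lt_of_pos ((a₂ : ℤ) + D.idx a - β) hd'
  have h4 := Int.emod_lt_of_pos ((a₁ : ℤ) + D.idx a - β) hd'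
  rw [abs_lt]
  omega

/-- Write t = β + m₁ + j d with 0 ≤ m₁ < d. The shift replaces the residue m₁ by the residue m₂ of
the other phase, so t stays in the block {β + j d, …, β + (j + 1) d - 1} and crosses no boundary β +
n d. -/
lemma phaseShift_spec (hd : 0 < D.period) {a₁ a₂ β t : ℕ} {a : DistinctPair K} (h : a₁ ≤ t)
    (hr : (t - a₁) % D.period = D.idx a) :
    (∀ n : ℕ, (t : ℤ) < β + n * D.period ↔
      (t : ℤ) + D.phaseShift a₁ a₂ β a < β + n * D.period) ∧
    ∃ k : ℤ, (t : ℤ) + D.phaseShift a₁ a₂ β a = a₂ + D.idx a + k * D.period := by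
  have hd' : (0 : ℤ) < D.period := by exact_mod_cast hd
  obtain ⟨k, hk⟩ := exists_eq_of_mod h hr
  have hk' : (t : ℤ) = a₁ + D.idx a + k * D.period := by exact_mod_cast hk
  unfold phaseShift
  have h1 := Int.emod_nonneg ((a₂ : ℤ) + D.idx a - β) hd'.ne'
  have h2 := Int.emod_nonneg ((a₁ : ℤ) + D.idx a - β) hd'.ne'
  have h3 := Int.emod_lt_of_pos ((a₂ : ℤ) + D.idx a - β) hd'
  have h4 := Int.emod_lt_of_pos ((a₁ : ℤ) + D.idx a - β) hd'
  have h5 := Int.emod_add_mul_ediv ((a₂ : ℤ) + D.idx a - β) D.period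
  have h6 := Int.emod_add_mul_ediv ((a₁ : ℤ) + D.idx a - β) D.period
  set m₁ := ((a₁ : ℤ) + D.idx a - β) % (D.period : ℤ)
  set m₂ := ((a₂ : ℤ) + D.idx a - β) % (D.period : ℤ)
  set q₁ := ((a₁ : ℤ) + D.idx a - β) / (D.period : ℤ)
  set q₂ := ((a₂ : ℤ) + D.idx a - β) / (D.period : ℤ)
  have key : ∀ (j m n : ℤ), 0 ≤ m → m < D.period →
      ((β : ℤ) + m + j * D.period < β + n * D.period ↔ j < n) := by
    intro j m n hm hm'
    constructor
    · intro h
      by_contra hj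
      push Not at hj
      have := mul_le_mul_of_nonneg_right hj hd'.le
      linarith
    · intro h
      have : j + 1 ≤ n := h
      have := mul_le_mul_of_nonneg_right this hd'.le
      linarith
  refine ⟨fun n => ?_, q₁ + k - q₂, ?_⟩
  · have e1 : (t : ℤ) = β + m₁ + (q₁ + k) * D.period := by linarith
    have e2 : (t : ℤ) + (m₂ - m₁) = β + m₂ + (q₁ + k) * D.period := by linarith
    rw [e2, key _ _ _ h1 h3, e1, key _ _ _ h2 h4]
  · linarith

/-- Samples at time `u` or later are mapped to samples at time `α` or later. -/
def Admissible (D : MDB K St Sd) (s u α : ℕ) : Prop :=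
  s < u ∧ ((u = s + 1 ∧ α ≤ u) ∨ α + D.period ≤ u)

/-- If the samples start a full period after α, a shift by less than d cannot lead below α. If the
reset is at s ≥ α - 1, then t ≥ α + `D.idx a`; the shifted time is congruent to α + `D.idx a` modulo
d and moved by less than d, so it is again at least α + `D.idx a`. -/
lemma Admissible.le_shift (hd : 0 < D.period) {s u α β t : ℕ} {a : DistinctPair K}
    (h : D.Admissible s u α) (hu : u ≤ t) (hr : (t - s - 1) % D.period = D.idx a) :
    (α : ℤ) ≤ t + D.phaseShift (s + 1) α β a := by
  obtain ⟨hsu, h⟩ := h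
  have hst : s + 1 ≤ t := by omega
  have hr' : (t - (s + 1)) % D.period = D.idx a := by rwa [Nat.sub_sub] at hr
  have hab := abs_lt.1 (abs_phaseShift_lt hd (s + 1) α β a)
  rcases h with ⟨h1, h2⟩ | h
  · obtain ⟨k, hk⟩ := (phaseShift_spec (a₂ := α) (β := β) hd hst hr').2
    obtain ⟨k', hk'⟩ := exists_eq_of_mod hst hr'
    have : (s : ℤ) + 1 + D.idx a ≤ t := by
      have := Nat.zero_le (k' * D.period)
      omega
    have hk0 : 0 ≤ k := by
      by_contra hneg
      have hneg : k ≤ -1 := by omega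
      have hd' : (0 : ℤ) ≤ D.period := by positivity
      have := mul_le_mul_of_nonneg_right hneg hd'
      omega
    have : 0 ≤ k * (D.period : ℤ) := by positivity
    omega
  · omega

/-- The change of time that aligns, pair by pair, the samples before time `β + h d`. -/
def alignTime (D : MDB K St Sd) (a₁ a₂ β h : ℕ) (t : ℕ) (i j : Fin K) : ℕ :=
  if hij : i < j then
    if t < β + h * D.period then ((t : ℤ) + D.phaseShift a₁ a₂ β ⟨(i, j), hij⟩).toNat else t
  else t

lemma alignTime_of_lt {a₁ a₂ β h t : ℕ} (a : DistinctPair K) (ht : t < β + h * D.period)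
    (h0 : 0 ≤ (t : ℤ) + D.phaseShift a₁ a₂ β a) :
    (D.alignTime a₁ a₂ β h t a.1.1 a.1.2 : ℤ) = t + D.phaseShift a₁ a₂ β a := by
  unfold alignTime
  rw [dif_pos a.2, if_pos ht, Int.toNat_of_nonneg h0]

lemma alignTime_of_le {a₁ a₂ β h t : ℕ} (i j : Fin K) (ht : β + h * D.period ≤ t) :
    D.alignTime a₁ a₂ β h t i j = t := by
  unfold alignTime
  split_ifs <;> first | rfl | omega

/-- The outcomes after the change of time. -/
def alignOutcomes (D : MDB K St Sd) (a₁ a₂ β h : ℕ) (x : ℕ → Fin K → Fin K → Bool) :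
    ℕ → Fin K → Fin K → Bool :=
  fun t i j => x (D.alignTime a₁ a₂ β h t i j) i j

lemma Admissible.exceeds_iff (hd : 0 < D.period) {s u α β h t t' : ℕ} {a : DistinctPair K}
    (hadm : D.Admissible s u α) (hu : u + (D.w - 1) * D.period ≤ t) (ht : t < β + h * D.period)
    (hr : (t - s - 1) % D.period = D.idx a) (x : ℕ → Fin K → Fin K → Bool)
    (ht' : (t' : ℤ) = t + D.phaseShift (s + 1) α β a) :
    D.Exceeds (D.alignOutcomes (s + 1) α β h x) a t ↔ D.Exceeds x a t' := by
  refine exceeds_congr fun k hk => ?_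
  have hkw := window_le (d := D.period) hk
  have hsu := hadm.1
  have h1 := hadm.le_shift (β := β) (t := t - k * D.period) (a := a) hd (by omega)
    (by rw [sub_window_mod (by omega), hr])
  have h2 := alignTime_of_lt (D := D) (h := h) a (t := t - k * D.period) (by omega)
    (by omega : 0 ≤ ((t - k * D.period : ℕ) : ℤ) + D.phaseShift (s + 1) α β a)
  unfold alignOutcomes
  have : D.alignTime (s + 1) α β h (t - k * D.period) a.1.1 a.1.2 = t' - k * D.period := by
    omega
  rw [this]

/-- Every window for the reset at s has an aligned counterpart for an initialization at α. The
converse fails, since the latter may have additional early windows; hence false alarms can only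
become rarer. -/
lemma Admissible.alarm_of_align (hd : 0 < D.period) {s u α β h : ℕ} (hα : 0 < α)
    (hadm : D.Admissible s u α) {x : ℕ → Fin K → Fin K → Bool}
    (hal : D.Alarm (D.alignOutcomes (s + 1) α β h x) s u β) : D.Alarm x (α - 1) α β := by
  obtain ⟨a, t, h1, h2, h3, h4⟩ := hal
  have hsu := hadm.1
  have hst : s + 1 ≤ t := by omega
  have hia := D.idx_lt a
  have hr' : (t - (s + 1)) % D.period = D.idx a := by rwa [Nat.sub_sub] at h3
  have hlow := hadm.le_shift (β := β) (t := t - (D.w - 1) * D.period) (a := a) hd (by omega)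
    (by rw [sub_window_mod (by omega), h3])
  obtain ⟨hlt, k, hk⟩ := phaseShift_spec (a₂ := α) (β := β) hd hst hr'
  have hlt0 := (hlt 0).1 (by push_cast; omega)
  obtain ⟨t', ht'⟩ : ∃ t' : ℕ, (t' : ℤ) = t + D.phaseShift (s + 1) α β a :=
    ⟨((t : ℤ) + D.phaseShift (s + 1) α β a).toNat, Int.toNat_of_nonneg (by omega)⟩
  have hlt' : t < β + h * D.period := by
    have := Nat.zero_le (h * D.period)
    omega
  rw [hadm.exceeds_iff hd h1 hlt' h3 x ht'] at h4
  refine ⟨a, t', by omega, by push_cast at hlt0; omega, ?_, h4⟩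
  have hia' : D.idx a < D.period := by rw [← h3]; exact Nat.mod_lt _ hd
  have hk0 : 0 ≤ k := by
    by_contra hneg
    have hneg : k ≤ -1 := by omega
    have hd' : (0 : ℤ) ≤ D.period := by positivity
    have := mul_le_mul_of_nonneg_right hneg hd'
    omega
  obtain ⟨k, rfl⟩ := Int.eq_ofNat_of_zero_le hk0
  have e : t' - (α - 1) - 1 = D.idx a + k * D.period := by
    have : (t' : ℤ) = α + D.idx a + (k * D.period : ℕ) := by push_cast; linarith
    omega
  rw [e, Nat.add_mul_mod_self_right, Nat.mod_eq_of_lt hia']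

/-- A window ending at β or later is not lost in the passage from α back to s: its shifted end is
still at least β, so it starts no earlier than β - (w - 1) d ≥ u. The hypothesis `hno` forces the
alarm to be of this kind. -/
lemma Admissible.align_alarm (hd : 0 < D.period) {s u α β h : ℕ} (hα : 0 < α)
    (hadm : D.Admissible s u α) (hu : u + (D.w - 1) * D.period ≤ β)
    {x : ℕ → Fin K → Fin K → Bool}
    (hal : D.Alarm x (α - 1) α (β + h * D.period)) (hno : ¬ D.Alarm x (α - 1) α β) :
    D.Alarm (D.alignOutcomes (s + 1) α β h x) s u (β + h * D.period) := by
  obtain ⟨a, t', h1, h2, h3, h4⟩ := hal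
  have hβ : β ≤ t' := by
    by_contra hlt
    exact hno ⟨a, t', h1, by omega, h3, h4⟩
  have hr' : (t' - α) % D.period = D.idx a := by
    rwa [show t' - (α - 1) - 1 = t' - α by omega] at h3
  obtain ⟨hlt, k, hk⟩ := phaseShift_spec (a₂ := s + 1) (β := β) hd (by omega) hr'
  have hge : (β : ℤ) ≤ t' + D.phaseShift α (s + 1) β a := by
    by_contra hlt'
    have := (hlt 0).2 (by push_cast; omega)
    push_cast at this
    omega
  have hlth := (hlt h).1 (by exact_mod_cast h2)
  obtain ⟨t, ht⟩ : ∃ t : ℕ, (t : ℤ) = t' + D.phaseShift α (s + 1) β a :=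
    ⟨((t' : ℤ) + D.phaseShift α (s + 1) β a).toNat, Int.toNat_of_nonneg (by omega)⟩
  have hsu := hadm.1
  have hlth' : t < β + h * D.period := by
    rw [← ht] at hlth
    exact_mod_cast hlth
  have hia' : D.idx a < D.period := by rw [← hr']; exact Nat.mod_lt _ hd
  have h3' : (t - s - 1) % D.period = D.idx a := by
    have hk0 : 0 ≤ k := by
      by_contra hneg
      have hneg : k ≤ -1 := by omega
      have hd' : (0 : ℤ) ≤ D.period := by positivity
      have := mul_le_mul_of_nonneg_right hneg hd'
      push_cast at hk
      omega
    obtain ⟨k, rfl⟩ := Int.eq_ofNat_of_zero_le hk0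
    have e : t - s - 1 = D.idx a + k * D.period := by
      have : (t : ℤ) = s + 1 + D.idx a + (k * D.period : ℕ) := by
        push_cast at hk ⊢; linarith
      omega
    rw [e, Nat.add_mul_mod_self_right, Nat.mod_eq_of_lt hia']
  refine ⟨a, t, by omega, hlth', h3', ?_⟩
  rw [hadm.exceeds_iff hd (by omega) hlth' h3' x (t' := t') ?_]
  · exact h4
  · rw [phaseShift_swap] at ht
    omega

/-- The change of time keeps each sample on its side of `β`, and maps the samples injectively. -/
lemma Admissible.alignTime_spec (hd : 0 < D.period) {s u α β h : ℕ} (hadm : D.Admissible s u α)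
    {c : ℕ × Fin K × Fin K} {v : ℕ} (hc : c ∈ D.sampleBlock s u v) :
    α ≤ D.alignTime (s + 1) α β h c.1 c.2.1 c.2.2 ∧
    (c.1 < β ↔ D.alignTime (s + 1) α β h c.1 c.2.1 c.2.2 < β) ∧
    (c.1 < β + h * D.period ↔
      D.alignTime (s + 1) α β h c.1 c.2.1 c.2.2 < β + h * D.period) := by
  obtain ⟨t, i, j⟩ := c
  obtain ⟨h1, h2, ⟨⟨i', j'⟩, hij⟩, heq, h3⟩ := hc
  simp only [Prod.mk.injEq] at heq h1 h2 h3
  obtain ⟨rfl, rfl⟩ := heq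
  have hsu := hadm.1
  have hlow := hadm.le_shift (β := β) hd h1 h3
  have hr' : (t - (s + 1)) % D.period = D.idx ⟨(i', j'), hij⟩ := by rwa [Nat.sub_sub] at h3
  obtain ⟨hlt, -⟩ := phaseShift_spec (a₂ := α) (β := β) hd (by omega : s + 1 ≤ t) hr'
  simp only
  have hH := Nat.zero_le (h * D.period)
  by_cases ht : t < β + h * D.period
  · have e := alignTime_of_lt (D := D) (a₁ := s + 1) (a₂ := α) ⟨(i', j'), hij⟩ ht (by omega)
    simp only at e
    have l0 := hlt 0
    have lh := hlt h
    rw [← e] at l0 lh hlow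
    refine ⟨by exact_mod_cast hlow, ?_, by exact_mod_cast lh⟩
    push_cast at l0
    omega
  · rw [alignTime_of_le i' j' (by omega)]
    refine ⟨?_, Iff.rfl, Iff.rfl⟩
    rcases hadm.2 with h | h <;> omega

/-- For each pair the map is a translation below β + h d and the identity above, and neither part
leaves its side of β + h d. -/
lemma Admissible.alignTime_injOn (hd : 0 < D.period) {s u α β h v : ℕ}
    (hadm : D.Admissible s u α) :
    Set.InjOn (fun c : ℕ × Fin K × Fin K => (D.alignTime (s + 1) α β h c.1 c.2.1 c.2.2, c.2))
      (D.sampleBlock s u v) := by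
  intro c hc c' hc' heq
  have h1 := (hadm.alignTime_spec (β := β) (h := h) hd hc).2.2
  have h1' := (hadm.alignTime_spec (β := β) (h := h) hd hc').2.2
  obtain ⟨t, i, j⟩ := c
  obtain ⟨t', i', j'⟩ := c'
  simp only [Prod.mk.injEq] at heq h1 h1'
  obtain ⟨ht, rfl, rfl⟩ := heq
  obtain ⟨g1, g2, ⟨⟨i', j'⟩, hij⟩, heq, h3⟩ := hc
  obtain ⟨g1', g2', a', heq', h3'⟩ := hc'
  simp only [Prod.mk.injEq] at heq
  obtain ⟨rfl, rfl⟩ := heq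
  obtain rfl : a' = ⟨(i', j'), hij⟩ := Subtype.ext heq'
  suffices t = t' by rw [this]
  by_cases hlt : t < β + h * D.period
  · have hlt' : t' < β + h * D.period := by
      rw [h1', ← ht, ← h1]
      exact hlt
    unfold alignTime at ht
    rw [dif_pos hij, dif_pos hij, if_pos hlt, if_pos hlt'] at ht
    have l1 := hadm.le_shift (β := β) (t := t) (a := ⟨(i', j'), hij⟩) hd g1 h3
    have l2 := hadm.le_shift (β := β) (t := t') (a := ⟨(i', j'), hij⟩) hd g1' h3'
    by_contra hne
    omega
  · have hlt' : ¬ t' < β + h * D.period := by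
      rw [h1', ← ht, ← h1]
      exact hlt
    rwa [alignTime_of_le _ _ (by omega), alignTime_of_le _ _ (by omega)] at ht

end MDB

/-! ### Probabilities of properties of the outcomes -/

/-- The table of all outcomes at the sample point `ω`. -/
def outcomesAt {K : ℕ} {Ω : Type*} (X : ℕ → Fin K → Fin K → Ω → Bool) (ω : Ω) :
    ℕ → Fin K → Fin K → Bool :=
  fun t i j => X t i j ω

/-- The probability of a property of the outcomes. -/
def outcomeProb {K : ℕ} {Ω : Type*} [MeasurableSpace Ω] (μ : Measure Ω)
    (X : ℕ → Fin K → Fin K → Ω → Bool) (A : (ℕ → Fin K → Fin K → Bool) → Prop) : ℝ :=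
  μ.real {ω | A (outcomesAt X ω)}

section OutcomeProb

variable {K T : ℕ} {Ω : Type*} [MeasurableSpace Ω] {μ : Measure Ω} [IsProbabilityMeasure μ]
  {X : ℕ → Fin K → Fin K → Ω → Bool} {A B : (ℕ → Fin K → Fin K → Bool) → Prop}

lemma outcomeProb_nonneg : 0 ≤ outcomeProb μ X A := measureReal_nonneg

lemma outcomeProb_le_one : outcomeProb μ X A ≤ 1 := measureReal_le_one

lemma outcomeProb_mono (h : ∀ x, A x → B x) : outcomeProb μ X A ≤ outcomeProb μ X B :=
  measureReal_mono fun _ hω => h _ hω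

lemma outcomeProb_congr (h : ∀ x, A x ↔ B x) : outcomeProb μ X A = outcomeProb μ X B := by
  rw [funext fun x => propext (h x)]

lemma outcomeProb_or_le :
    outcomeProb μ X (fun x => A x ∨ B x) ≤ outcomeProb μ X A + outcomeProb μ X B :=
  measureReal_union_le _ _

lemma outcomeProb_const_true : outcomeProb μ X (fun _ => True) = 1 := by
  simp [outcomeProb]

/-- Extend a table of the outcomes with indices in a finite set. -/
def extendOutcomes (I : Finset (Finset.Icc 1 T × Fin K × Fin K)) (z : I → Bool) :
    ℕ → Fin K → Fin K → Bool := by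
  classical
  exact fun t i j =>
    if h : ∃ ht : t ∈ Finset.Icc 1 T, ((⟨t, ht⟩, i, j) : Finset.Icc 1 T × Fin K × Fin K) ∈ I
    then z ⟨_, h.2⟩ else false

/-- The indices in `{1, …, T}` that belong to `C`. -/
def indexFinset (T : ℕ) (C : Set (ℕ × Fin K × Fin K)) :
    Finset (Finset.Icc 1 T × Fin K × Fin K) := by
  classical
  exact Finset.univ.filter fun c => ((c.1 : ℕ), c.2) ∈ C

lemma OutcomesDependOn.iff_extend {C : Set (ℕ × Fin K × Fin K)} (hA : OutcomesDependOn A C)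
    (hC : C ⊆ timeBlock K 1 (T + 1)) (x : ℕ → Fin K → Fin K → Bool) :
    A x ↔ A (extendOutcomes (indexFinset T C) fun c => x c.1.1 c.1.2.1 c.1.2.2) := by
  refine hA _ _ fun c hc => ?_
  have hc' := hC hc
  have h1 : c.1 ∈ Finset.Icc 1 T := Finset.mem_Icc.2 ⟨hc'.1, Nat.lt_succ_iff.1 hc'.2⟩
  have h2 : ((⟨c.1, h1⟩, c.2.1, c.2.2) : Finset.Icc 1 T × Fin K × Fin K) ∈ indexFinset T C := by
    simpa [indexFinset] using hc
  unfold extendOutcomes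
  rw [dif_pos ⟨h1, h2⟩]

/-- Only finitely many Boolean outcomes matter, so the event is the preimage of a subset of a finite
type. -/
lemma OutcomesDependOn.measurableSet {C : Set (ℕ × Fin K × Fin K)} (hA : OutcomesDependOn A C)
    (hC : C ⊆ timeBlock K 1 (T + 1)) (hX : ∀ t i j, Measurable (X t i j)) :
    MeasurableSet {ω | A (outcomesAt X ω)} := by
  have : {ω | A (outcomesAt X ω)} =
      (fun ω (c : indexFinset T C) => X c.1.1 c.1.2.1 c.1.2.2 ω) ⁻¹'
        {z | A (extendOutcomes (indexFinset T C) z)} := by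
    ext ω
    exact hA.iff_extend hC _
  rw [this]
  exact measurable_pi_lambda _ (fun c => hX _ _ _) (Set.toFinite _).measurableSet

lemma outcomeProb_and_eq_mul (hX : ∀ t i j, Measurable (X t i j))
    (hind : iIndepFun (fun (c : Finset.Icc 1 T × Fin K × Fin K) => X c.1 c.2.1 c.2.2) μ)
    {C C' : Set (ℕ × Fin K × Fin K)} (hA : OutcomesDependOn A C) (hB : OutcomesDependOn B C')
    (hC : C ⊆ timeBlock K 1 (T + 1)) (hC' : C' ⊆ timeBlock K 1 (T + 1)) (hd : Disjoint C C') :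
    outcomeProb μ X (fun x => A x ∧ B x) = outcomeProb μ X A * outcomeProb μ X B := by
  have hdisj : Disjoint (indexFinset T C) (indexFinset T C') := by
    rw [Finset.disjoint_left]
    intro c h1 h2
    simp only [indexFinset, Finset.mem_filter, Finset.mem_univ, true_and] at h1 h2
    exact Set.disjoint_left.1 hd h1 h2
  have h := hind.indepFun_finset _ _ hdisj fun c => hX _ _ _
  have h2 := h.measure_inter_preimage_eq_mul
    {z | A (extendOutcomes (indexFinset T C) z)} {z | B (extendOutcomes (indexFinset T C') z)}
    (Set.toFinite _).measurableSet (Set.toFinite _).measurableSet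
  unfold outcomeProb Measure.real
  rw [← ENNReal.toReal_mul]
  congr 1
  convert h2 using 2
  · ext ω
    exact and_congr (hA.iff_extend hC _) (hB.iff_extend hC' _)
  · congr 1
    ext ω
    exact hA.iff_extend hC _
  · congr 1
    ext ω
    exact hB.iff_extend hC' _

lemma outcomeProb_and_block (hX : ∀ t i j, Measurable (X t i j))
    (hind : iIndepFun (fun (c : Finset.Icc 1 T × Fin K × Fin K) => X c.1 c.2.1 c.2.2) μ)
    {u c v : ℕ} (hu : 1 ≤ u) (hv : v ≤ T + 1) (huc : u ≤ c) (hcv : c ≤ v)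
    (hA : OutcomesDependOn A (timeBlock K u c)) (hB : OutcomesDependOn B (timeBlock K c v)) :
    outcomeProb μ X (fun x => A x ∧ B x) = outcomeProb μ X A * outcomeProb μ X B := by
  refine outcomeProb_and_eq_mul hX hind hA hB (timeBlock_mono hu (by omega))
    (timeBlock_mono (by omega) hv) ?_
  rw [Set.disjoint_left]
  rintro d ⟨-, h1⟩ ⟨h2, -⟩
  omega

lemma outcomeProb_not (hX : ∀ t i j, Measurable (X t i j))
    (hA : OutcomesDependOn A (timeBlock K 1 (T + 1))) :
    outcomeProb μ X (fun x => ¬ A x) = 1 - outcomeProb μ X A :=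
  probReal_compl_eq_one_sub (hA.measurableSet subset_rfl hX)

lemma outcomeProb_and_add_and_not (hX : ∀ t i j, Measurable (X t i j))
    (hB : OutcomesDependOn B (timeBlock K 1 (T + 1))) :
    outcomeProb μ X (fun x => A x ∧ B x) + outcomeProb μ X (fun x => A x ∧ ¬ B x) =
      outcomeProb μ X A :=
  measureReal_inter_add_sdiff (s := {ω | A (outcomesAt X ω)}) (hB.measurableSet subset_rfl hX)

lemma outcomeProb_exists_le {ι : Type*} (S : Finset ι)
    (A : ι → (ℕ → Fin K → Fin K → Bool) → Prop) :
    outcomeProb μ X (fun x => ∃ i ∈ S, A i x) ≤ ∑ i ∈ S, outcomeProb μ X (A i) := by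
  have : {ω | ∃ i ∈ S, A i (outcomesAt X ω)} = ⋃ i ∈ S, {ω | A i (outcomesAt X ω)} := by
    ext ω
    simp
  unfold outcomeProb
  rw [this]
  exact measureReal_biUnion_finset_le S _

lemma outcomeProb_exists_eq {ι : Type*} (S : Finset ι)
    (A : ι → (ℕ → Fin K → Fin K → Bool) → Prop) (hX : ∀ t i j, Measurable (X t i j))
    (hA : ∀ i ∈ S, OutcomesDependOn (A i) (timeBlock K 1 (T + 1)))
    (hdisj : ∀ x, ∀ i ∈ S, ∀ j ∈ S, A i x → A j x → i = j) :
    outcomeProb μ X (fun x => ∃ i ∈ S, A i x) = ∑ i ∈ S, outcomeProb μ X (A i) := by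
  have : {ω | ∃ i ∈ S, A i (outcomesAt X ω)} = ⋃ i ∈ S, {ω | A i (outcomesAt X ω)} := by
    ext ω
    simp
  unfold outcomeProb
  rw [this]
  refine measureReal_biUnion_finset ?_ fun i hi => (hA i hi).measurableSet subset_rfl hX
  intro i hi j hj hij
  rw [Function.onFun, Set.disjoint_left]
  intro ω h1 h2
  exact hij (hdisj _ i hi j hj h1 h2)

/-- If the disjoint properties `A i` are decided before time `c i`, and each `B i` concerns the
outcomes from time `c i` on and has probability at most `ε`, then some `A i ∧ B i` holds with
probability at most `ε` times that of some `A i`. -/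
lemma outcomeProb_cut_le (hX : ∀ t i j, Measurable (X t i j))
    (hind : iIndepFun (fun (c : Finset.Icc 1 T × Fin K × Fin K) => X c.1 c.2.1 c.2.2) μ)
    {ι : Type*} (S : Finset ι) (A B : ι → (ℕ → Fin K → Fin K → Bool) → Prop) (c : ι → ℕ) {ε : ℝ}
    (hc : ∀ i ∈ S, 1 ≤ c i ∧ c i ≤ T + 1)
    (hA : ∀ i ∈ S, OutcomesDependOn (A i) (timeBlock K 1 (c i)))
    (hB : ∀ i ∈ S, OutcomesDependOn (B i) (timeBlock K (c i) (T + 1)))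
    (hdisj : ∀ x, ∀ i ∈ S, ∀ j ∈ S, A i x → A j x → i = j)
    (hε : ∀ i ∈ S, outcomeProb μ X (B i) ≤ ε) :
    outcomeProb μ X (fun x => ∃ i ∈ S, A i x ∧ B i x) ≤
      ε * outcomeProb μ X (fun x => ∃ i ∈ S, A i x) := by
  have h1 := outcomeProb_exists_eq (μ := μ) S A hX
    (fun i hi => (hA i hi).mono (timeBlock_mono le_rfl (hc i hi).2)) hdisj
  rw [h1, Finset.mul_sum]
  refine (outcomeProb_exists_le S _).trans (Finset.sum_le_sum fun i hi => ?_)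
  rw [outcomeProb_and_block hX hind le_rfl le_rfl (hc i hi).1 (hc i hi).2 (hA i hi) (hB i hi),
    mul_comm]
  exact mul_le_mul_of_nonneg_right (hε i hi) outcomeProb_nonneg

lemma map_eq_of_prob_true_eq {f g : Ω → Bool} (hf : Measurable f) (hg : Measurable g)
    (h : μ.real {ω | f ω = true} = μ.real {ω | g ω = true}) : μ.map f = μ.map g := by
  have ht : μ (f ⁻¹' {true}) = μ (g ⁻¹' {true}) :=
    (measureReal_eq_measureReal_iff (measure_ne_top _ _) (measure_ne_top _ _)).1 h
  have hfalse : ∀ k : Ω → Bool, k ⁻¹' {false} = (k ⁻¹' {true})ᶜ := by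
    intro k
    ext ω
    cases hk : k ω <;> simp [hk]
  refine Measure.ext_of_singleton fun b => ?_
  rw [Measure.map_apply hf (measurableSet_singleton b),
    Measure.map_apply hg (measurableSet_singleton b)]
  cases b
  · rw [hfalse f, hfalse g, measure_compl (hf (measurableSet_singleton _)) (measure_ne_top _ _),
      measure_compl (hg (measurableSet_singleton _)) (measure_ne_top _ _), ht]
  · exact ht

/-- The law of the outcomes with indices in `C` does not change under an injective change of time
that preserves their distributions. -/
lemma outcomeProb_comp_time (hX : ∀ t i j, Measurable (X t i j))
    (hind : iIndepFun (fun (c : Finset.Icc 1 T × Fin K × Fin K) => X c.1 c.2.1 c.2.2) μ)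
    {C : Set (ℕ × Fin K × Fin K)} (hA : OutcomesDependOn A C) (hC : C ⊆ timeBlock K 1 (T + 1))
    (θ : ℕ → Fin K → Fin K → ℕ)
    (hθ : ∀ c ∈ C, θ c.1 c.2.1 c.2.2 ∈ Finset.Icc 1 T)
    (hinj : Set.InjOn (fun c : ℕ × Fin K × Fin K => (θ c.1 c.2.1 c.2.2, c.2)) C)
    (hlaw : ∀ c ∈ C, μ.real {ω | X (θ c.1 c.2.1 c.2.2) c.2.1 c.2.2 ω = true} =
      μ.real {ω | X c.1 c.2.1 c.2.2 ω = true}) :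
    outcomeProb μ X (fun x => A fun t i j => x (θ t i j) i j) = outcomeProb μ X A := by
  have hmem : ∀ c : indexFinset T C, ((c.1.1 : ℕ), c.1.2) ∈ C := by
    intro c
    have := c.2
    simpa only [indexFinset, Finset.mem_filter, Finset.mem_univ, true_and] using this
  let g : indexFinset T C → Finset.Icc 1 T × Fin K × Fin K :=
    fun c => (⟨θ c.1.1 c.1.2.1 c.1.2.2, hθ _ (hmem c)⟩, c.1.2)
  have hg : Function.Injective g := by
    intro c c' h
    have h' : (θ c.1.1 c.1.2.1 c.1.2.2, c.1.2) = (θ c'.1.1 c'.1.2.1 c'.1.2.2, c'.1.2) := by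
      simp only [g, Prod.mk.injEq, Subtype.mk.injEq] at h
      exact Prod.ext h.1 h.2
    have := hinj (hmem c) (hmem c') h'
    refine Subtype.ext (Prod.ext (Subtype.ext ?_) ?_)
    · exact congrArg (fun z : ℕ × Fin K × Fin K => z.1) this
    · exact congrArg (fun z : ℕ × Fin K × Fin K => z.2) this
  have h1 := (hind.precomp hg).map_fun_eq_pi_map fun c => (hX _ _ _).aemeasurable
  have h2 := (hind.precomp (g := fun c : indexFinset T C => c.1)
    Subtype.val_injective).map_fun_eq_pi_map fun c => (hX _ _ _).aemeasurable
  have h3 : μ.map (fun ω (c : indexFinset T C) => X (g c).1 (g c).2.1 (g c).2.2 ω) =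
      μ.map (fun ω (c : indexFinset T C) => X c.1.1 c.1.2.1 c.1.2.2 ω) := by
    rw [h1, h2]
    congr 1
    ext1 c
    exact map_eq_of_prob_true_eq (hX _ _ _) (hX _ _ _) (hlaw _ (hmem c))
  have h4 := congrArg (fun ν => ν {z | A (extendOutcomes (indexFinset T C) z)}) h3
  beta_reduce at h4
  rw [Measure.map_apply (measurable_pi_lambda _ fun c => hX _ _ _) (Set.toFinite _).measurableSet,
    Measure.map_apply (measurable_pi_lambda _ fun c => hX _ _ _)
      (Set.toFinite _).measurableSet] at h4
  unfold outcomeProb Measure.real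
  congr 1
  convert h4 using 2
  · ext ω
    exact hA.iff_extend hC _
  · ext ω
    exact hA.iff_extend hC _

end OutcomeProb

-- Detection probabilities for an arbitrary reset time.

namespace DuelingProblem

variable {K T M : ℕ} (E : DuelingProblem K T M)

/-- The first time step of segment `m`. -/
def start (m : Fin M) : ℕ := E.cp m.castSucc

/-- The first time step after segment `m`. -/
def finish (m : Fin M) : ℕ := E.cp m.succ

variable {E}

lemma one_le_start (m : Fin M) : 1 ≤ E.start m := by
  rw [← E.cp_zero]
  exact E.cp_strictMono.monotone (Fin.zero_le _)

lemma start_lt_finish (m : Fin M) : E.start m < E.finish m :=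
  E.cp_strictMono Fin.castSucc_lt_succ

lemma finish_le (m : Fin M) : E.finish m ≤ T + 1 := by
  rw [← E.cp_last]
  exact E.cp_strictMono.monotone (Fin.le_last _)

lemma start_succ (m : Fin M) (h : (m : ℕ) + 1 < M) : E.start ⟨m + 1, h⟩ = E.finish m := rfl

lemma mem_segment {m : Fin M} {t : ℕ} : t ∈ E.segment m ↔ E.start m ≤ t ∧ t < E.finish m :=
  Finset.mem_Ico

lemma card_segment (m : Fin M) : (E.segment m).card = E.finish m - E.start m :=
  Nat.card_Ico _ _

end DuelingProblem

namespace MDB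

variable {K T M : ℕ} {St Sd : Type*} [MeasurableSpace St] [MeasurableSpace Sd]
  {Ω : Type*} [MeasurableSpace Ω]

/-- The number of time steps needed to fill one half of all detection windows. -/
def halfL (D : MDB K St Sd) : ℕ := D.w / 2 * D.period

/-- The outcomes are independent Bernoulli variables, the segments are long enough, and the
detection has false alarm probability at most `p` and large delay probability at most `q`. -/
structure DetectionBounds (D : MDB K St Sd) (E : DuelingProblem K T M) (μ : Measure Ω)
    (X : ℕ → Fin K → Fin K → Ω → Bool) (p q : ℝ) : Prop where
  isProb : IsProbabilityMeasure μ
  measurable : ∀ t i j, Measurable (X t i j)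
  indep : iIndepFun (fun (c : Finset.Icc 1 T × Fin K × Fin K) => X c.1 c.2.1 c.2.2) μ
  bernoulli : ∀ m, ∀ t ∈ E.segment m, ∀ i j, μ.real {ω | X t i j ω = true} = E.P m i j
  pairs_le : K * (K - 1) / 2 ≤ D.period
  period_pos : 0 < D.period
  two_le_w : 2 ≤ D.w
  even_w : Even D.w
  length : ∀ m, E.start m + 2 * D.L ≤ E.finish m
  p_nonneg : 0 ≤ p
  p_le_one : p ≤ 1
  q_nonneg : 0 ≤ q
  q_le_one : q ≤ 1
  false_alarm : ∀ m,
    outcomeProb μ X (fun x => D.Alarm x (E.start m - 1) (E.start m) (E.finish m)) ≤ p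
  delay : ∀ m : Fin M, (m : ℕ) + 1 < M →
    outcomeProb μ X (fun x => ¬ D.Alarm x (E.start m - 1) (E.start m) (E.finish m + D.halfL)) ≤
      q * (1 - outcomeProb μ X (fun x => D.Alarm x (E.start m - 1) (E.start m) (E.finish m)))

variable {D : MDB K St Sd} {E : DuelingProblem K T M} {μ : Measure Ω}
  {X : ℕ → Fin K → Fin K → Ω → Bool} {p q : ℝ}

namespace DetectionBounds

lemma L_eq (h : D.DetectionBounds E μ X p q) : D.L = 2 * D.halfL := by
  obtain ⟨k, hk⟩ := h.even_w
  unfold L halfL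
  rw [← mul_assoc]
  congr 1
  omega

lemma window_add_period (h : D.DetectionBounds E μ X p q) :
    (D.w - 1) * D.period + D.period = D.L := by
  have := h.two_le_w
  unfold L
  rw [← Nat.succ_mul]
  congr 1
  omega

lemma period_le_halfL (h : D.DetectionBounds E μ X p q) : D.period ≤ D.halfL := by
  have := h.two_le_w
  exact Nat.le_mul_of_pos_left _ (by omega)

lemma finish_add_halfL_le (h : D.DetectionBounds E μ X p q) (m : Fin M) (hm : (m : ℕ) + 1 < M) :
    E.finish m + D.halfL ≤ E.finish ⟨m + 1, hm⟩ := by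
  have h1 := h.length ⟨m + 1, hm⟩
  rw [E.start_succ] at h1
  have := h.L_eq
  omega

lemma _root_.MDB.Admissible.start_le {s u α : ℕ} (h : D.Admissible s u α) : α ≤ u := by
  rcases h.2 with h | h <;> omega

/-- Samples before the changepoint stay in segment m, those in the next n d steps stay in segment m
+ 1, and later ones do not move; so each keeps its Bernoulli parameter. After the last segment there
is nothing to align, whence `hn'`. -/
lemma align_mem (h : D.DetectionBounds E μ X p q) (m : Fin M) {s u : ℕ}
    (hadm : D.Admissible s u (E.start m)) {n v : ℕ} (hv : v ≤ T + 1)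
    (hn : ∀ hm : (m : ℕ) + 1 < M,
      E.finish m + n * D.period ≤ E.finish ⟨m + 1, hm⟩)
    (hn' : ¬ (m : ℕ) + 1 < M → v ≤ E.finish m)
    {c : ℕ × Fin K × Fin K} (hc : c ∈ D.sampleBlock s u v) :
    D.alignTime (s + 1) (E.start m) (E.finish m) n c.1 c.2.1 c.2.2 ∈ Finset.Icc 1 T ∧
    μ.real {ω | X (D.alignTime (s + 1) (E.start m) (E.finish m) n c.1 c.2.1 c.2.2)
      c.2.1 c.2.2 ω = true} = μ.real {ω | X c.1 c.2.1 c.2.2 ω = true} := by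
  obtain ⟨g1, g2, g3⟩ := hadm.alignTime_spec (β := E.finish m) (h := n) h.period_pos hc
  have hs := E.one_le_start m
  have hst := E.finish_le m
  have hu := hadm.start_le
  by_cases hlt : c.1 < E.finish m
  · have hlt' := g2.1 hlt
    refine ⟨Finset.mem_Icc.2 ⟨by omega, by omega⟩, ?_⟩
    rw [h.bernoulli m _ (E.mem_segment.2 ⟨g1, hlt'⟩),
      h.bernoulli m _ (E.mem_segment.2 ⟨hu.trans hc.1, hlt⟩)]
  · have hlt' := mt g2.2 hlt
    have hcv : c.1 < v := hc.2.1
    by_cases hm : (m : ℕ) + 1 < M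
    · by_cases hn2 : c.1 < E.finish m + n * D.period
      · have hn2' := g3.1 hn2
        have h4 := hn hm
        have h5 := E.finish_le ⟨m + 1, hm⟩
        refine ⟨Finset.mem_Icc.2 ⟨by omega, by omega⟩, ?_⟩
        rw [h.bernoulli ⟨m + 1, hm⟩ _ (E.mem_segment.2 ⟨by rw [E.start_succ]; omega, by omega⟩),
          h.bernoulli ⟨m + 1, hm⟩ _ (E.mem_segment.2 ⟨by rw [E.start_succ]; omega, by omega⟩)]
      · rw [alignTime_of_le (t := c.1) _ _ (not_lt.1 hn2)]
        exact ⟨Finset.mem_Icc.2 ⟨hs.trans (hu.trans hc.1), Nat.lt_succ_iff.1 (hcv.trans_le hv)⟩,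
          rfl⟩
    · exact absurd (hcv.trans_le (hn' hm)) hlt

lemma prob_align (h : D.DetectionBounds E μ X p q) (m : Fin M) {s u : ℕ}
    (hadm : D.Admissible s u (E.start m)) {n v : ℕ} (hv : v ≤ T + 1)
    (hn : ∀ hm : (m : ℕ) + 1 < M,
      E.finish m + n * D.period ≤ E.finish ⟨m + 1, hm⟩)
    (hn' : ¬ (m : ℕ) + 1 < M → v ≤ E.finish m)
    {A : (ℕ → Fin K → Fin K → Bool) → Prop} (hA : OutcomesDependOn A (D.sampleBlock s u v)) :
    outcomeProb μ X (fun x => A (D.alignOutcomes (s + 1) (E.start m) (E.finish m) n x)) =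
      outcomeProb μ X A := by
  have := h.isProb
  refine outcomeProb_comp_time h.measurable h.indep hA ?_ _ ?_ ?_ ?_
  · refine (sampleBlock_subset s u v).trans (timeBlock_mono ?_ hv)
    exact (E.one_le_start m).trans hadm.start_le
  · exact fun c hc => (h.align_mem m hadm hv hn hn' hc).1
  · exact hadm.alignTime_injOn h.period_pos
  · exact fun c hc => (h.align_mem m hadm hv hn hn' hc).2

/-- Alignment with n = 0 moves only samples before the changepoint; it preserves the law and sends
alarms for s to alarms for an initialization at the segment start. -/
lemma prob_alarm_le_start (h : D.DetectionBounds E μ X p q) (m : Fin M) {s u : ℕ}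
    (hadm : D.Admissible s u (E.start m)) :
    outcomeProb μ X (fun x => D.Alarm x s u (E.finish m)) ≤
      outcomeProb μ X (fun x => D.Alarm x (E.start m - 1) (E.start m) (E.finish m)) := by
  have := h.isProb
  have h1 := h.prob_align m hadm (n := 0) (E.finish_le m)
    (fun hm => by have := h.finish_add_halfL_le m hm; omega) (fun _ => le_rfl)
    (alarm_dependsOn (D := D) hadm.1)
  rw [← h1]
  exact outcomeProb_mono fun x hx => hadm.alarm_of_align h.period_pos (E.one_le_start m) hx

lemma prob_alarm_le (h : D.DetectionBounds E μ X p q) (m : Fin M) {s u : ℕ}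
    (hadm : D.Admissible s u (E.start m)) :
    outcomeProb μ X (fun x => D.Alarm x s u (E.finish m)) ≤ p :=
  (h.prob_alarm_le_start m hadm).trans (h.false_alarm m)

/-- The detection delay, jointly with a property `B` of later samples of probability at most `e`. -/
lemma prob_delay_le (h : D.DetectionBounds E μ X p q) (m : Fin M) (hm : (m : ℕ) + 1 < M) {s u : ℕ}
    (hadm : D.Admissible s u (E.start m)) (hu : u + (D.w - 1) * D.period ≤ E.finish m)
    {B : (ℕ → Fin K → Fin K → Bool) → Prop} {e : ℝ}
    (hB : OutcomesDependOn B (D.sampleBlock s (E.finish m) (T + 1)))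
    (he : outcomeProb μ X B ≤ e) (hqe : q ≤ e) :
    e * outcomeProb μ X (fun x => D.Alarm x s u (E.finish m)) +
      outcomeProb μ X (fun x => ¬ D.Alarm x s u (E.finish m + D.halfL) ∧ B x) ≤
      p * e + q * (1 - p) := by
  have := h.isProb
  have hfinish := h.finish_add_halfL_le m hm
  have hst := E.finish_le ⟨m + 1, hm⟩
  have hstart := E.one_le_start m
  set α := E.start m with hα
  set β := E.finish m with hβ
  have huα := hadm.start_le
  have hβT : β ≤ T + 1 := E.finish_le m
  have hpr : ∀ {A : (ℕ → Fin K → Fin K → Bool) → Prop},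
      OutcomesDependOn A (D.sampleBlock s u (T + 1)) →
      outcomeProb μ X (fun x => A (D.alignOutcomes (s + 1) α β (D.w / 2) x)) =
        outcomeProb μ X A :=
    fun hA => h.prob_align m hadm le_rfl (fun _ => hfinish) (fun hm' => absurd hm hm') hA
  have hBu : OutcomesDependOn B (D.sampleBlock s u (T + 1)) :=
    hB.mono (sampleBlock_mono (by omega) le_rfl)
  have hdelay : OutcomesDependOn (fun x => ¬ D.Alarm x s u (β + D.halfL) ∧ B x)
      (D.sampleBlock s u (T + 1)) :=
    (((alarm_dependsOn hadm.1).not).mono (sampleBlock_mono le_rfl (by omega))).and hBu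
  rw [← hpr hdelay, ← hpr ((alarm_dependsOn hadm.1 (v := β)).mono
    (sampleBlock_mono le_rfl hβT))]
  have hdepA : OutcomesDependOn
      (fun x => D.Alarm (D.alignOutcomes (s + 1) α β (D.w / 2) x) s u β) (timeBlock K α β) := by
    intro x y hxy
    refine alarm_dependsOn hadm.1 _ _ fun c hc => hxy (_, c.2) ?_
    obtain ⟨g1, g2, -⟩ := hadm.alignTime_spec (β := β) (h := D.w / 2) h.period_pos hc
    exact ⟨g1, g2.1 hc.2.1⟩
  have hdepB : OutcomesDependOn
      (fun x => B (D.alignOutcomes (s + 1) α β (D.w / 2) x)) (timeBlock K β (T + 1)) := by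
    intro x y hxy
    refine hB _ _ fun c hc => hxy (_, c.2) ?_
    have hc' := sampleBlock_mono (D := D) (s := s) (by omega : u ≤ β) le_rfl hc
    obtain ⟨-, g2, -⟩ := hadm.alignTime_spec (β := β) (h := D.w / 2) h.period_pos hc'
    have hmem := Finset.mem_Icc.1 (h.align_mem m hadm (n := D.w / 2) le_rfl (fun _ => hfinish)
      (fun hm' => absurd hm hm') hc').1
    rw [← hα, ← hβ] at hmem
    have hc1 : β ≤ c.1 := hc.1
    have := mt g2.2 (by omega)
    exact ⟨not_lt.1 this, Nat.lt_succ_of_le hmem.2⟩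
  have hdep0 : OutcomesDependOn (fun x => D.Alarm x (α - 1) α β) (timeBlock K α β) :=
    alarm_dependsOn' (by omega)
  set A0 := fun x => D.Alarm x (α - 1) α β
  set A1 := fun x => D.Alarm (D.alignOutcomes (s + 1) α β (D.w / 2) x) s u β
  -- After alignment both detectors live on the same outcomes: `A0` is a false alarm of the one
  -- started at α, `A1` of the one reset at s.
  have hsub : ∀ x, A1 x → A0 x := fun x hx => hadm.alarm_of_align h.period_pos hstart hx
  have hsplit : outcomeProb μ X (fun x => A0 x ∧ A1 x) +
      outcomeProb μ X (fun x => A0 x ∧ ¬ A1 x) = outcomeProb μ X A0 :=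
    outcomeProb_and_add_and_not h.measurable (hdepA.mono (timeBlock_mono hstart hβT))
  have hA01 : outcomeProb μ X (fun x => A0 x ∧ A1 x) = outcomeProb μ X A1 :=
    outcomeProb_congr fun x => ⟨fun hx => hx.2, fun hx => ⟨hsub x hx, hx⟩⟩
  -- If the detector of s is silent until β + L/2, so is the one of α, unless the latter raised an
  -- alarm before β that the former missed. In that case `B` is kept, since it concerns only samples
  -- from β on and is independent of `A0 ∧ ¬ A1`.
  have hcover : outcomeProb μ X (fun x =>
      ¬ D.Alarm (D.alignOutcomes (s + 1) α β (D.w / 2) x) s u (β + D.halfL) ∧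
        B (D.alignOutcomes (s + 1) α β (D.w / 2) x)) ≤
      outcomeProb μ X (fun x => ¬ D.Alarm x (α - 1) α (β + D.halfL)) +
      outcomeProb μ X (fun x => (A0 x ∧ ¬ A1 x) ∧
        B (D.alignOutcomes (s + 1) α β (D.w / 2) x)) := by
    refine (outcomeProb_mono fun x hx => ?_).trans outcomeProb_or_le
    by_cases h1 : D.Alarm x (α - 1) α (β + D.halfL)
    · right
      refine ⟨⟨?_, ?_⟩, hx.2⟩
      · by_contra h0
        exact hx.1 (hadm.align_alarm h.period_pos hstart hu h1 h0)
      · exact fun hA1 => hx.1 (Alarm.mono hA1 le_rfl (by omega))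
    · exact Or.inl h1
  have hmul : outcomeProb μ X (fun x => (A0 x ∧ ¬ A1 x) ∧
      B (D.alignOutcomes (s + 1) α β (D.w / 2) x)) =
      outcomeProb μ X (fun x => A0 x ∧ ¬ A1 x) *
        outcomeProb μ X (fun x => B (D.alignOutcomes (s + 1) α β (D.w / 2) x)) :=
    outcomeProb_and_block h.measurable h.indep hstart le_rfl (by omega) hβT
      (hdep0.and hdepA.not) hdepB
  rw [hmul, hpr hBu] at hcover
  have hd := h.delay m hm
  have hfa := h.false_alarm m
  have hnn : 0 ≤ outcomeProb μ X (fun x => A0 x ∧ ¬ A1 x) := outcomeProb_nonneg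
  have h2 := mul_le_mul_of_nonneg_left he hnn
  have hπ : outcomeProb μ X A0 ≤ p := hfa
  have hd' : outcomeProb μ X (fun x => ¬ D.Alarm x (α - 1) α (β + D.halfL)) ≤
    q * (1 - outcomeProb μ X A0) := hd
  rw [hA01] at hsplit
  have hsplit' : e * outcomeProb μ X A1 + e * outcomeProb μ X (fun x => A0 x ∧ ¬ A1 x) =
    e * outcomeProb μ X A0 := by rw [← mul_add, hsplit]
  -- With π the probability of `A0`, the terms add up to at most e π + q (1 - π), which is
  -- nondecreasing in π because q ≤ e, and π ≤ p.
  nlinarith [mul_nonneg (sub_nonneg.2 hπ) (sub_nonneg.2 hqe)]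

end DetectionBounds

end MDB

-- Resets around a changepoint and the recursive inequalities.

namespace MDB

variable {K T M : ℕ} {St Sd : Type*} [MeasurableSpace St] [MeasurableSpace Sd]
  {Ω : Type*} [MeasurableSpace Ω]

/-- No reset happens at the time steps `a, …, b - 1`; the initialization counts as a reset at
time `0`. -/
def NoReset (D : MDB K St Sd) (x : ℕ → Fin K → Fin K → Bool) (a b : ℕ) : Prop :=
  ∀ s, a ≤ s → s < b → D.lastReset x (s + 1) ≠ s

/-- The first reset at time `a` or later happens at time `s`. -/
def FirstReset (D : MDB K St Sd) (x : ℕ → Fin K → Fin K → Bool) (a s : ℕ) : Prop :=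
  D.lastReset x (s + 1) = s ∧ D.NoReset x a s

/-- With detection phases aligned to a reset at time `s` and samples from time `u` on, there is an
alarm before the changepoint `v` or none in the first `L / 2` time steps after it. -/
def BadDetection (D : MDB K St Sd) (x : ℕ → Fin K → Fin K → Bool) (s u v : ℕ) : Prop :=
  D.Alarm x s u v ∨ ¬ D.Alarm x s u (v + D.halfL)

variable {D : MDB K St Sd} {E : DuelingProblem K T M} {μ : Measure Ω}
  {X : ℕ → Fin K → Fin K → Ω → Bool} {p q : ℝ}

lemma NoReset.mono {x : ℕ → Fin K → Fin K → Bool} {a b a' b' : ℕ} (h : D.NoReset x a b)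
    (ha : a ≤ a') (hb : b' ≤ b) : D.NoReset x a' b' :=
  fun s h1 h2 => h s (ha.trans h1) (h2.trans_le hb)

lemma exists_firstReset_iff {x : ℕ → Fin K → Fin K → Bool} {a b : ℕ} :
    (∃ s ∈ Finset.Ico a b, D.FirstReset x a s) ↔ ¬ D.NoReset x a b := by
  constructor
  · rintro ⟨s, hs, h1, -⟩ h
    rw [Finset.mem_Ico] at hs
    exact h s hs.1 hs.2 h1
  · intro h
    unfold NoReset at h
    push Not at h
    classical
    obtain ⟨h1, h2, h3⟩ := Nat.find_spec h
    refine ⟨_, Finset.mem_Ico.2 ⟨h1, h2⟩, h3, fun r hr hr' hr'' => ?_⟩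
    exact Nat.find_min h hr' ⟨hr, by omega, hr''⟩

lemma FirstReset.unique {x : ℕ → Fin K → Fin K → Bool} {a s s' : ℕ} (hs : a ≤ s) (hs' : a ≤ s')
    (h : D.FirstReset x a s) (h' : D.FirstReset x a s') : s = s' := by
  rcases lt_trichotomy s s' with hlt | heq | hlt
  · exact absurd h.1 (h'.2 s hs hlt)
  · exact heq
  · exact absurd h'.1 (h.2 s' hs' hlt)

lemma noReset_dependsOn (a b : ℕ) :
    OutcomesDependOn (fun x => D.NoReset x a b) (timeBlock K 1 b) :=
  .forall' fun s => .imp_of_imp fun _ => .imp_of_imp fun h =>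
    (lastReset_dependsOn (fun r => r ≠ s) (s + 1)).mono (timeBlock_mono le_rfl h)

lemma firstReset_dependsOn (a s : ℕ) :
    OutcomesDependOn (fun x => D.FirstReset x a s) (timeBlock K 1 (s + 1)) :=
  (lastReset_dependsOn (fun r => r = s) (s + 1)).and
    ((noReset_dependsOn a s).mono (timeBlock_mono le_rfl (Nat.le_succ s)))

lemma badDetection_dependsOn {s u v : ℕ} (hs : s < u) :
    OutcomesDependOn (fun x => D.BadDetection x s u v) (D.sampleBlock s u (v + D.halfL)) :=
  ((alarm_dependsOn hs).mono (sampleBlock_mono le_rfl (Nat.le_add_right _ _))).or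
    (alarm_dependsOn hs).not

/-- If the last reset before time `v` is `s`, then an alarm after `v` leads to a reset. -/
lemma not_noReset_of_alarm {x : ℕ → Fin K → Fin K → Bool} {s u v v' : ℕ} (hsu : s < u)
    (hv : D.lastReset x v = s) (hno : ¬ D.Alarm x s u v) (hal : D.Alarm x s u v') :
    ¬ D.NoReset x (v - 1) v' := by
  obtain ⟨a, t, h1, h2, h3⟩ := hal
  have hvt : v ≤ t := by
    by_contra hlt
    exact hno ⟨a, t, h1, by omega, h3⟩
  obtain ⟨r, hr1, hr2, hr3⟩ := exists_reset_of_alarmAt hv hvt h2 ⟨a, by omega, h3⟩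
  exact fun h => h r (by omega) hr2 hr3

lemma lastReset_eq_of_not_alarm {x : ℕ → Fin K → Fin K → Bool} {s v : ℕ}
    (hs : D.lastReset x (s + 1) = s) (hsv : s < v) (hno : ¬ D.Alarm x s (s + 1) v) :
    D.lastReset x v = s := by
  refine lastReset_eq_of_forall_not_alarmAt hs hsv fun t _ h2 h3 => ?_
  exact hno (alarm_succ_iff.2 ⟨t, h2, h3⟩)

namespace DetectionBounds

/-- An alarm in the last L steps of the segment has a window starting no earlier than `E.finish m -
L - (w - 1) d`. This is at least `E.start m + d`, because the segment has length at least 2L and L =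
(w - 1) d + d, so `hal` excludes it. -/
lemma lastReset_finish_of_noReset (h : D.DetectionBounds E μ X p q) (m : Fin M)
    {x : ℕ → Fin K → Fin K → Bool}
    (hno : D.NoReset x (E.start m - 1) (E.finish m - D.L))
    (hal : ¬ D.Alarm x (D.lastReset x (E.start m)) (E.start m + D.period) (E.finish m)) :
    D.lastReset x (E.finish m) = D.lastReset x (E.start m) := by
  have hlen := h.length m
  have hw := h.window_add_period
  have hL : D.lastReset x (E.finish m - D.L) = D.lastReset x (E.start m) :=
    lastReset_eq_of_forall_ne (by omega) fun s h1 h2 => hno s (by omega) h2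
  refine lastReset_eq_of_forall_not_alarmAt hL (Nat.sub_le _ _) fun t h1 h2 h3 => ?_
  exact hal (h3.alarm (by omega) h2)

/-- The case of `prob_delay_le` with a trivial further event and e = 1. -/
lemma prob_badDetection_le (h : D.DetectionBounds E μ X p q) (m : Fin M) (hm : (m : ℕ) + 1 < M)
    {s u : ℕ} (hadm : D.Admissible s u (E.start m))
    (hu : u + (D.w - 1) * D.period ≤ E.finish m) :
    outcomeProb μ X (fun x => D.BadDetection x s u (E.finish m)) ≤ p + q * (1 - p) := by
  have := h.isProb
  have h1 := h.prob_delay_le m hm hadm hu (B := fun _ => True) (e := 1) (.const True)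
    outcomeProb_le_one h.q_le_one
  simp only [and_true, one_mul, mul_one] at h1
  exact outcomeProb_or_le.trans h1

/-- Conditioning on the time of the last reset before segment `m`. -/
lemma prob_lastReset_le (h : D.DetectionBounds E μ X p q) (m : Fin M) {c : ℕ}
    (hc : E.start m ≤ c) (hcT : c ≤ T + 1) {A : (ℕ → Fin K → Fin K → Bool) → Prop}
    {B : ℕ → (ℕ → Fin K → Fin K → Bool) → Prop} {ε : ℝ}
    (hA : OutcomesDependOn A (timeBlock K 1 c))
    (hB : ∀ s < E.start m, OutcomesDependOn (B s) (timeBlock K c (T + 1)))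
    (hε : ∀ s < E.start m, outcomeProb μ X (B s) ≤ ε) :
    outcomeProb μ X (fun x => A x ∧ B (D.lastReset x (E.start m)) x) ≤ ε * outcomeProb μ X A := by
  have := h.isProb
  have hs := E.one_le_start m
  have key := outcomeProb_cut_le (T := T) h.measurable h.indep (Finset.range (E.start m))
    (fun s x => A x ∧ D.lastReset x (E.start m) = s) B (fun _ => c) (ε := ε)
    (fun s _ => ⟨by omega, hcT⟩)
    (fun s _ => hA.and ((lastReset_dependsOn (fun r => r = s) _).mono (timeBlock_mono le_rfl hc)))
    (fun s hs => hB s (Finset.mem_range.1 hs))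
    (fun x s _ s' _ h1 h2 => h1.2.symm.trans h2.2)
    (fun s hs => hε s (Finset.mem_range.1 hs))
  have hmem : ∀ x, D.lastReset x (E.start m) ∈ Finset.range (E.start m) := fun x =>
    Finset.mem_range.2 (lastReset_lt x (by omega))
  have e1 : outcomeProb μ X (fun x => ∃ s ∈ Finset.range (E.start m),
      A x ∧ D.lastReset x (E.start m) = s) = outcomeProb μ X A :=
    outcomeProb_congr fun x => ⟨fun ⟨_, _, h1, _⟩ => h1, fun h1 => ⟨_, hmem x, h1, rfl⟩⟩
  rw [e1] at key
  exact (outcomeProb_mono fun x hx => ⟨_, hmem x, ⟨hx.1, rfl⟩, hx.2⟩).trans key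

lemma admissible_phase {s α : ℕ} (hs : s < α) {u : ℕ} (hu : α + D.period ≤ u) :
    D.Admissible s u α :=
  ⟨by omega, Or.inr hu⟩

lemma admissible_succ {s α : ℕ} (hs : α - 1 ≤ s) : D.Admissible s (s + 1) α :=
  ⟨by omega, Or.inl ⟨rfl, by omega⟩⟩

/-- A property decided before segment `m`, jointly with a bad detection at the end of segment `m`
for the detection phases at its start. -/
lemma prob_and_bad_le (h : D.DetectionBounds E μ X p q) (m : Fin M) (hm : (m : ℕ) + 1 < M)
    {A : (ℕ → Fin K → Fin K → Bool) → Prop}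
    (hA : OutcomesDependOn A (timeBlock K 1 (E.start m))) :
    outcomeProb μ X (fun x => A x ∧
      D.BadDetection x (D.lastReset x (E.start m)) (E.start m + D.period) (E.finish m)) ≤
      (p + q * (1 - p)) * outcomeProb μ X A := by
  have hlen := h.length m
  have hw := h.window_add_period
  have hst := E.start_lt_finish m
  have hT := E.finish_le m
  have h2 := h.finish_add_halfL_le m hm
  have h3 := E.finish_le ⟨m + 1, hm⟩
  refine h.prob_lastReset_le m le_rfl (by omega) hA
    (B := fun s x => D.BadDetection x s (E.start m + D.period) (E.finish m))
    (fun s hs => ?_) fun s hs => ?_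
  · exact (badDetection_dependsOn (by omega)).mono
      ((sampleBlock_subset _ _ _).trans (timeBlock_mono (by omega) (by omega)))
  · exact h.prob_badDetection_le m hm (admissible_phase hs le_rfl) (by omega)

lemma prob_exists_firstReset (h : D.DetectionBounds E μ X p q) {a b : ℕ} (hb : b ≤ T + 1) :
    outcomeProb μ X (fun x => ∃ s ∈ Finset.Ico a b, D.FirstReset x a s) =
      1 - outcomeProb μ X (fun x => D.NoReset x a b) := by
  have := h.isProb
  rw [← outcomeProb_not h.measurable ((noReset_dependsOn a b).mono (timeBlock_mono le_rfl hb))]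
  exact outcomeProb_congr fun x => exists_firstReset_iff

/-- A bound on the probability that the changepoint after segment `m` is not detected in time. -/
lemma prob_noReset_succ_le (h : D.DetectionBounds E μ X p q) (m : Fin M) (hm : (m : ℕ) + 1 < M) :
    outcomeProb μ X (fun x => D.NoReset x (E.finish m - 1) (E.finish m + D.halfL)) ≤
      (p + q * (1 - p)) *
        (1 - outcomeProb μ X (fun x => D.NoReset x (E.start m - 1) (E.finish m - D.L))) +
      outcomeProb μ X (fun x => D.NoReset x (E.start m - 1) (E.finish m - D.L) ∧
        D.BadDetection x (D.lastReset x (E.start m)) (E.start m + D.period) (E.finish m)) := by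
  have := h.isProb
  have hlen := h.length m
  have hw := h.window_add_period
  have hst := E.one_le_start m
  have hT := E.finish_le m
  have hd := h.period_pos
  have h2 := h.finish_add_halfL_le m hm
  have h3 := E.finish_le ⟨m + 1, hm⟩
  -- A first reset at s < `E.finish m - L` leaves room for a full window before the changepoint, so
  -- missing the changepoint requires a bad detection by the detector of s, which only uses samples
  -- after s. Without such a reset the detector inherited from earlier segments must behave badly.
  have hcover : ∀ x, D.NoReset x (E.finish m - 1) (E.finish m + D.halfL) →
      (∃ s ∈ Finset.Ico (E.start m - 1) (E.finish m - D.L), D.FirstReset x (E.start m - 1) s ∧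
        D.BadDetection x s (s + 1) (E.finish m)) ∨
      (D.NoReset x (E.start m - 1) (E.finish m - D.L) ∧
        D.BadDetection x (D.lastReset x (E.start m)) (E.start m + D.period) (E.finish m)) := by
    intro x hx
    by_cases hno : D.NoReset x (E.start m - 1) (E.finish m - D.L)
    · right
      refine ⟨hno, ?_⟩
      by_contra hbad
      unfold BadDetection at hbad
      push Not at hbad
      have hlt := D.lastReset_lt x (t := E.start m) (by omega)
      exact not_noReset_of_alarm (by omega) (h.lastReset_finish_of_noReset m hno hbad.1)
        hbad.1 hbad.2 hx
    · left
      obtain ⟨s, hs, hfirst⟩ := exists_firstReset_iff.2 hno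
      refine ⟨s, hs, hfirst, ?_⟩
      rw [Finset.mem_Ico] at hs
      by_contra hbad
      unfold BadDetection at hbad
      push Not at hbad
      exact not_noReset_of_alarm (Nat.lt_succ_self s)
        (lastReset_eq_of_not_alarm hfirst.1 (by omega) hbad.1) hbad.1 hbad.2 hx
  refine (outcomeProb_mono hcover).trans (outcomeProb_or_le.trans ?_)
  rw [← h.prob_exists_firstReset (by omega)]
  refine add_le_add_left ?_ _
  refine outcomeProb_cut_le h.measurable h.indep _ _ _ (fun s => s + 1) ?_
    (fun s _ => firstReset_dependsOn _ s) ?_ ?_ ?_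
  · intro s hs
    rw [Finset.mem_Ico] at hs
    omega
  · intro s hs
    rw [Finset.mem_Ico] at hs
    exact (badDetection_dependsOn (Nat.lt_succ_self s)).mono
      ((sampleBlock_subset _ _ _).trans (timeBlock_mono le_rfl (by omega)))
  · intro x s hs s' hs' h1 h2
    rw [Finset.mem_Ico] at hs hs'
    exact h1.unique hs.1 hs'.1 h2
  · intro s hs
    rw [Finset.mem_Ico] at hs
    exact h.prob_badDetection_le m hm (admissible_succ hs.1) (by omega)

/-- The absence of resets over most of the segment is not independent of its samples. An alarm is
therefore bounded by p on its own; otherwise the absence of resets is weakened to the first L/2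
steps and the detection to samples taken after them, which makes the two independent. -/
lemma prob_noReset_and_bad_le (h : D.DetectionBounds E μ X p q) (m : Fin M)
    (hm : (m : ℕ) + 1 < M) :
    outcomeProb μ X (fun x => D.NoReset x (E.start m - 1) (E.finish m - D.L) ∧
        D.BadDetection x (D.lastReset x (E.start m)) (E.start m + D.period) (E.finish m)) ≤
      p + (p + q * (1 - p)) *
        outcomeProb μ X (fun x => D.NoReset x (E.start m - 1) (E.start m + D.halfL)) := by
  have := h.isProb
  have hlen := h.length m
  have hw := h.window_add_period
  have hst := E.one_le_start m
  have hT := E.finish_le m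
  have hd := h.period_le_halfL
  have hd0 := h.period_pos
  have hL := h.L_eq
  have h2 := h.finish_add_halfL_le m hm
  have h3 := E.finish_le ⟨m + 1, hm⟩
  have hcover : ∀ x, (D.NoReset x (E.start m - 1) (E.finish m - D.L) ∧
        D.BadDetection x (D.lastReset x (E.start m)) (E.start m + D.period) (E.finish m)) →
      (True ∧ D.Alarm x (D.lastReset x (E.start m)) (E.start m + D.period) (E.finish m)) ∨
      (D.NoReset x (E.start m - 1) (E.start m + D.halfL) ∧
        D.BadDetection x (D.lastReset x (E.start m)) (E.start m + D.halfL) (E.finish m)) := by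
    rintro x ⟨hno, hbad⟩
    rcases hbad with hbad | hbad
    · exact Or.inl ⟨trivial, hbad⟩
    · refine Or.inr ⟨hno.mono le_rfl (by omega), Or.inr fun hal => hbad ?_⟩
      exact hal.mono (by omega) le_rfl
  refine (outcomeProb_mono hcover).trans (outcomeProb_or_le.trans (add_le_add ?_ ?_))
  · have := h.prob_lastReset_le m le_rfl (by omega) (A := fun _ => True)
      (B := fun s x => D.Alarm x s (E.start m + D.period) (E.finish m)) (ε := p) (.const True)
      (fun s hs => (alarm_dependsOn' (by omega)).mono (timeBlock_mono (by omega) hT))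
      (fun s hs => h.prob_alarm_le m (admissible_phase hs le_rfl))
    rwa [outcomeProb_const_true, mul_one] at this
  · exact h.prob_lastReset_le m (Nat.le_add_right _ _) (by omega)
      (B := fun s x => D.BadDetection x s (E.start m + D.halfL) (E.finish m))
      (noReset_dependsOn _ _)
      (fun s hs => (badDetection_dependsOn (by omega)).mono
        ((sampleBlock_subset _ _ _).trans (timeBlock_mono le_rfl (by omega))))
      (fun s hs => h.prob_badDetection_le m hm (admissible_phase hs (by omega)) (by omega))

/-- A missed changepoint or a false alarm in segment `m`. -/
def _root_.MDB.Fails (D : MDB K St Sd) (E : DuelingProblem K T M) (m : Fin M)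
    (x : ℕ → Fin K → Fin K → Bool) : Prop :=
  D.NoReset x (E.start m - 1) (E.start m + D.halfL) ∨
    ∃ s ∈ Finset.Ico (E.start m - 1) (E.start m + D.halfL),
      D.FirstReset x (E.start m - 1) s ∧ D.Alarm x s (s + 1) (E.finish m)

/-- A reset at s is decided by the outcomes up to s and a later alarm uses only samples after s, so
the false alarm bound p multiplies the probability of a timely first reset. -/
lemma prob_fails_le (h : D.DetectionBounds E μ X p q) (m : Fin M) :
    outcomeProb μ X (D.Fails E m) ≤
      outcomeProb μ X (fun x => D.NoReset x (E.start m - 1) (E.start m + D.halfL)) +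
      p * (1 - outcomeProb μ X (fun x => D.NoReset x (E.start m - 1) (E.start m + D.halfL))) := by
  have := h.isProb
  have hlen := h.length m
  have hL := h.L_eq
  have hT := E.finish_le m
  have hd := h.period_le_halfL
  have hd0 := h.period_pos
  refine outcomeProb_or_le.trans (add_le_add_right ?_ _)
  rw [← h.prob_exists_firstReset (by omega)]
  refine outcomeProb_cut_le h.measurable h.indep _ _ _ (fun s => s + 1) ?_
    (fun s _ => firstReset_dependsOn _ s) ?_ ?_ ?_
  · intro s hs
    rw [Finset.mem_Ico] at hs
    omega
  · exact fun s hs => (alarm_dependsOn' (Nat.lt_succ_self s)).mono (timeBlock_mono le_rfl hT)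
  · intro x s hs s' hs' h1 h2
    rw [Finset.mem_Ico] at hs hs'
    exact h1.unique hs.1 hs'.1 h2
  · intro s hs
    rw [Finset.mem_Ico] at hs
    exact h.prob_alarm_le m (admissible_succ hs.1)

end DetectionBounds

end MDB

namespace MDB

variable {K T M : ℕ} {St Sd : Type*} [MeasurableSpace St] [MeasurableSpace Sd]
  {Ω : Type*} [MeasurableSpace Ω] {D : MDB K St Sd} {E : DuelingProblem K T M} {μ : Measure Ω}
  {X : ℕ → Fin K → Fin K → Ω → Bool} {p q : ℝ}

namespace DetectionBounds

/-- If the detector in force raises no alarm before the changepoint, it is still in force there; it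
must then stay silent for L/2 more steps, and `B` refers to the same reset. If it does raise one,
`B` stays attached to whatever the last reset is, which is decided before the changepoint. -/
lemma noReset_and_bad_cover (h : D.DetectionBounds E μ X p q) (m : Fin M)
    (x : ℕ → Fin K → Fin K → Bool) {B : ℕ → Prop}
    (hno : D.NoReset x (E.finish m - 1) (E.finish m + D.halfL))
    (hB : B (D.lastReset x (E.finish m))) :
    ((∃ s ∈ Finset.Ico (E.start m - 1) (E.finish m - D.L), D.FirstReset x (E.start m - 1) s ∧
        D.Alarm x s (s + 1) (E.finish m)) ∧ B (D.lastReset x (E.finish m)) ∨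
      ∃ s ∈ Finset.Ico (E.start m - 1) (E.finish m - D.L), D.FirstReset x (E.start m - 1) s ∧
        ¬ D.Alarm x s (s + 1) (E.finish m + D.halfL) ∧ B s) ∨
    ((D.NoReset x (E.start m - 1) (E.finish m - D.L) ∧
        D.Alarm x (D.lastReset x (E.start m)) (E.start m + D.period) (E.finish m)) ∧
        B (D.lastReset x (E.finish m)) ∨
      D.NoReset x (E.start m - 1) (E.start m + D.halfL) ∧
        ¬ D.Alarm x (D.lastReset x (E.start m)) (E.start m + D.halfL) (E.finish m + D.halfL) ∧
          B (D.lastReset x (E.start m))) := by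
  have hlen := h.length m
  have hL := h.L_eq
  have hd := h.period_le_halfL
  by_cases hno' : D.NoReset x (E.start m - 1) (E.finish m - D.L)
  · right
    by_cases hal : D.Alarm x (D.lastReset x (E.start m)) (E.start m + D.period) (E.finish m)
    · exact Or.inl ⟨⟨hno', hal⟩, hB⟩
    · have hst := E.one_le_start m
      have hlt := D.lastReset_lt x (t := E.start m) (by omega)
      have heq := h.lastReset_finish_of_noReset m hno' hal
      refine Or.inr ⟨hno'.mono le_rfl (by omega), fun hal' => ?_, heq ▸ hB⟩
      exact not_noReset_of_alarm (by omega) heq hal (hal'.mono (by omega) le_rfl) hno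
  · left
    obtain ⟨s, hs, hfirst⟩ := exists_firstReset_iff.2 hno'
    have hs' := Finset.mem_Ico.1 hs
    by_cases hal : D.Alarm x s (s + 1) (E.finish m)
    · exact Or.inl ⟨⟨s, hs, hfirst, hal⟩, hB⟩
    · have heq := lastReset_eq_of_not_alarm hfirst.1 (by omega) hal
      refine Or.inr ⟨s, hs, hfirst, fun hal' => ?_, heq ▸ hB⟩
      exact not_noReset_of_alarm (Nat.lt_succ_self s) heq hal hal' hno

/-- Two bad detections in a row. -/
lemma prob_noReset_and_bad_succ_le (h : D.DetectionBounds E μ X p q) (m m' : Fin M)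
    (hmm : (m' : ℕ) = m + 1) (hm : (m' : ℕ) + 1 < M) :
    outcomeProb μ X (fun x => D.NoReset x (E.start m' - 1) (E.finish m' - D.L) ∧
        D.BadDetection x (D.lastReset x (E.start m')) (E.start m' + D.period) (E.finish m')) ≤
      (p * (p + q * (1 - p)) + q * (1 - p)) *
        (1 - outcomeProb μ X (fun x => D.NoReset x (E.start m - 1) (E.finish m - D.L))) +
      (p + q * (1 - p)) *
        outcomeProb μ X (fun x => D.NoReset x (E.start m - 1) (E.finish m - D.L) ∧
        D.BadDetection x (D.lastReset x (E.start m)) (E.start m + D.period) (E.finish m)) +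
      (p * (p + q * (1 - p)) + q * (1 - p)) *
        outcomeProb μ X (fun x => D.NoReset x (E.start m - 1) (E.start m + D.halfL)) := by
  have := h.isProb
  have hm1 : (m : ℕ) + 1 < M := by omega
  obtain rfl : m' = ⟨m + 1, hm1⟩ := Fin.ext hmm
  have hstart := E.start_succ m hm1
  set m' : Fin M := ⟨m + 1, hm1⟩
  have hlen := h.length m
  have hlen' := h.length m'
  rw [hstart] at hlen' ⊢
  have hL := h.L_eq
  have hd := h.period_le_halfL
  have hd0 := h.period_pos
  have hst := E.one_le_start m
  have hw := h.window_add_period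
  have h2 := h.finish_add_halfL_le m' hm
  have h3 := E.finish_le ⟨m' + 1, hm⟩
  have hT := E.finish_le m'
  have hp0 := h.p_nonneg
  have hp1 := h.p_le_one
  have hq0 := h.q_nonneg
  have hq1 := h.q_le_one
  set β := E.finish m
  set α := E.start m
  set γ := E.finish m'
  set e := p + q * (1 - p) with he
  have hqe : q ≤ e := by nlinarith
  have he0 : 0 ≤ e := hq0.trans hqe
  set κ := p * e + q * (1 - p)
  let B : ℕ → (ℕ → Fin K → Fin K → Bool) → Prop := fun s x => D.BadDetection x s (β + D.period) γ
  have hBdep : ∀ s < β, OutcomesDependOn (B s) (D.sampleBlock s β (T + 1)) := fun s hs =>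
    (badDetection_dependsOn (by omega)).mono (sampleBlock_mono (by omega) (by omega))
  have hBprob : ∀ s < β, outcomeProb μ X (B s) ≤ e := fun s hs =>
    h.prob_badDetection_le m' hm (admissible_phase (by rw [hstart]; omega) (by rw [hstart]))
      (by omega)
  have hphase : ∀ A : (ℕ → Fin K → Fin K → Bool) → Prop, OutcomesDependOn A (timeBlock K 1 β) →
      outcomeProb μ X (fun x => A x ∧ B (D.lastReset x β) x) ≤ e * outcomeProb μ X A :=
    fun A hA => h.prob_and_bad_le m' hm (by rwa [hstart])
  refine (outcomeProb_mono fun x hx => h.noReset_and_bad_cover m x (B := fun s => B s x)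
    (hx.1.mono le_rfl (by omega)) hx.2).trans (outcomeProb_or_le.trans ?_)
  have hS : ∀ s ∈ Finset.Ico (α - 1) (β - D.L), α - 1 ≤ s ∧ s < β - D.L := fun s hs =>
    Finset.mem_Ico.1 hs
  have hfirstdep : ∀ s ∈ Finset.Ico (α - 1) (β - D.L),
      OutcomesDependOn (fun x => D.FirstReset x (α - 1) s) (timeBlock K 1 (T + 1)) := fun s hs =>
    (firstReset_dependsOn _ s).mono (timeBlock_mono le_rfl (by have := hS s hs; omega))
  have hfirst : outcomeProb μ X (fun x =>
        (∃ s ∈ Finset.Ico (α - 1) (β - D.L), D.FirstReset x (α - 1) s ∧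
          D.Alarm x s (s + 1) β) ∧ B (D.lastReset x β) x ∨
        ∃ s ∈ Finset.Ico (α - 1) (β - D.L), D.FirstReset x (α - 1) s ∧
          ¬ D.Alarm x s (s + 1) (β + D.halfL) ∧ B s x) ≤
      κ * (1 - outcomeProb μ X (fun x => D.NoReset x (α - 1) (β - D.L))) := by
    refine outcomeProb_or_le.trans ?_
    rw [← h.prob_exists_firstReset (by omega), outcomeProb_exists_eq _ _ h.measurable hfirstdep
      (fun x s hs s' hs' h1 h2 => h1.unique (hS s hs).1 (hS s' hs').1 h2)]
    have hdep1 : ∀ s ∈ Finset.Ico (α - 1) (β - D.L), OutcomesDependOn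
        (fun x => D.Alarm x s (s + 1) β) (timeBlock K (s + 1) β) := fun s hs =>
      alarm_dependsOn' (Nat.lt_succ_self s)
    have g1 := hphase (fun x => ∃ s ∈ Finset.Ico (α - 1) (β - D.L),
      D.FirstReset x (α - 1) s ∧ D.Alarm x s (s + 1) β)
      (.exists' fun s => .and_of_imp fun hs =>
        ((firstReset_dependsOn _ s).mono (timeBlock_mono le_rfl (by have := hS s hs; omega))).and
          ((hdep1 s hs).mono (timeBlock_mono (by omega) le_rfl)))
    refine (add_le_add (g1.trans (mul_le_mul_of_nonneg_left (outcomeProb_exists_le _ _) he0))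
      (outcomeProb_exists_le _ _)).trans ?_
    rw [Finset.mul_sum, Finset.mul_sum, ← Finset.sum_add_distrib]
    refine Finset.sum_le_sum fun s hs => ?_
    have hs' := hS s hs
    rw [outcomeProb_and_block h.measurable h.indep le_rfl (by omega : β ≤ T + 1) (by omega)
        (by omega) (firstReset_dependsOn _ s) (hdep1 s hs),
      outcomeProb_and_block h.measurable h.indep le_rfl (le_refl (T + 1)) (by omega)
        (by omega) (firstReset_dependsOn _ s)
        (((alarm_dependsOn' (Nat.lt_succ_self s)).not.mono (timeBlock_mono le_rfl (by omega))).and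
          ((hBdep s (by omega)).mono ((sampleBlock_subset _ _ _).trans
            (timeBlock_mono (by omega) le_rfl))))]
    -- Silence after β and `B s` use overlapping samples, so their probabilities cannot be
    -- multiplied. The weight e on the early alarms and this joint term are exactly the left-hand
    -- side of `prob_delay_le`.
    have g2 := h.prob_delay_le m hm1 (admissible_succ hs'.1) (by omega) (hBdep s (by omega))
      (hBprob s (by omega)) hqe
    have g3 := mul_le_mul_of_nonneg_left g2
      (outcomeProb_nonneg (μ := μ) (X := X) (A := fun x => D.FirstReset x (α - 1) s))
    refine le_trans (le_of_eq ?_) (g3.trans (le_of_eq ?_)) <;> ring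
  have hsecond : outcomeProb μ X (fun x =>
        (D.NoReset x (α - 1) (β - D.L) ∧
          D.Alarm x (D.lastReset x α) (α + D.period) β) ∧ B (D.lastReset x β) x ∨
        D.NoReset x (α - 1) (α + D.halfL) ∧
          ¬ D.Alarm x (D.lastReset x α) (α + D.halfL) (β + D.halfL) ∧ B (D.lastReset x α) x) ≤
      e * outcomeProb μ X (fun x => D.NoReset x (α - 1) (β - D.L) ∧
        D.BadDetection x (D.lastReset x α) (α + D.period) β) +
      κ * outcomeProb μ X (fun x => D.NoReset x (α - 1) (α + D.halfL)) := by
    refine outcomeProb_or_le.trans (add_le_add ?_ ?_)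
    · refine (hphase _ ?_).trans (mul_le_mul_of_nonneg_left
        (outcomeProb_mono fun x hx => ⟨hx.1, Or.inl hx.2⟩) he0)
      refine ((noReset_dependsOn _ _).mono (timeBlock_mono le_rfl (by omega))).and ?_
      intro x y hxy
      have e1 : D.lastReset x α = D.lastReset y α :=
        lastReset_congr fun c hc => hxy c (timeBlock_mono le_rfl (by omega) hc)
      change D.Alarm x (D.lastReset x α) _ _ ↔ D.Alarm y (D.lastReset y α) _ _
      rw [e1]
      have hlt := D.lastReset_lt y (t := α) (by omega)
      exact (alarm_dependsOn' (by omega)).mono (timeBlock_mono (by omega) le_rfl) x y hxy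
    · refine h.prob_lastReset_le m (c := α + D.halfL) (Nat.le_add_right _ _) (by omega)
        (B := fun s x => ¬ D.Alarm x s (α + D.halfL) (β + D.halfL) ∧ B s x)
        (noReset_dependsOn _ _) (fun s hs => ?_) fun s hs => ?_
      · exact ((alarm_dependsOn' (by omega)).not.mono (timeBlock_mono le_rfl (by omega))).and
          ((hBdep s (by omega)).mono ((sampleBlock_subset _ _ _).trans
            (timeBlock_mono (by omega) le_rfl)))
      · have g2 := h.prob_delay_le m hm1 (u := α + D.halfL) (admissible_phase hs (by omega))
          (by omega) (hBdep s (by omega)) (hBprob s (by omega)) hqe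
        -- Early alarms of the old detector are already counted in the other event, so their term in
        -- `prob_delay_le` is dropped.
        have g3 := mul_nonneg he0 (outcomeProb_nonneg (μ := μ) (X := X)
          (A := fun x => D.Alarm x s (α + D.halfL) β))
        linarith
  linarith

end DetectionBounds

end MDB

-- Closing the recursion for missed changepoints.

lemma missed_bound_of_le {p q : ℝ} (hp : 0 ≤ p) (hpq : p ≤ q) (h : p + q ≤ 1 / 2) :
    (1 - p) * ((p + q * (1 - p)) + (1 - (p + q * (1 - p))) * p) +
      (1 - (p + q * (1 - p))) * (p + q * (1 - p)) * (p + 2 * q) ≤ p + 2 * q := by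
  obtain ⟨r, rfl⟩ : ∃ r, q = p + r := ⟨q - p, by ring⟩
  have hr : 0 ≤ r := by linarith
  have h1 : 0 ≤ r * (1 - 2 * r - 4 * p) := mul_nonneg hr (by linarith)
  have h2 : 0 ≤ r ^ 3 * (2 - 4 * p) := mul_nonneg (by positivity) (by linarith)
  have h3 : 0 ≤ p * r ^ 2 * (13 - 18 * p) := mul_nonneg (by positivity) (by linarith)
  have h4 : 0 ≤ p ^ 2 * r * (22 - 25 * p) := mul_nonneg (by positivity) (by linarith)
  have h5 : 0 ≤ p ^ 3 * (11 - 11 * p) := mul_nonneg (by positivity) (by linarith)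
  have h6 : 0 ≤ 2 * p ^ 2 * r ^ 3 + 7 * p ^ 3 * r ^ 2 + 8 * p ^ 4 * r + 3 * p ^ 5 := by positivity
  linarith

/-- The induction step for y, the bound on two bad detections in a row, when q ≤ p. After
substituting p = q + r, the inequality follows from grouping the monomials into products that are
nonnegative for 2q + r ≤ 1/2. -/
lemma twice_missed_bound_of_ge {p q : ℝ} (hq : 0 ≤ q) (hpq : q ≤ p) (h : p + q ≤ 1 / 2) :
    (1 - p) ^ 2 * (1 - q) * (p * (p + q * (1 - p)) + q * (1 - p)) +
      ((p + q * (1 - p)) - (p * (p + q * (1 - p)) + q * (1 - p))) *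
        (q + p ^ 2 + 2 * p * q - p ^ 2 * q) +
      (p * (p + q * (1 - p)) + q * (1 - p)) * ((1 - p) * (1 - q)) * (p + 2 * q) ≤
      q + p ^ 2 + 2 * p * q - p ^ 2 * q := by
  obtain ⟨r, rfl⟩ : ∃ r, p = q + r := ⟨p - q, by ring⟩
  have hr : 0 ≤ r := by linarith
  have h1 : 0 ≤ q * r * (2 - 2 * r - 2 * q) := mul_nonneg (by positivity) (by linarith)
  have h2 : 0 ≤ q ^ 3 * (2 + 22 * r - 32 * r ^ 2 - 30 * (q * r)) :=
    mul_nonneg (by positivity) (by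
      have : 0 ≤ r * (1 / 2 - r) := mul_nonneg hr (by linarith)
      have : 0 ≤ r * (1 / 4 - q) := mul_nonneg hr (by linarith)
      linarith)
  have h3 : 0 ≤ q * r ^ 3 * (8 - 2 * r) := mul_nonneg (by positivity) (by linarith)
  have h4 : 0 ≤ q ^ 2 * r ^ 2 * (22 - 14 * r) := mul_nonneg (by positivity) (by linarith)
  have h5 : 0 ≤ q ^ 4 * (7 - 10 * q) := mul_nonneg (by positivity) (by linarith)
  have h6 : 0 ≤ q ^ 2 + r ^ 4 + q ^ 2 * r ^ 4 + 6 * q ^ 3 * r ^ 3 + 12 * q ^ 4 * r ^ 2 +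
    10 * q ^ 5 * r + 3 * q ^ 6 := by positivity
  linarith

namespace MDB

variable {K T M : ℕ} {St Sd : Type*} [MeasurableSpace St] [MeasurableSpace Sd]
  {Ω : Type*} [MeasurableSpace Ω] {D : MDB K St Sd} {E : DuelingProblem K T M} {μ : Measure Ω}
  {X : ℕ → Fin K → Fin K → Ω → Bool} {p q : ℝ}

namespace DetectionBounds

/-- The first segment starts at time 1 and the initialization counts as a reset at time 0, which
lies in the range considered. -/
lemma prob_noReset_zero (m : Fin M) (hm : (m : ℕ) = 0) {b : ℕ}
    (hb : 0 < b) (B : (ℕ → Fin K → Fin K → Bool) → Prop) :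
    outcomeProb μ X (fun x => D.NoReset x (E.start m - 1) b ∧ B x) = 0 := by
  have hs : E.start m = 1 := by
    have : m.castSucc = 0 := Fin.ext hm
    rw [DuelingProblem.start, this, E.cp_zero]
  rw [← measureReal_empty (μ := μ)]
  unfold outcomeProb
  congr 1
  ext ω
  simp only [Set.mem_ofPred_eq, Set.mem_empty_iff_false, iff_false, not_and]
  intro hno
  refine absurd ?_ (hno 0 (by omega) hb)
  have := D.lastReset_succ_le (outcomesAt X ω) 0
  omega

/-- Changepoints are missed with small probability. -/
lemma prob_missed_le (h : D.DetectionBounds E μ X p q) (hpq : p + q ≤ 1 / 2) (n : ℕ) :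
    ∀ m : Fin M, (m : ℕ) = n →
    (1 - p) * outcomeProb μ X (fun x => D.NoReset x (E.start m - 1) (E.start m + D.halfL)) ≤
      p + 2 * q ∧
    (q ≤ p → (m : ℕ) + 1 < M → (1 - p) ^ 2 * (1 - q) *
      outcomeProb μ X (fun x => D.NoReset x (E.start m - 1) (E.finish m - D.L) ∧
        D.BadDetection x (D.lastReset x (E.start m)) (E.start m + D.period) (E.finish m)) ≤
      q + p ^ 2 + 2 * p * q - p ^ 2 * q) := by
  have := h.isProb
  have hp0 := h.p_nonneg
  have hq0 := h.q_nonneg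
  have hp1 : 0 ≤ 1 - p := by linarith
  have hq1 : 0 ≤ 1 - q := by linarith
  have hd := h.period_le_halfL
  have hd0 := h.period_pos
  have hc0 : 0 ≤ q + p ^ 2 + 2 * p * q - p ^ 2 * q := by
    have : 0 ≤ p * q * (2 - p) := mul_nonneg (by positivity) (by linarith)
    nlinarith
  induction n with
  | zero =>
    intro m hm
    have hlen := h.length m
    have hL := h.L_eq
    have h0 := prob_noReset_zero (D := D) (E := E) (μ := μ) (X := X) m hm
      (b := E.start m + D.halfL) (by omega) (fun _ => True)
    simp only [and_true] at h0
    rw [h0, prob_noReset_zero (D := D) (E := E) (μ := μ) (X := X) m hm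
      (by have := E.one_le_start m; omega)]
    refine ⟨by linarith, fun _ _ => by linarith⟩
  | succ n ih =>
    intro m' hm'
    have hmM : n < M := by omega
    obtain ⟨ihf, ihy⟩ := ih ⟨n, hmM⟩ rfl
    set m : Fin M := ⟨n, hmM⟩
    have hm1 : (m : ℕ) + 1 < M := by
      rw [← hm']
      exact m'.2
    obtain rfl : m' = ⟨m + 1, hm1⟩ := Fin.ext hm'
    have hS1 := h.prob_noReset_succ_le m hm1
    have hS3 := h.prob_noReset_and_bad_le m hm1
    have hxy : outcomeProb μ X (fun x => D.NoReset x (E.start m - 1) (E.finish m - D.L) ∧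
        D.BadDetection x (D.lastReset x (E.start m)) (E.start m + D.period) (E.finish m)) ≤
        outcomeProb μ X (fun x => D.NoReset x (E.start m - 1) (E.finish m - D.L)) :=
      outcomeProb_mono fun x hx => hx.1
    have hy0 : 0 ≤ outcomeProb μ X (fun x => D.NoReset x (E.start m - 1) (E.finish m - D.L) ∧
        D.BadDetection x (D.lastReset x (E.start m)) (E.start m + D.period) (E.finish m)) :=
      outcomeProb_nonneg
    have hS2 := h.prob_noReset_and_bad_succ_le m ⟨m + 1, hm1⟩ rfl
    rw [E.start_succ m hm1] at hS2 ⊢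
    set f := outcomeProb μ X (fun x => D.NoReset x (E.start m - 1) (E.start m + D.halfL))
    set f' := outcomeProb μ X (fun x => D.NoReset x (E.finish m - 1) (E.finish m + D.halfL))
    set ρ := outcomeProb μ X (fun x => D.NoReset x (E.start m - 1) (E.finish m - D.L))
    set y := outcomeProb μ X (fun x => D.NoReset x (E.start m - 1) (E.finish m - D.L) ∧
        D.BadDetection x (D.lastReset x (E.start m)) (E.start m + D.period) (E.finish m))
    have heq : 1 - (p + q * (1 - p)) = (1 - p) * (1 - q) := by ring
    have he0 : 0 ≤ p + q * (1 - p) := by positivity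
    set e := p + q * (1 - p) with he
    have he1 : 0 ≤ 1 - e := heq ▸ mul_nonneg hp1 hq1
    -- The unknown ρ is eliminated by y ≤ ρ.
    have hf' : f' ≤ e + (1 - e) * y := by
      have := mul_le_mul_of_nonneg_left hxy he0
      linarith
    have hf2 := mul_le_mul_of_nonneg_left hf' hp1
    refine ⟨?_, fun hqp hm2 => ?_⟩
    · rcases le_total p q with hle | hle
      · have key := missed_bound_of_le hp0 hle hpq
        rw [← he] at key
        have g1 := mul_le_mul_of_nonneg_left hS3 (mul_nonneg hp1 he1)
        have g2 := mul_le_mul_of_nonneg_left ihf (mul_nonneg he1 he0)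
        linarith
      · have g1 := ihy hle hm1
        have g2 : (1 - p) * ((1 - e) * y) = (1 - p) ^ 2 * (1 - q) * y := by rw [heq]; ring
        -- The invariant for y is chosen so that this identity holds.
        have g3 : (1 - p) * e + (q + p ^ 2 + 2 * p * q - p ^ 2 * q) = p + 2 * q := by
          rw [he]; ring
        linarith
    · have key := twice_missed_bound_of_ge hq0 hqp hpq
      rw [← he] at key
      have hS2 := hS2 hm2
      have hκ0 : 0 ≤ p * e + q * (1 - p) := by positivity
      have hκe : 0 ≤ e - (p * e + q * (1 - p)) := by
        have : e - (p * e + q * (1 - p)) = (1 - p) * (p * (1 - q)) := by rw [he]; ring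
        rw [this]
        positivity
      set κ := p * e + q * (1 - p)
      have g1 := mul_le_mul_of_nonneg_left hxy hκ0
      have g2 : κ * (1 - ρ) + e * y + κ * f ≤ κ + (e - κ) * y + κ * f := by linarith
      have hc : 0 ≤ (1 - p) ^ 2 * (1 - q) := by positivity
      have g3 := mul_le_mul_of_nonneg_left (hS2.trans g2) hc
      have g4 := mul_le_mul_of_nonneg_left (ihy hqp hm1) hκe
      have g5 := mul_le_mul_of_nonneg_left ihf (mul_nonneg hκ0 (mul_nonneg hp1 hq1))
      linarith

/-- The probability of a missed changepoint or a false alarm in a segment. -/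
lemma prob_fails_le_two_mul (h : D.DetectionBounds E μ X p q) (m : Fin M) :
    outcomeProb μ X (D.Fails E m) ≤ 2 * (p + q) := by
  have := h.isProb
  -- In the main case the bound is p + (1 - p) f ≤ p + (p + 2q); otherwise the right-hand side
  -- exceeds one.
  rcases le_or_gt (p + q) (1 / 2) with hpq | hpq
  · have h1 := (h.prob_missed_le hpq m m rfl).1
    have h2 := h.prob_fails_le m
    linarith
  · have h1 : outcomeProb μ X (D.Fails E m) ≤ 1 := outcomeProb_le_one
    linarith

end DetectionBounds

end MDB

/-! ### Independence of the time steps -/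

/-- The joint law of the two families is a product of two product measures, and rearranging the
factors gives a product over the pairs. -/
lemma iIndepFun_prodMk_of_indepFun {ι Ω : Type*} [Fintype ι] [MeasurableSpace Ω] {μ : Measure Ω}
    [IsProbabilityMeasure μ] {β γ : Type*} [MeasurableSpace β] [MeasurableSpace γ]
    {f : ι → Ω → β} {g : ι → Ω → γ} (hf : ∀ i, Measurable (f i)) (hg : ∀ i, Measurable (g i))
    (hfi : iIndepFun f μ) (hgi : iIndepFun g μ)
    (hfg : IndepFun (fun ω i => f i ω) (fun ω i => g i ω) μ) :
    iIndepFun (fun i ω => (f i ω, g i ω)) μ := by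
  have hf' : Measurable fun ω i => f i ω := measurable_pi_lambda _ hf
  have hg' : Measurable fun ω i => g i ω := measurable_pi_lambda _ hg
  have hprob : ∀ i, IsProbabilityMeasure (μ.map (f i)) := fun i =>
    Measure.isProbabilityMeasure_map (hf i).aemeasurable
  have hprob' : ∀ i, IsProbabilityMeasure (μ.map (g i)) := fun i =>
    Measure.isProbabilityMeasure_map (hg i).aemeasurable
  rw [iIndepFun_iff_map_fun_eq_pi_map fun i => ((hf i).prodMk (hg i)).aemeasurable]
  have h1 : ∀ i, μ.map (fun ω => (f i ω, g i ω)) = (μ.map (f i)).prod (μ.map (g i)) := by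
    intro i
    rw [← indepFun_iff_map_prod_eq_prod_map_map (hf i).aemeasurable (hg i).aemeasurable]
    exact hfg.comp (measurable_pi_apply i) (measurable_pi_apply i)
  have h2 := (indepFun_iff_map_prod_eq_prod_map_map hf'.aemeasurable hg'.aemeasurable).1 hfg
  rw [hfi.map_fun_eq_pi_map fun i => (hf i).aemeasurable,
    hgi.map_fun_eq_pi_map fun i => (hg i).aemeasurable] at h2
  have h3 := measurePreserving_arrowProdEquivProdArrow β γ ι (fun i => μ.map (f i))
    (fun i => μ.map (g i))
  simp_rw [h1]
  rw [← (h3.symm).map_eq, ← h2, Measure.map_map (MeasurableEquiv.measurable _) (hf'.prodMk hg')]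
  rfl

lemma iIndepFun_curry {ι κ Ω β : Type*} [Finite ι] [Finite κ] [MeasurableSpace Ω] {μ : Measure Ω}
    [IsProbabilityMeasure μ] [MeasurableSpace β] {f : ι × κ → Ω → β}
    (hf : ∀ c, Measurable (f c)) (h : iIndepFun f μ) :
    iIndepFun (fun i ω (k : κ) => f (i, k) ω) μ := by
  have hprob : ∀ c, IsProbabilityMeasure (μ.map (f c)) := fun c =>
    Measure.isProbabilityMeasure_map (hf c).aemeasurable
  rw [iIndepFun_iff_map_fun_eq_infinitePi_map fun i => measurable_pi_lambda _ fun k => hf _]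
  have h1 := (iIndepFun_iff_map_fun_eq_infinitePi_map hf).1 h
  have h2 : ∀ i, μ.map (fun ω (k : κ) => f (i, k) ω) =
      Measure.infinitePi fun k => μ.map (f (i, k)) := by
    intro i
    exact (iIndepFun_iff_map_fun_eq_infinitePi_map fun k => hf (i, k)).1
      (h.precomp (g := fun k => (i, k)) (Prod.mk_right_injective i))
  simp_rw [h2]
  rw [← Measure.infinitePi_map_curry (μ := fun i k => μ.map (f (i, k))), ← h1,
    Measure.map_map (MeasurableEquiv.measurable _) (measurable_pi_lambda _ hf)]
  rfl

namespace DuelingProblem.IsExperiment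

variable {K T M : ℕ} {E : DuelingProblem K T M} {Ω Sd : Type*} [MeasurableSpace Ω]
  [MeasurableSpace Sd] {μ : Measure Ω} [IsProbabilityMeasure μ]
  {X : ℕ → Fin K → Fin K → Ω → Bool} {ξ : ℕ → Ω → Sd}

/-- The outcomes and the seed at time `t`. -/
def _root_.stepData {K : ℕ} {Ω Sd : Type*} (X : ℕ → Fin K → Fin K → Ω → Bool) (ξ : ℕ → Ω → Sd)
    (t : ℕ) (ω : Ω) : (Fin K → Fin K → Bool) × Sd :=
  (fun i j => X t i j ω, ξ t ω)

lemma measurable_block (h : E.IsExperiment μ X ξ) (t : ℕ) :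
    Measurable fun ω (i j : Fin K) => X t i j ω :=
  measurable_pi_lambda _ fun i => measurable_pi_lambda _ fun j => h.measurable_outcome t i j

lemma measurable_stepData (h : E.IsExperiment μ X ξ) (t : ℕ) : Measurable (stepData X ξ t) :=
  (h.measurable_block t).prodMk (h.measurable_seed t)

lemma measurable_curry_block :
    Measurable fun (z : Fin K × Fin K → Bool) (i j : Fin K) => z (i, j) :=
  measurable_pi_lambda _ fun _ => measurable_pi_lambda _ fun _ => measurable_pi_apply _

lemma iIndepFun_stepData (h : E.IsExperiment μ X ξ) :
    iIndepFun (fun t : Finset.Icc 1 T => stepData X ξ t) μ := by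
  refine iIndepFun_prodMk_of_indepFun (fun t => h.measurable_block t)
    (fun t => h.measurable_seed t) ?_ h.indep_seeds ?_
  · exact (iIndepFun_curry (fun c => h.measurable_outcome _ _ _) h.indep_outcomes).comp
      (fun _ z i j => z (i, j)) fun _ => measurable_curry_block
  · refine h.indep.comp (φ := fun z (t : Finset.Icc 1 T) (i j : Fin K) => z (t, i, j)) (ψ := id)
      ?_ measurable_id
    exact measurable_pi_lambda _ fun _ => measurable_pi_lambda _ fun _ =>
      measurable_pi_lambda _ fun _ => measurable_pi_apply _

lemma mem_Icc_of_mem_segment {m : Fin M} {t : ℕ} (ht : t ∈ E.segment m) : t ∈ Finset.Icc 1 T := by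
  have h1 := E.one_le_start m
  have h2 := E.finish_le m
  rw [mem_segment] at ht
  exact Finset.mem_Icc.2 (by omega)

lemma map_block_eq (h : E.IsExperiment μ X ξ) {m : Fin M} {t t' : ℕ} (ht : t ∈ E.segment m)
    (ht' : t' ∈ E.segment m) :
    μ.map (fun ω (i j : Fin K) => X t i j ω) = μ.map fun ω (i j : Fin K) => X t' i j ω := by
  have hlaw : ∀ r ∈ E.segment m, μ.map (fun ω (i j : Fin K) => X r i j ω) =
      (Measure.pi fun ij : Fin K × Fin K => μ.map (X r ij.1 ij.2)).map
        fun z (i j : Fin K) => z (i, j) := by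
    intro r hr
    have h1 := (h.indep_outcomes.precomp
      (g := fun ij : Fin K × Fin K => (⟨r, mem_Icc_of_mem_segment hr⟩, ij))
      (Prod.mk_right_injective _)).map_fun_eq_pi_map
        fun ij => (h.measurable_outcome _ _ _).aemeasurable
    simp only at h1
    rw [← h1, Measure.map_map measurable_curry_block
      (measurable_pi_lambda _ fun _ => h.measurable_outcome _ _ _)]
    rfl
  rw [hlaw t ht, hlaw t' ht']
  congr 2
  ext1 ij
  refine map_eq_of_prob_true_eq (h.measurable_outcome _ _ _) (h.measurable_outcome _ _ _) ?_
  rw [h.bernoulli m t ht, h.bernoulli m t' ht']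

lemma map_stepData_eq (h : E.IsExperiment μ X ξ) {m : Fin M} {t t' : ℕ} (ht : t ∈ E.segment m)
    (ht' : t' ∈ E.segment m) : μ.map (stepData X ξ t) = μ.map (stepData X ξ t') := by
  have hprod : ∀ r ∈ E.segment m, μ.map (stepData X ξ r) =
      (μ.map fun ω (i j : Fin K) => X r i j ω).prod (μ.map (ξ r)) := by
    intro r hr
    have hproj : Measurable fun z : Finset.Icc 1 T → Sd => z ⟨r, mem_Icc_of_mem_segment hr⟩ :=
      measurable_pi_apply _
    refine (indepFun_iff_map_prod_eq_prod_map_map (h.measurable_block r).aemeasurable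
      (h.measurable_seed r).aemeasurable).1 ?_
    exact h.indep.comp
      (φ := fun z (i j : Fin K) => z (⟨r, mem_Icc_of_mem_segment hr⟩, i, j))
      (ψ := fun z : Finset.Icc 1 T → Sd => z ⟨r, mem_Icc_of_mem_segment hr⟩)
      (measurable_pi_lambda _ fun _ => measurable_pi_lambda _ fun _ => measurable_pi_apply _)
      hproj
  rw [hprod t ht, hprod t' ht', h.map_block_eq ht ht',
    (h.identDistrib t (mem_Icc_of_mem_segment ht) t' (mem_Icc_of_mem_segment ht')).map_eq]

/-- The law of the data of finitely many distinct time steps of a segment does not depend on the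
choice of the time steps. -/
lemma map_stepData_comp_eq (h : E.IsExperiment μ X ξ) {m : Fin M} {n : ℕ} {θ θ' : Fin n → ℕ}
    (hθ : Function.Injective θ) (hθ' : Function.Injective θ')
    (hm : ∀ j, θ j ∈ E.segment m) (hm' : ∀ j, θ' j ∈ E.segment m) :
    μ.map (fun ω j => stepData X ξ (θ j) ω) = μ.map fun ω j => stepData X ξ (θ' j) ω := by
  have key : ∀ {η : Fin n → ℕ}, Function.Injective η → (hη : ∀ j, η j ∈ E.segment m) →
      μ.map (fun ω j => stepData X ξ (η j) ω) =
        Measure.pi fun j => μ.map (stepData X ξ (η j)) := by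
    intro η hinj hη
    exact (h.iIndepFun_stepData.precomp
      (g := fun j => ⟨η j, mem_Icc_of_mem_segment (hη j)⟩)
      (fun i j hij => hinj (congrArg Subtype.val hij))).map_fun_eq_pi_map
        fun j => (h.measurable_stepData _).aemeasurable
  rw [key hθ hm, key hθ' hm']
  congr 1
  ext1 j
  exact h.map_stepData_eq (hm j) (hm' j)

/-- Data of disjoint sets of time steps are independent. -/
lemma indepFun_stepData (h : E.IsExperiment μ X ξ) (c : ℕ) :
    IndepFun
      (fun ω (t : {t : Finset.Icc 1 T //
          t ∈ Finset.univ.filter fun t : Finset.Icc 1 T => t.1 < c}) =>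
        stepData X ξ t.1 ω)
      (fun ω (t : {t : Finset.Icc 1 T //
          t ∈ Finset.univ.filter fun t : Finset.Icc 1 T => ¬ t.1 < c}) =>
        stepData X ξ t.1 ω) μ :=
  h.iIndepFun_stepData.indepFun_finset _ _ (Finset.disjoint_filter_filter_not _ _ _)
    fun t => h.measurable_stepData t

end DuelingProblem.IsExperiment

/-! ### Regret of a segment -/

namespace DuelingProblem

variable {K T M : ℕ} (E : DuelingProblem K T M)

lemma gap_mem (m : Fin M) (i : Fin K) : E.gap m i ∈ Set.Icc (0 : ℝ) (1 / 2) := by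
  have h1 := (E.P_mem m (E.best m) i).2
  have h0 : 1 / 2 ≤ E.P m (E.best m) i := by
    by_cases hi : i = E.best m
    -- An arm against itself has winning probability 1/2 by `P_add`.
    · have := E.P_add m (E.best m) (E.best m)
      rw [hi]
      linarith
    · exact (E.best_wins m i hi).le
  unfold gap
  constructor <;> linarith

lemma binaryStrongRegret_nonneg (m : Fin M) (a : Fin K × Fin K) :
    0 ≤ E.binaryStrongRegret m a := by
  have h1 := (E.gap_mem m a.1).1
  have h2 := (E.gap_mem m a.2).1
  have : 0 ≤ E.strongRegret m a := by
    unfold strongRegret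
    linarith
  have := Int.ceil_nonneg this
  unfold binaryStrongRegret
  exact_mod_cast this

lemma binaryStrongRegret_le_one (m : Fin M) (a : Fin K × Fin K) :
    E.binaryStrongRegret m a ≤ 1 := by
  have h1 := (E.gap_mem m a.1).2
  have h2 := (E.gap_mem m a.2).2
  have : E.strongRegret m a ≤ 1 := by
    unfold strongRegret
    linarith
  have : ⌈E.strongRegret m a⌉ ≤ 1 := Int.ceil_le.2 (by exact_mod_cast this)
  unfold binaryStrongRegret
  exact_mod_cast this

end DuelingProblem

namespace DuelingAlg

variable {K T M : ℕ} {St Sd : Type*} [MeasurableSpace St] [MeasurableSpace Sd]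
  (A : DuelingAlg K St Sd)

/-- The internal state after `k` time steps when the `j`-th time step has data `z j`. -/
def run (z : ℕ → (Fin K → Fin K → Bool) × Sd) : ℕ → St
  | 0 => A.init
  | k + 1 =>
    A.update (run z k) (z k).2
      ((z k).1 (A.select (run z k) (z k).2).1 (A.select (run z k) (z k).2).2)

/-- The binary strong regret in the first `n` time steps when the `j`-th time step has
data `z j`. -/
def runRegret (E : DuelingProblem K T M) (m : Fin M) (n : ℕ)
    (z : ℕ → (Fin K → Fin K → Bool) × Sd) : ℝ :=
  ∑ j ∈ Finset.range n, E.binaryStrongRegret m (A.select (A.run z j) (z j).2)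

lemma run_congr {z z' : ℕ → (Fin K → Fin K → Bool) × Sd} {k : ℕ} (h : ∀ j < k, z j = z' j) :
    A.run z k = A.run z' k := by
  induction k with
  | zero => rfl
  | succ k ih =>
    simp only [run, ih fun j hj => h j (by omega), h k (Nat.lt_succ_self k)]

lemma runRegret_congr (E : DuelingProblem K T M) (m : Fin M) {n : ℕ}
    {z z' : ℕ → (Fin K → Fin K → Bool) × Sd} (h : ∀ j < n, z j = z' j) :
    A.runRegret E m n z = A.runRegret E m n z' := by
  refine Finset.sum_congr rfl fun j hj => ?_
  rw [Finset.mem_range] at hj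
  rw [A.run_congr fun i hi => h i (by omega), h j hj]

lemma runRegret_nonneg (E : DuelingProblem K T M) (m : Fin M) (n : ℕ)
    (z : ℕ → (Fin K → Fin K → Bool) × Sd) : 0 ≤ A.runRegret E m n z :=
  Finset.sum_nonneg fun _ _ => E.binaryStrongRegret_nonneg m _

lemma runRegret_le (E : DuelingProblem K T M) (m : Fin M) (n : ℕ)
    (z : ℕ → (Fin K → Fin K → Bool) × Sd) : A.runRegret E m n z ≤ n := by
  refine (Finset.sum_le_sum fun _ _ => E.binaryStrongRegret_le_one m _).trans ?_
  simp

lemma runRegret_mono (E : DuelingProblem K T M) (m : Fin M) {n n' : ℕ} (h : n ≤ n')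
    (z : ℕ → (Fin K → Fin K → Bool) × Sd) : A.runRegret E m n z ≤ A.runRegret E m n' z :=
  Finset.sum_le_sum_of_subset_of_nonneg (Finset.range_mono h)
    fun _ _ _ => E.binaryStrongRegret_nonneg m _

lemma stateFrom_eq_run (x : ℕ → Fin K → Fin K → Bool) (u : ℕ → Sd) (t₀ k : ℕ) :
    A.stateFrom x u t₀ k = A.run (fun j => (x (t₀ + j), u (t₀ + j))) k := by
  induction k with
  | zero => rfl
  | succ k ih => simp only [stateFrom, run, ih]

lemma regretAlone_eq_runRegret (E : DuelingProblem K T M) (x : ℕ → Fin K → Fin K → Bool)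
    (u : ℕ → Sd) (m : Fin M) :
    A.regretAlone E x u m = A.runRegret E m (E.segment m).card
      (fun j => (x (E.start m + j), u (E.start m + j))) := by
  unfold regretAlone runRegret
  rw [E.card_segment]
  change ∑ t ∈ Finset.Ico (E.start m) (E.finish m), _ = _
  rw [Finset.sum_Ico_eq_sum_range]
  refine Finset.sum_congr rfl fun j _ => ?_
  unfold played
  rw [stateFrom_eq_run]
  change E.binaryStrongRegret m (A.select (A.run _ (E.start m + j - E.start m)) _) = _
  rw [Nat.add_sub_cancel_left]
  rfl

end DuelingAlg

lemma nth_of_lt_count {p : ℕ → Prop} [DecidablePred p] {j n : ℕ} (h : j < Nat.count p n) :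
    Nat.count p (Nat.nth p j) = j := by
  induction n with
  | zero => simp at h
  | succ n ih =>
    rw [Nat.count_succ] at h
    by_cases hj : j < Nat.count p n
    · exact ih hj
    · split_ifs at h with hp
      · have : j = Nat.count p n := by omega
        rw [this, Nat.nth_count hp]
      · omega

lemma sum_range_ite_count {p : ℕ → Prop} [DecidablePred p] (g : ℕ → ℝ) (n : ℕ) :
    (∑ k ∈ Finset.range n, if p k then g (Nat.count p k) else 1) =
      Nat.count (fun k => ¬ p k) n + ∑ j ∈ Finset.range (Nat.count p n), g j := by
  induction n with
  | zero => simp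
  | succ n ih =>
    rw [Finset.sum_range_succ, ih, Nat.count_succ, Nat.count_succ]
    by_cases h : p n
    · simp only [h, not_true, if_true, if_false, add_zero, Finset.sum_range_succ]
      ring
    · simp only [h, not_false_iff, if_true, if_false, add_zero]
      push_cast
      ring

/-- The range is rounded up to full periods, each of which contains at most N such steps. -/
lemma count_mod_lt_le (N : ℕ) {d : ℕ} (hd : 0 < d) (n : ℕ) :
    Nat.count (fun k => k % d < N) n ≤ (n / d + 1) * N := by
  have hper : ∀ c, Nat.count (fun k => k % d < N) (c * d) ≤ c * N := by
    intro c
    induction c with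
    | zero => simp
    | succ c ih =>
      rw [add_mul, one_mul, Nat.count_add, add_mul, one_mul]
      refine add_le_add ih ?_
      rw [Nat.count_eq_card_filter_range]
      refine (Finset.card_le_card (t := Finset.range N) fun k hk => ?_).trans_eq
        (Finset.card_range N)
      rw [Finset.mem_filter, Finset.mem_range] at hk
      rw [Finset.mem_range]
      have h1 := hk.2
      rwa [add_comm, Nat.add_mul_mod_self_right, Nat.mod_eq_of_lt hk.1] at h1
  refine (Nat.count_monotone _ ?_).trans (hper _)
  have h1 := Nat.div_add_mod n d
  have h2 := Nat.mod_lt n hd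
  rw [add_mul, one_mul, mul_comm]
  omega

namespace MDB

variable {K T M : ℕ} {St Sd : Type*} [MeasurableSpace St] [MeasurableSpace Sd]

/-- The black-box algorithm is run in the `k`-th time step (counting from `0`) after a reset. -/
def Exploits (D : MDB K St Sd) (k : ℕ) : Prop := ¬ k % D.period < K * (K - 1) / 2

instance (D : MDB K St Sd) : DecidablePred D.Exploits :=
  fun k => inferInstanceAs (Decidable (¬ k % D.period < K * (K - 1) / 2))

/-- The `j`-th time step (counting from `0`) of the black-box algorithm after a reset at
time `s`. -/
def exploitTime (D : MDB K St Sd) (s j : ℕ) : ℕ := s + 1 + Nat.nth D.Exploits j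

/-- The number of time steps of the black-box algorithm between a reset at time `s` and
time `v`. -/
def exploitCount (D : MDB K St Sd) (s v : ℕ) : ℕ := Nat.count D.Exploits (v - (s + 1))

/-- The data of the `j`-th time step of the black-box algorithm after a reset at time `s`. -/
def exploitData (D : MDB K St Sd) (x : ℕ → Fin K → Fin K → Bool) (u : ℕ → Sd) (s j : ℕ) :
    (Fin K → Fin K → Bool) × Sd :=
  (x (D.exploitTime s j), u (D.exploitTime s j))

variable {D : MDB K St Sd} {E : DuelingProblem K T M}

lemma exploitTime_injective {s v : ℕ} :
    Function.Injective fun j : Fin (D.exploitCount s v) => D.exploitTime s j := by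
  intro i j hij
  have h : Nat.nth D.Exploits i = Nat.nth D.Exploits j := by
    simp only [exploitTime] at hij
    omega
  have hi := nth_of_lt_count i.2
  have hj := nth_of_lt_count j.2
  rw [h] at hi
  exact Fin.ext (hi.symm.trans hj)

lemma lt_exploitTime (s j : ℕ) : s < D.exploitTime s j := by
  unfold exploitTime
  omega

lemma exploitTime_lt {s v j : ℕ} (hj : j < D.exploitCount s v) : D.exploitTime s j < v := by
  have h := Nat.nth_lt_of_lt_count hj
  unfold exploitTime
  omega

lemma exploitCount_le (s v : ℕ) : D.exploitCount s v ≤ v - (s + 1) := Nat.count_le _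

variable {x : ℕ → Fin K → Fin K → Bool} {u : ℕ → Sd} {s : ℕ}

lemma inner_stateFrom_of_reset (hd : K * (K - 1) / 2 ≤ D.period) (hw : 0 < D.w)
    (hs : D.lastReset x (s + 1) = s) : (D.stateFrom x u 1 s).inner = D.alg.init := by
  classical
  rcases s with _ | s
  · rfl
  · have h1 := tau_stateFrom hd hw x u (s + 1)
    rw [add_comm 1, hs] at h1
    have h2 := tau_stateFrom hd hw x u s
    rw [add_comm 1] at h2
    have h3 := D.lastReset_succ_le x s
    change (D.next _ _ _ _).tau = _ at h1
    change (D.next _ _ _ _).inner = _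
    rw [next_tau] at h1
    split_ifs at h1 with htr
    · rw [next, if_pos htr]
      rfl
    · omega

lemma tau_stateFrom_of_reset (hd : K * (K - 1) / 2 ≤ D.period) (hw : 0 < D.w)
    (hs : D.lastReset x (s + 1) = s) {k : ℕ} (hno : ¬ D.Alarm x s (s + 1) (s + 1 + k)) :
    (D.stateFrom x u 1 (s + k)).tau = s := by
  rw [tau_stateFrom hd hw, show 1 + (s + k) = s + 1 + k by omega]
  exact lastReset_eq_of_not_alarm hs (by omega) hno

/-- Exploration steps leave the black-box state unchanged, so as long as there is no alarm it
evolves as if run alone on the data of its own time steps. -/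
lemma inner_stateFrom (hd : K * (K - 1) / 2 ≤ D.period) (hw : 0 < D.w)
    (hs : D.lastReset x (s + 1) = s) {k : ℕ} (hno : ¬ D.Alarm x s (s + 1) (s + 1 + k)) :
    (D.stateFrom x u 1 (s + k)).inner =
      D.alg.run (D.exploitData x u s) (Nat.count D.Exploits k) := by
  induction k with
  | zero => exact inner_stateFrom_of_reset hd hw hs
  | succ k ih =>
    have hno' : ¬ D.Alarm x s (s + 1) (s + 1 + k) := fun h => hno (h.mono le_rfl (by omega))
    have ih := ih hno'
    have htau := tau_stateFrom_of_reset (u := u) hd hw hs hno'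
    have htr : ¬ D.triggers (1 + (s + k)) (x (1 + (s + k))) (D.stateFrom x u 1 (s + k)) := by
      rw [(tracks_stateFrom hd x u 1 one_pos (s + k)).triggers_iff hd hw, htau]
      exact fun h => hno (alarm_succ_iff.2 ⟨_, by omega, h⟩)
    change (D.next (1 + (s + k)) (x (1 + (s + k))) (u (1 + (s + k)))
      (D.stateFrom x u 1 (s + k))).inner = _
    rw [next, if_neg htr]
    have hsub : 1 + (s + k) - s - 1 = k := by omega
    rcases hp : D.detectionPair (1 + (s + k)) (D.stateFrom x u 1 (s + k)) with _ | a
    · rw [detectionPair_eq_none, htau, hsub] at hp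
      have hx : D.Exploits k := hp
      have ht : D.exploitTime s (Nat.count D.Exploits k) = 1 + (s + k) := by
        rw [exploitTime, Nat.nth_count hx]
        omega
      rw [Nat.count_succ, if_pos hx]
      simp only [DuelingAlg.run, ih, exploitData, ht]
    · rw [detectionPair_eq_some, htau, hsub] at hp
      have hx : ¬ D.Exploits k := not_not.2 (hp ▸ D.idx_lt a)
      rw [Nat.count_succ, if_neg hx, add_zero, ← ih]
      rfl

lemma played_of_exploits (hd : K * (K - 1) / 2 ≤ D.period) (hw : 0 < D.w)
    (hs : D.lastReset x (s + 1) = s) {k : ℕ} (hno : ¬ D.Alarm x s (s + 1) (s + 1 + k))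
    (hk : D.Exploits k) :
    D.played x u 1 (s + 1 + k) = D.alg.select
      (D.alg.run (D.exploitData x u s) (Nat.count D.Exploits k))
      (D.exploitData x u s (Nat.count D.Exploits k)).2 := by
  have ht : D.exploitTime s (Nat.count D.Exploits k) = s + 1 + k := by
    rw [exploitTime, Nat.nth_count hk]
  have hnone : D.detectionPair (s + 1 + k) (D.stateFrom x u 1 (s + k)) = none := by
    rw [detectionPair_eq_none, tau_stateFrom_of_reset hd hw hs hno,
      show s + 1 + k - s - 1 = k by omega]
    exact hk
  rw [played, show s + 1 + k - 1 = s + k by omega, pair, hnone]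
  simp only
  rw [inner_stateFrom hd hw hs hno, exploitData, ht]

/-- The incomplete last period is absorbed by a factor 2, since the segment is at least one period
long. -/
lemma count_exploration_le (hd0 : 0 < D.period) {n l : ℕ}
    (hn : n ≤ l) (hl : D.period ≤ l) :
    (Nat.count (fun k => ¬ D.Exploits k) n : ℝ) ≤
      2 * (l : ℝ) * ((K * (K - 1) / 2 : ℕ) : ℝ) / (D.period : ℝ) := by
  have h1 : Nat.count (fun k => ¬ D.Exploits k) n =
      Nat.count (fun k => k % D.period < K * (K - 1) / 2) n := by
    congr 1
    ext k
    exact not_not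
  have h2 := count_mod_lt_le (K * (K - 1) / 2) hd0 n
  have h3 : ((n / D.period : ℕ) : ℝ) ≤ l / D.period :=
    Nat.cast_div_le.trans (by gcongr)
  have h4 : (1 : ℝ) ≤ l / D.period := by
    rw [one_le_div (by exact_mod_cast hd0)]
    exact_mod_cast hl
  rw [h1]
  calc (Nat.count (fun k => k % D.period < K * (K - 1) / 2) n : ℝ)
      ≤ ((n / D.period : ℕ) + 1) * ((K * (K - 1) / 2 : ℕ) : ℝ) := by exact_mod_cast h2
    _ ≤ (l / D.period + l / D.period) * ((K * (K - 1) / 2 : ℕ) : ℝ) := by gcongr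
    _ = _ := by ring

lemma segment_regret_le_card (m : Fin M) :
    ∑ t ∈ E.segment m, E.binaryStrongRegret m (D.played x u 1 t) ≤ (E.segment m).card := by
  refine (Finset.sum_le_sum fun _ _ => E.binaryStrongRegret_le_one m _).trans ?_
  simp

/-- The regret in a segment with a reset at time `s` and no later alarm. -/
lemma segment_regret_le (hd : K * (K - 1) / 2 ≤ D.period) (hd0 : 0 < D.period) (hw : 0 < D.w)
    (m : Fin M) (hl : D.period ≤ (E.segment m).card)
    (hs : D.lastReset x (s + 1) = s) (hs1 : E.start m ≤ s + 1) (hs2 : s + 1 ≤ E.start m + D.halfL)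
    (hs3 : s + 1 ≤ E.finish m) (hno : ¬ D.Alarm x s (s + 1) (E.finish m)) :
    ∑ t ∈ E.segment m, E.binaryStrongRegret m (D.played x u 1 t) ≤
      D.halfL + 2 * ((E.segment m).card : ℝ) * ((K * (K - 1) / 2 : ℕ) : ℝ) / (D.period : ℝ) +
        D.alg.runRegret E m (D.exploitCount s (E.finish m)) (D.exploitData x u s) := by
  change ∑ t ∈ Finset.Ico (E.start m) (E.finish m), _ ≤ _
  rw [← Finset.sum_Ico_consecutive _ hs1 hs3, add_assoc]
  refine add_le_add ?_ ?_
  · refine (Finset.sum_le_sum fun _ _ => E.binaryStrongRegret_le_one m _).trans ?_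
    rw [Finset.sum_const, Nat.card_Ico, nsmul_eq_mul, mul_one]
    exact_mod_cast (by omega : s + 1 - E.start m ≤ D.halfL)
  · rw [Finset.sum_Ico_eq_sum_range]
    have hterm : ∀ k ∈ Finset.range (E.finish m - (s + 1)),
        E.binaryStrongRegret m (D.played x u 1 (s + 1 + k)) ≤
        if D.Exploits k then (fun j => E.binaryStrongRegret m
          (D.alg.select (D.alg.run (D.exploitData x u s) j) (D.exploitData x u s j).2))
            (Nat.count D.Exploits k) else 1 := by
      intro k hk
      rw [Finset.mem_range] at hk
      have hno' : ¬ D.Alarm x s (s + 1) (s + 1 + k) := fun h => hno (h.mono le_rfl (by omega))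
      split_ifs with hx
      · rw [played_of_exploits hd hw hs hno' hx]
      · exact E.binaryStrongRegret_le_one m _
    refine (Finset.sum_le_sum hterm).trans ?_
    rw [sum_range_ite_count (p := D.Exploits) (fun j => E.binaryStrongRegret m
      (D.alg.select (D.alg.run (D.exploitData x u s) j) (D.exploitData x u s j).2))]
    refine add_le_add (count_exploration_le hd0 ?_ hl) le_rfl
    rw [E.card_segment]
    omega

end MDB

/-! ### Expected regret -/

namespace DuelingAlg

variable {K T M : ℕ} {St Sd : Type*} [MeasurableSpace St] [MeasurableSpace Sd]
  (A : DuelingAlg K St Sd)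

lemma measurable_select_run (k : ℕ)
    (h : Measurable fun z : ℕ → (Fin K → Fin K → Bool) × Sd => A.run z k) :
    Measurable fun z : ℕ → (Fin K → Fin K → Bool) × Sd => A.select (A.run z k) (z k).2 :=
  A.measurable_select.comp (h.prodMk (measurable_pi_apply k).snd)

lemma measurable_run (k : ℕ) :
    Measurable fun z : ℕ → (Fin K → Fin K → Bool) × Sd => A.run z k := by
  induction k with
  | zero => exact measurable_const
  | succ k ih =>
    have heval : Measurable fun y : (Fin K → Fin K → Bool) × (Fin K × Fin K) =>
        y.1 y.2.1 y.2.2 :=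
      measurable_from_prod_countable_left fun a =>
        (measurable_pi_apply a.2).comp (measurable_pi_apply a.1)
    exact A.measurable_update.comp (ih.prodMk ((measurable_pi_apply k).snd.prodMk
      (heval.comp ((measurable_pi_apply k).fst.prodMk (A.measurable_select_run k ih)))))

lemma measurable_runRegret (E : DuelingProblem K T M) (m : Fin M) (n : ℕ) :
    Measurable (A.runRegret E m n) :=
  Finset.measurable_sum _ fun j _ =>
    (measurable_of_countable (E.binaryStrongRegret m)).comp
      (A.measurable_select_run j (A.measurable_run j))

end DuelingAlg

open Classical in
/-- Extend a family indexed by some of the time steps `1, …, T` by a default value. -/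
def extendFamily {T : ℕ} {β : Type*} (I : Finset (Finset.Icc 1 T)) (y : β) (z : I → β)
    (t : ℕ) : β :=
  if h : ∃ ht : t ∈ Finset.Icc 1 T, (⟨t, ht⟩ : Finset.Icc 1 T) ∈ I then z ⟨_, h.2⟩ else y

lemma extendFamily_of_mem {T : ℕ} {β : Type*} {I : Finset (Finset.Icc 1 T)} (y : β) (f : ℕ → β)
    {t : ℕ} (ht : t ∈ Finset.Icc 1 T) (hI : (⟨t, ht⟩ : Finset.Icc 1 T) ∈ I) :
    extendFamily I y (fun t => f t.1) t = f t := by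
  unfold extendFamily
  rw [dif_pos ⟨ht, hI⟩]

lemma fst_extendFamily {T : ℕ} {β γ : Type*} (I : Finset (Finset.Icc 1 T)) (y : β × γ)
    (z : I → β × γ) (t : ℕ) :
    (extendFamily I y z t).1 = extendFamily I y.1 (fun t => (z t).1) t := by
  unfold extendFamily
  split_ifs <;> rfl

lemma measurable_extendFamily {T : ℕ} {β : Type*} [MeasurableSpace β]
    (I : Finset (Finset.Icc 1 T)) (y : β) : Measurable (extendFamily I y) := by
  refine measurable_pi_lambda _ fun t => ?_
  unfold extendFamily
  split_ifs
  · exact measurable_pi_apply _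
  · exact measurable_const

namespace DuelingProblem.IsExperiment

variable {K T M : ℕ} {E : DuelingProblem K T M} {St Ω Sd : Type*} [MeasurableSpace Ω]
  [MeasurableSpace St] [MeasurableSpace Sd] {μ : Measure Ω} [IsProbabilityMeasure μ]
  {X : ℕ → Fin K → Fin K → Ω → Bool} {ξ : ℕ → Ω → Sd} {A : DuelingAlg K St Sd}

lemma measurable_runRegret (h : E.IsExperiment μ X ξ) (m : Fin M) (n : ℕ) (θ : ℕ → ℕ) :
    Measurable fun ω => A.runRegret E m n fun j => stepData X ξ (θ j) ω :=
  (A.measurable_runRegret E m n).comp (measurable_pi_lambda _ fun j => h.measurable_stepData (θ j))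

lemma integrable_runRegret (h : E.IsExperiment μ X ξ) (m : Fin M) (n : ℕ) (θ : ℕ → ℕ) :
    Integrable (fun ω => A.runRegret E m n fun j => stepData X ξ (θ j) ω) μ := by
  refine Integrable.of_bound (h.measurable_runRegret m n θ).aestronglyMeasurable n
    (.of_forall fun ω => ?_)
  rw [Real.norm_of_nonneg (A.runRegret_nonneg E m n _)]
  exact A.runRegret_le E m n _

/-- The expected regret of the black-box algorithm does not depend on the choice of its time
steps within a segment. -/
lemma integral_runRegret_eq (h : E.IsExperiment μ X ξ) (m : Fin M) {n : ℕ} {θ θ' : ℕ → ℕ}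
    (hθ : Function.Injective fun j : Fin n => θ j) (hθ' : Function.Injective fun j : Fin n => θ' j)
    (hm : ∀ j < n, θ j ∈ E.segment m) (hm' : ∀ j < n, θ' j ∈ E.segment m) :
    ∫ ω, A.runRegret E m n (fun j => stepData X ξ (θ j) ω) ∂μ =
      ∫ ω, A.runRegret E m n (fun j => stepData X ξ (θ' j) ω) ∂μ := by
  -- A sample point supplies a default seed; the values filled in after the first n steps do not
  -- affect the regret.
  obtain ⟨ω₀⟩ := nonempty_of_isProbabilityMeasure μ
  let y := stepData X ξ 0 ω₀
  let e : (Fin n → (Fin K → Fin K → Bool) × Sd) → ℕ → (Fin K → Fin K → Bool) × Sd :=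
    fun z j => if hj : j < n then z ⟨j, hj⟩ else y
  have he : Measurable e := by
    refine measurable_pi_lambda _ fun j => ?_
    by_cases hj : j < n
    · simp only [e, hj, dif_pos]
      exact measurable_pi_apply _
    · simp only [e, hj, dif_neg, not_false_iff]
      exact measurable_const
  have key : ∀ η : ℕ → ℕ, ∫ ω, A.runRegret E m n (fun j => stepData X ξ (η j) ω) ∂μ =
      ∫ z, A.runRegret E m n (e z) ∂(μ.map fun ω (j : Fin n) => stepData X ξ (η j) ω) := by
    intro η
    have hη : Measurable fun ω (j : Fin n) => stepData X ξ (η j) ω :=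
      measurable_pi_lambda _ fun _ => h.measurable_stepData _
    have hcomp : Measurable fun z => A.runRegret E m n (e z) :=
      (A.measurable_runRegret E m n).comp he
    rw [integral_map hη.aemeasurable hcomp.aestronglyMeasurable]
    congr 1 with ω
    exact A.runRegret_congr E m fun j hj => by simp only [e, hj, dif_pos]
  rw [key θ, key θ', h.map_stepData_comp_eq hθ hθ' (fun j => hm j j.2) fun j => hm' j j.2]

/-- A property decided before time `c` is independent of the regret of the black-box algorithm when
it is run from time `c` on. -/
lemma integral_indicator_runRegret (h : E.IsExperiment μ X ξ) (m : Fin M) {n c : ℕ} {θ : ℕ → ℕ}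
    {B : (ℕ → Fin K → Fin K → Bool) → Prop} (hB : OutcomesDependOn B (timeBlock K 1 c))
    (hc : 1 ≤ c) (hcT : c ≤ T + 1) (hθ : ∀ j < n, c ≤ θ j ∧ θ j ≤ T) :
    ∫ ω, {ω | B (outcomesAt X ω)}.indicator
        (fun ω => A.runRegret E m n fun j => stepData X ξ (θ j) ω) ω ∂μ =
      outcomeProb μ X B * ∫ ω, A.runRegret E m n (fun j => stepData X ξ (θ j) ω) ∂μ := by
  classical
  obtain ⟨ω₀⟩ := nonempty_of_isProbabilityMeasure μ
  let y := stepData X ξ 0 ω₀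
  let I := Finset.univ.filter fun t : Finset.Icc 1 T => t.1 < c
  let J := Finset.univ.filter fun t : Finset.Icc 1 T => ¬ t.1 < c
  -- `F` writes the event through the data before c, and `G` writes the regret through the data from
  -- c on; the two data families are independent.
  let F : (I → (Fin K → Fin K → Bool) × Sd) → ℝ :=
    {z | B fun t => (extendFamily I y z t).1}.indicator 1
  let G : (J → (Fin K → Fin K → Bool) × Sd) → ℝ :=
    fun z => A.runRegret E m n fun j => extendFamily J y z (θ j)
  have hF : Measurable F := by
    refine measurable_one.indicator ?_
    have : {z : I → (Fin K → Fin K → Bool) × Sd | B fun t => (extendFamily I y z t).1} =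
        (fun z t => (z t).1) ⁻¹' {v | B fun t => extendFamily I y.1 v t} := by
      ext z
      simp only [Set.mem_preimage, Set.mem_ofPred_eq, fst_extendFamily]
    rw [this]
    exact measurable_pi_lambda _ (fun t => (measurable_pi_apply t).fst)
      (Set.toFinite _).measurableSet
  have hG : Measurable G := (A.measurable_runRegret E m n).comp
    (measurable_pi_lambda _ fun j =>
      (measurable_pi_apply (θ j)).comp (measurable_extendFamily J y))
  have hFeq : ∀ ω, F (fun t => stepData X ξ t.1 ω) =
      {ω | B (outcomesAt X ω)}.indicator (fun _ => (1 : ℝ)) ω := by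
    intro ω
    have hiff : B (fun t => (extendFamily I y (fun t => stepData X ξ t.1 ω) t).1) ↔
        B (outcomesAt X ω) := by
      refine hB _ _ fun a ha => ?_
      have ht : a.1 ∈ Finset.Icc 1 T := Finset.mem_Icc.2 ⟨ha.1, by have := ha.2; omega⟩
      rw [extendFamily_of_mem (I := I) y (fun t => stepData X ξ t ω) ht
        (Finset.mem_filter.2 ⟨Finset.mem_univ _, ha.2⟩)]
      rfl
    simp only [F, Set.indicator, Set.mem_ofPred_eq, hiff, Pi.one_apply]
  have hGeq : ∀ ω, G (fun t => stepData X ξ t.1 ω) =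
      A.runRegret E m n (fun j => stepData X ξ (θ j) ω) := by
    intro ω
    refine A.runRegret_congr E m fun j hj => ?_
    obtain ⟨h1, h2⟩ := hθ j hj
    exact extendFamily_of_mem (I := J) y (fun t => stepData X ξ t ω)
      (Finset.mem_Icc.2 ⟨hc.trans h1, h2⟩)
      (Finset.mem_filter.2 ⟨Finset.mem_univ _, not_lt.2 h1⟩)
  have hind : IndepFun ({ω | B (outcomesAt X ω)}.indicator fun _ => (1 : ℝ))
      (fun ω => A.runRegret E m n fun j => stepData X ξ (θ j) ω) μ := by
    rw [← funext hFeq, ← funext hGeq]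
    exact (h.indepFun_stepData c).comp hF hG
  have hmeas : MeasurableSet {ω | B (outcomesAt X ω)} :=
    hB.measurableSet (T := T) (timeBlock_mono le_rfl hcT) h.measurable_outcome
  have key := hind.integral_fun_mul_eq_mul_integral
    (measurable_const.indicator hmeas).aestronglyMeasurable
    (h.measurable_runRegret m n θ).aestronglyMeasurable
  rw [integral_indicator_const _ hmeas, smul_eq_mul, mul_one] at key
  unfold outcomeProb
  rw [← key]
  congr 1 with ω
  by_cases hω : ω ∈ {ω | B (outcomesAt X ω)} <;> simp [hω]

end DuelingProblem.IsExperiment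

namespace MDB

variable {K T M : ℕ} {E : DuelingProblem K T M} {St Ω Sd : Type*} [MeasurableSpace Ω]
  [MeasurableSpace St] [MeasurableSpace Sd] {μ : Measure Ω} [IsProbabilityMeasure μ]
  {X : ℕ → Fin K → Fin K → Ω → Bool} {ξ : ℕ → Ω → Sd} {D : MDB K St Sd}

lemma regretAlone_eq_runRegret_stepData (m : Fin M) (ω : Ω) :
    D.alg.regretAlone E (fun t i j => X t i j ω) (fun t => ξ t ω) m =
      D.alg.runRegret E m (E.segment m).card (fun j => stepData X ξ (E.start m + j) ω) :=
  D.alg.regretAlone_eq_runRegret E _ _ m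

/-- The time steps of the algorithm may be exchanged for the first ones of the segment, and running
it to the end of the segment only adds nonnegative regret. -/
lemma integral_exploit_le (h : E.IsExperiment μ X ξ) (m : Fin M) {s : ℕ}
    (hs : E.start m ≤ s + 1) :
    ∫ ω, D.alg.runRegret E m (D.exploitCount s (E.finish m))
        (fun j => stepData X ξ (D.exploitTime s j) ω) ∂μ ≤
      ∫ ω, D.alg.regretAlone E (fun t i j => X t i j ω) (fun t => ξ t ω) m ∂μ := by
  have hle : D.exploitCount s (E.finish m) ≤ (E.segment m).card := by
    have := D.exploitCount_le s (E.finish m)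
    rw [E.card_segment]
    omega
  rw [h.integral_runRegret_eq m (θ' := fun j => E.start m + j) exploitTime_injective]
  · simp_rw [regretAlone_eq_runRegret_stepData]
    refine integral_mono (h.integrable_runRegret m _ _) (h.integrable_runRegret m _ _) fun ω => ?_
    exact D.alg.runRegret_mono E m hle _
  · intro i j hij
    exact Fin.ext (Nat.add_left_cancel hij)
  · intro j hj
    have := D.lt_exploitTime s j
    exact E.mem_segment.2 ⟨by omega, exploitTime_lt hj⟩
  · intro j hj
    rw [E.card_segment] at hle
    exact E.mem_segment.2 ⟨Nat.le_add_right _ _, by omega⟩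

/-- The regret of the black-box algorithm after the first reset at time `α` or later, if this
happens before time `β`. -/
def exploitRegret (D : MDB K St Sd) (E : DuelingProblem K T M) (X : ℕ → Fin K → Fin K → Ω → Bool)
    (ξ : ℕ → Ω → Sd) (m : Fin M) (α β : ℕ) (ω : Ω) : ℝ :=
  ∑ s ∈ Finset.Ico α β, {ω | D.FirstReset (outcomesAt X ω) α s}.indicator
    (fun ω => D.alg.runRegret E m (D.exploitCount s (E.finish m))
        (fun j => stepData X ξ (D.exploitTime s j) ω)) ω

lemma integrable_indicator_exploit (h : E.IsExperiment μ X ξ) (m : Fin M) {α s : ℕ} (hs : s ≤ T) :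
    Integrable ({ω | D.FirstReset (outcomesAt X ω) α s}.indicator
      (fun ω => D.alg.runRegret E m (D.exploitCount s (E.finish m))
        (fun j => stepData X ξ (D.exploitTime s j) ω))) μ :=
  (h.integrable_runRegret m _ _).indicator
    ((firstReset_dependsOn α s).measurableSet (T := T) (timeBlock_mono le_rfl (by omega))
      h.measurable_outcome)

lemma integrable_exploitRegret (h : E.IsExperiment μ X ξ) (m : Fin M) {α β : ℕ} (hβ : β ≤ T + 1) :
    Integrable (D.exploitRegret E X ξ m α β) μ :=
  integrable_finsetSum _ fun s hs =>
    integrable_indicator_exploit h m (by rw [Finset.mem_Ico] at hs; omega)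

/-- The regret after a reset at s is counted up to the end of the segment even if another alarm
follows. No conditioning on the absence of alarms is then needed: only the event that s is the first
reset enters, it is independent of the later data, and these events are disjoint. -/
lemma integral_exploitRegret_le (h : E.IsExperiment μ X ξ) (m : Fin M) {α β : ℕ}
    (hα : E.start m ≤ α + 1) (hβ : β ≤ T + 1) :
    ∫ ω, D.exploitRegret E X ξ m α β ω ∂μ ≤
      ∫ ω, D.alg.regretAlone E (fun t i j => X t i j ω) (fun t => ξ t ω) m ∂μ := by
  set R := ∫ ω, D.alg.regretAlone E (fun t i j => X t i j ω) (fun t => ξ t ω) m ∂μ with hR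
  have hR0 : 0 ≤ R := integral_nonneg fun ω => by
    rw [regretAlone_eq_runRegret_stepData]
    exact D.alg.runRegret_nonneg E m _ _
  have hfinish := E.finish_le m
  unfold exploitRegret
  rw [integral_finsetSum _ fun s hs =>
    integrable_indicator_exploit h m (by rw [Finset.mem_Ico] at hs; omega)]
  calc ∑ s ∈ Finset.Ico α β, ∫ ω, {ω | D.FirstReset (outcomesAt X ω) α s}.indicator
        (fun ω => D.alg.runRegret E m (D.exploitCount s (E.finish m))
          (fun j => stepData X ξ (D.exploitTime s j) ω)) ω ∂μ
      ≤ ∑ s ∈ Finset.Ico α β, outcomeProb μ X (fun x => D.FirstReset x α s) * R := by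
        refine Finset.sum_le_sum fun s hs => ?_
        rw [Finset.mem_Ico] at hs
        rw [h.integral_indicator_runRegret m (firstReset_dependsOn α s) (by omega) (by omega)]
        · exact mul_le_mul_of_nonneg_left (integral_exploit_le h m (by omega)) outcomeProb_nonneg
        · intro j hj
          have h1 := D.lt_exploitTime s j
          have h2 := exploitTime_lt hj
          omega
    _ = outcomeProb μ X (fun x => ∃ s ∈ Finset.Ico α β, D.FirstReset x α s) * R := by
        rw [← Finset.sum_mul, outcomeProb_exists_eq (T := T) _ _ h.measurable_outcome]
        · intro s hs
          rw [Finset.mem_Ico] at hs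
          exact (firstReset_dependsOn α s).mono (timeBlock_mono le_rfl (by omega))
        · intro x s hs s' hs' h1 h2
          rw [Finset.mem_Ico] at hs hs'
          exact h1.unique hs.1 hs'.1 h2
    _ ≤ R := mul_le_of_le_one_left hR0 outcomeProb_le_one

end MDB

-- Assembling the regret bound.

namespace MDB

variable {K T M : ℕ} {E : DuelingProblem K T M} {St Ω Sd : Type*} [MeasurableSpace Ω]
  [MeasurableSpace St] [MeasurableSpace Sd] {μ : Measure Ω}
  {X : ℕ → Fin K → Fin K → Ω → Bool} {ξ : ℕ → Ω → Sd} {D : MDB K St Sd} {p q : ℝ}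

lemma exploitRegret_nonneg (m : Fin M) (α β : ℕ) (ω : Ω) : 0 ≤ D.exploitRegret E X ξ m α β ω :=
  Finset.sum_nonneg fun _ _ => Set.indicator_nonneg (fun _ _ => D.alg.runRegret_nonneg E m _ _) _

lemma le_exploitRegret (m : Fin M) {α β s : ℕ} (hs : s ∈ Finset.Ico α β) {ω : Ω}
    (h : D.FirstReset (outcomesAt X ω) α s) :
    D.alg.runRegret E m (D.exploitCount s (E.finish m))
      (fun j => stepData X ξ (D.exploitTime s j) ω) ≤ D.exploitRegret E X ξ m α β ω := by
  have h1 := Finset.single_le_sum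
    (f := fun s => {ω | D.FirstReset (outcomesAt X ω) α s}.indicator
      (fun ω => D.alg.runRegret E m (D.exploitCount s (E.finish m))
        (fun j => stepData X ξ (D.exploitTime s j) ω)) ω)
    (fun _ _ => Set.indicator_nonneg (fun _ _ => D.alg.runRegret_nonneg E m _ _) _) hs
  simp only [Set.indicator, Set.mem_ofPred_eq, h, if_true] at h1
  exact h1

lemma fails_dependsOn (m : Fin M) (h : E.start m + D.halfL ≤ T + 1) :
    OutcomesDependOn (D.Fails E m) (timeBlock K 1 (T + 1)) := by
  refine ((noReset_dependsOn _ _).mono (timeBlock_mono le_rfl h)).or (.exists' fun s =>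
    .and_of_imp fun hs => ?_)
  rw [Finset.mem_Ico] at hs
  exact ((firstReset_dependsOn _ s).mono (timeBlock_mono le_rfl (by omega))).and
    ((alarm_dependsOn' (Nat.lt_succ_self s)).mono (timeBlock_mono (by omega) (E.finish_le m)))

/-- The regret of a segment in terms of failures of the detection, the delay, the exploration, and
the regret of the black-box algorithm. -/
lemma segment_regret_le_of_fails (h : D.DetectionBounds E μ X p q) (m : Fin M) (ω : Ω) :
    ∑ t ∈ E.segment m, E.binaryStrongRegret m
        (D.played (outcomesAt X ω) (fun t => ξ t ω) 1 t) ≤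
      {ω | D.Fails E m (outcomesAt X ω)}.indicator (fun _ => ((E.segment m).card : ℝ)) ω +
      (D.halfL + 2 * ((E.segment m).card : ℝ) * ((K * (K - 1) / 2 : ℕ) : ℝ) / (D.period : ℝ)) +
      D.exploitRegret E X ξ m (E.start m - 1) (E.start m + D.halfL) ω := by
  have hx := D.exploitRegret_nonneg (E := E) (X := X) (ξ := ξ) m (E.start m - 1)
    (E.start m + D.halfL) ω
  have h0 : 0 ≤ D.halfL + 2 * ((E.segment m).card : ℝ) * ((K * (K - 1) / 2 : ℕ) : ℝ) /
    (D.period : ℝ) := by positivity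
  by_cases hf : D.Fails E m (outcomesAt X ω)
  · have := segment_regret_le_card (D := D) (x := outcomesAt X ω) (u := fun t => ξ t ω)
      (E := E) m
    rw [Set.indicator_of_mem (show ω ∈ {ω | D.Fails E m (outcomesAt X ω)} from hf)]
    linarith
  · rw [Set.indicator_of_notMem (show ω ∉ {ω | D.Fails E m (outcomesAt X ω)} from hf), zero_add]
    unfold Fails at hf
    push Not at hf
    obtain ⟨hno, hal⟩ := hf
    obtain ⟨s, hs, hfirst⟩ := exists_firstReset_iff.2 hno
    have hs' := Finset.mem_Ico.1 hs
    have hlen := h.length m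
    have hL := h.L_eq
    have hd := h.period_le_halfL
    have hd0 := h.period_pos
    have h1 := E.one_le_start m
    refine (segment_regret_le h.pairs_le h.period_pos (by have := h.two_le_w; omega) m ?_ hfirst.1
      (by omega) (by omega) (by omega) (hal s hs hfirst)).trans
      (add_le_add le_rfl (le_exploitRegret m hs hfirst))
    rw [E.card_segment]
    omega

lemma sum_card_segment (E : DuelingProblem K T M) : ∑ m, ((E.segment m).card : ℝ) = T := by
  have h1 : ∀ m, ((E.segment m).card : ℝ) = (E.cp m.succ : ℝ) - E.cp m.castSucc := by
    intro m
    rw [E.card_segment, Nat.cast_sub (E.start_lt_finish m).le]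
    rfl
  have h2 := Fin.sum_univ_succ fun i => (E.cp i : ℝ)
  have h3 := Fin.sum_univ_castSucc fun i => (E.cp i : ℝ)
  rw [E.cp_zero] at h2
  rw [E.cp_last] at h3
  simp_rw [h1, Finset.sum_sub_distrib]
  push_cast at h2 h3
  linarith

lemma DetectionBounds.integral_regret_le (h : D.DetectionBounds E μ X p q)
    (hE : E.IsExperiment μ X ξ) :
    ∫ ω, D.regret E (fun t i j => X t i j ω) (fun t => ξ t ω) ∂μ ≤
      M * (D.halfL : ℝ) + 2 * T * (((K * (K - 1) / 2 : ℕ) : ℝ) / (D.period : ℝ) + p + q) +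
        ∑ m, ∫ ω, D.alg.regretAlone E (fun t i j => X t i j ω) (fun t => ξ t ω) m ∂μ := by
  have := h.isProb
  set c : ℝ := ((K * (K - 1) / 2 : ℕ) : ℝ) / (D.period : ℝ)
  have hT : ∀ m, E.start m + D.halfL ≤ T + 1 := by
    intro m
    have h1 := h.length m
    have h2 := h.L_eq
    have h3 := E.finish_le m
    omega
  have hmeas : ∀ m, MeasurableSet {ω | D.Fails E m (outcomesAt X ω)} := fun m =>
    (fails_dependsOn m (hT m)).measurableSet subset_rfl h.measurable
  have hi1 : ∀ m, Integrable (fun ω => {ω | D.Fails E m (outcomesAt X ω)}.indicator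
      (fun _ => ((E.segment m).card : ℝ)) ω) μ := fun m =>
    (integrable_const _).indicator (hmeas m)
  have hi2 : ∀ m, Integrable (fun ω => {ω | D.Fails E m (outcomesAt X ω)}.indicator
      (fun _ => ((E.segment m).card : ℝ)) ω + (D.halfL + 2 * ((E.segment m).card : ℝ) *
        ((K * (K - 1) / 2 : ℕ) : ℝ) / (D.period : ℝ))) μ := fun m =>
    (hi1 m).add (integrable_const _)
  have hi3 : ∀ m, Integrable (fun ω =>
      D.exploitRegret E X ξ m (E.start m - 1) (E.start m + D.halfL) ω) μ := fun m =>
    integrable_exploitRegret hE m (hT m)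
  have hpt : ∀ ω, D.regret E (fun t i j => X t i j ω) (fun t => ξ t ω) ≤
      ∑ m, ({ω | D.Fails E m (outcomesAt X ω)}.indicator
        (fun _ => ((E.segment m).card : ℝ)) ω + (D.halfL + 2 * ((E.segment m).card : ℝ) *
        ((K * (K - 1) / 2 : ℕ) : ℝ) / (D.period : ℝ)) +
      D.exploitRegret E X ξ m (E.start m - 1) (E.start m + D.halfL) ω) := fun ω =>
    Finset.sum_le_sum fun m _ => segment_regret_le_of_fails h m ω
  -- Only the upper bound has to be integrable, so no measurability of the regret of MDB is
  -- required.
  refine (integral_mono_of_nonneg (.of_forall fun ω => ?_)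
    (integrable_finsetSum _ fun m _ => (hi2 m).add (hi3 m)) (.of_forall hpt)).trans ?_
  · exact Finset.sum_nonneg fun m _ => Finset.sum_nonneg fun t _ =>
      E.binaryStrongRegret_nonneg m _
  rw [integral_finsetSum _ fun m _ => (hi2 m).add (hi3 m)]
  have hterm : ∀ m, ∫ ω, ({ω | D.Fails E m (outcomesAt X ω)}.indicator
        (fun _ => ((E.segment m).card : ℝ)) ω + (D.halfL + 2 * ((E.segment m).card : ℝ) *
        ((K * (K - 1) / 2 : ℕ) : ℝ) / (D.period : ℝ)) +
      D.exploitRegret E X ξ m (E.start m - 1) (E.start m + D.halfL) ω) ∂μ ≤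
      D.halfL + (E.segment m).card * (2 * (c + p + q)) +
        ∫ ω, D.alg.regretAlone E (fun t i j => X t i j ω) (fun t => ξ t ω) m ∂μ := by
    intro m
    rw [integral_add (hi2 m) (hi3 m), integral_add (hi1 m) (integrable_const _),
      integral_indicator_const _ (hmeas m), integral_const, probReal_univ, one_smul, smul_eq_mul]
    have h1 : μ.real {ω | D.Fails E m (outcomesAt X ω)} ≤ 2 * (p + q) := h.prob_fails_le_two_mul m
    have h2 := integral_exploitRegret_le (D := D) hE m (α := E.start m - 1) (by omega) (hT m)
    have h3 := mul_le_mul_of_nonneg_right h1 (Nat.cast_nonneg (α := ℝ) (E.segment m).card)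
    have h4 : 2 * ((E.segment m).card : ℝ) * ((K * (K - 1) / 2 : ℕ) : ℝ) / (D.period : ℝ) =
      (E.segment m).card * (2 * c) := by ring
    linarith
  refine (Finset.sum_le_sum fun m _ => hterm m).trans_eq ?_
  rw [Finset.sum_add_distrib, Finset.sum_add_distrib, ← Finset.sum_mul, sum_card_segment,
    Finset.sum_const, Finset.card_univ, Fintype.card_fin, nsmul_eq_mul]
  ring

section Parameters

variable (hγ : D.γ ∈ Set.Ioc (0 : ℝ) 1) (hK : D.γ ≤ ((K : ℝ) - 1) / 2)
include hγ hK

lemma one_lt_arms : (1 : ℝ) < K := by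
  linarith [hγ.1]

lemma cast_pairs_le : ((K * (K - 1) / 2 : ℕ) : ℝ) ≤ (K : ℝ) * ((K : ℝ) - 1) / 2 := by
  have hK1 : 1 ≤ K := by exact_mod_cast (one_lt_arms hγ hK).le
  refine Nat.cast_div_le.trans_eq ?_
  push_cast [Nat.cast_sub hK1]
  ring

lemma arms_le_ratio : (K : ℝ) ≤ (K : ℝ) * ((K : ℝ) - 1) / (2 * D.γ) := by
  have h1 := hγ.1
  rw [le_div_iff₀ (by linarith)]
  exact mul_le_mul_of_nonneg_left (by linarith) (Nat.cast_nonneg K)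

lemma pairs_le_period : K * (K - 1) / 2 ≤ D.period := by
  have h1 := hγ.1
  have h2 := one_lt_arms hγ hK
  refine Nat.le_floor ((cast_pairs_le hγ hK).trans ?_)
  refine div_le_div_of_nonneg_left (mul_nonneg (by linarith) (by linarith)) (by linarith) ?_
  linarith [hγ.2]

lemma period_pos : 0 < D.period := by
  refine Nat.floor_pos.2 ((one_lt_arms hγ hK).le.trans (arms_le_ratio hγ hK))

lemma pairs_div_period_le :
    ((K * (K - 1) / 2 : ℕ) : ℝ) / (D.period : ℝ) ≤ D.γ * K / ((K : ℝ) - 1) := by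
  have h1 := hγ.1
  have h2 := one_lt_arms hγ hK
  have h3 := arms_le_ratio hγ hK
  have h4 : (K : ℝ) * ((K : ℝ) - 1) / (2 * D.γ) < D.period + 1 := Nat.lt_floor_add_one _
  have h5 := cast_pairs_le hγ hK
  have hd : (0 : ℝ) < D.period := by exact_mod_cast period_pos hγ hK
  set r := (K : ℝ) * ((K : ℝ) - 1) / (2 * D.γ) with hr
  have h6 : (K : ℝ) * ((K : ℝ) - 1) / 2 = D.γ * r := by
    rw [hr]
    field_simp
  rw [h6] at h5
  rw [div_le_div_iff₀ hd (by linarith)]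
  -- The loss from rounding is controlled by r ≥ K: since d > r - 1, K d ≥ K r - K ≥ K r - r.
  have h7 : r * ((K : ℝ) - 1) ≤ K * D.period := by
    nlinarith
  calc ((K * (K - 1) / 2 : ℕ) : ℝ) * ((K : ℝ) - 1) ≤ D.γ * r * ((K : ℝ) - 1) :=
        mul_le_mul_of_nonneg_right h5 (by linarith)
    _ = D.γ * (r * ((K : ℝ) - 1)) := by ring
    _ ≤ D.γ * (K * D.period) := mul_le_mul_of_nonneg_left h7 h1.le
    _ = _ := by ring

end Parameters

lemma real_eq_mul_cond_real [IsProbabilityMeasure μ] {s t : Set Ω} (hs : MeasurableSet s)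
    (hts : t ⊆ s) : μ.real t = (μ[|s]).real t * μ.real s := by
  have h1 : (μ[|s]) t * μ s = μ t := by
    rw [cond_mul_eq_inter hs, Set.inter_eq_self_of_subset_right hts]
  rw [Measure.real, ← h1, ENNReal.toReal_mul]
  rfl

end MDB

end

theorem theorem3 {K T M : ℕ} (E : DuelingProblem K T M)
    {St Sd : Type*} [MeasurableSpace St] [MeasurableSpace Sd] (D : MDB K St Sd)
    (hw_pos : 0 < D.w) (hw_even : Even D.w) (hb : 0 < D.b) (hγ : D.γ ∈ Set.Ioc (0 : ℝ) 1)
    {Ω : Type*} [MeasurableSpace Ω] (μ : Measure Ω) [IsProbabilityMeasure μ]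
    (X : ℕ → Fin K → Fin K → Ω → Bool) (ξ : ℕ → Ω → Sd) (hX : E.IsExperiment μ X ξ)
    -- Assumption 1: every segment has length at least `2 L`
    (h1 : ∀ m, 2 * D.L ≤ (E.segment m).card)
    -- Assumption 2: the minimal segmental change is at least `2 b / w + c` for some `c > 0`
    (h2 : ∃ c : ℝ, 0 < c ∧ ∀ (m : Fin M) (h : (m : ℕ) + 1 < M),
      2 * D.b / D.w + c ≤ E.change m h)
    -- Assumption 3: the range of the exploration rate
    (h3 : D.γ ∈ Set.Icc ((K : ℝ) * ((K : ℝ) - 1) / (2 * (T : ℝ))) (((K : ℝ) - 1) / 2))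
    -- `τ m` is the first detection time of MDB initialized at the first time step of segment `m`
    (τ : Fin M → Ω → ℕ∞)
    (hτ : ∀ m ω, τ m ω =
      D.firstDetection T (fun t i j => X t i j ω) (fun t => ξ t ω) (E.cp m.castSucc))
    (p q : ℝ) (hp : p ∈ Set.Icc (0 : ℝ) 1) (hq : q ∈ Set.Icc (0 : ℝ) 1)
    -- false alarms
    (hfalse : ∀ m, μ.real {ω | τ m ω < (E.cp m.succ : ℕ∞)} ≤ p)
    -- large delays
    (hdelay : ∀ m : Fin M, (m : ℕ) + 1 < M →
      (μ[|{ω | (E.cp m.succ : ℕ∞) ≤ τ m ω}]).real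
        {ω | ((E.cp m.succ + D.L / 2 : ℕ) : ℕ∞) ≤ τ m ω} ≤ q) :
    ∫ ω, D.regret E (fun t i j => X t i j ω) (fun t => ξ t ω) ∂μ ≤
      (M : ℝ) * (D.L : ℝ) / 2 + 2 * (T : ℝ) * (D.γ * (K : ℝ) / ((K : ℝ) - 1) + p + q) +
        ∑ m, ∫ ω, D.alg.regretAlone E (fun t i j => X t i j ω) (fun t => ξ t ω) m ∂μ := by
  have hd := MDB.pairs_le_period hγ h3.2
  have hd0 := MDB.period_pos hγ h3.2
  have hL : D.L = 2 * D.halfL := by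
    obtain ⟨v, hv⟩ := hw_even
    rw [MDB.L, MDB.halfL, hv, show (v + v) / 2 = v by omega]
    ring
  have hlen : ∀ m, E.start m + 2 * D.L ≤ E.finish m := by
    intro m
    have h := h1 m
    have hlt := E.start_lt_finish m
    rw [E.card_segment] at h
    omega
  have hlt : ∀ m v, v ≤ T + 1 → ∀ ω, τ m ω < (v : ℕ∞) ↔
      D.Alarm (outcomesAt X ω) (E.start m - 1) (E.start m) v := by
    intro m v hv ω
    rw [hτ]
    exact MDB.firstDetection_lt_iff hd hw_pos _ _ (E.one_le_start m) hv
  have hbounds : D.DetectionBounds E μ X p q := by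
    refine ⟨inferInstance, hX.measurable_outcome, hX.indep_outcomes, hX.bernoulli, hd, hd0, ?_,
      hw_even, hlen, hp.1, hp.2, hq.1, hq.2, fun m => ?_, fun m hm => ?_⟩
    · obtain ⟨v, hv⟩ := hw_even
      omega
    · refine le_trans (le_of_eq ?_) (hfalse m)
      exact congrArg μ.real (Set.ext fun ω => (hlt m _ (E.finish_le m) ω).symm)
    -- `firstDetection` looks no further than T, so the delay deadline must lie within the horizon;
    -- the length of the next segment guarantees this.
    · have hT : E.finish m + D.halfL ≤ T + 1 := by
        have h4 := hlen ⟨m + 1, hm⟩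
        have h5 := E.finish_le ⟨m + 1, hm⟩
        rw [E.start_succ m hm] at h4
        omega
      have hset1 : {ω | (E.cp m.succ : ℕ∞) ≤ τ m ω} =
          {ω | ¬ D.Alarm (outcomesAt X ω) (E.start m - 1) (E.start m) (E.finish m)} :=
        Set.ext fun ω => not_lt.symm.trans (hlt m _ (E.finish_le m) ω).not
      have hset2 : {ω | ((E.cp m.succ + D.L / 2 : ℕ) : ℕ∞) ≤ τ m ω} =
          {ω | ¬ D.Alarm (outcomesAt X ω) (E.start m - 1) (E.start m)
            (E.finish m + D.halfL)} := by
        rw [show D.L / 2 = D.halfL by omega]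
        exact Set.ext fun ω => not_lt.symm.trans (hlt m _ hT ω).not
      have hdep : OutcomesDependOn
          (fun x => D.Alarm x (E.start m - 1) (E.start m) (E.finish m)) (timeBlock K 1 (T + 1)) :=
        (MDB.alarm_dependsOn' (by have := E.one_le_start m; omega)).mono
          (timeBlock_mono (E.one_le_start m) (E.finish_le m))
      have hq' := hdelay m hm
      rw [hset1, hset2] at hq'
      rw [← outcomeProb_not hX.measurable_outcome hdep]
      have hsub : {ω | ¬ D.Alarm (outcomesAt X ω) (E.start m - 1) (E.start m)
            (E.finish m + D.halfL)} ⊆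
          {ω | ¬ D.Alarm (outcomesAt X ω) (E.start m - 1) (E.start m) (E.finish m)} :=
        fun ω hω hal => hω (MDB.Alarm.mono hal le_rfl (Nat.le_add_right _ _))
      -- Silence until the deadline includes silence before the changepoint, so its probability is
      -- the conditional one times that of no false alarm.
      refine (MDB.real_eq_mul_cond_real
        (hdep.not.measurableSet subset_rfl hX.measurable_outcome) hsub).trans_le ?_
      exact mul_le_mul_of_nonneg_right hq' measureReal_nonneg
  refine (hbounds.integral_regret_le hX).trans (add_le_add (add_le_add (le_of_eq ?_) ?_) le_rfl)
  · rw [hL]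
    push_cast
    ring
  · have := MDB.pairs_div_period_le hγ h3.2
    gcongr
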